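/- Conventions. A threshold tree on $\mathbb{R}^d$ is a binary tree in which every internal node carries a coordinate cut $(i,\theta)\in\Omega=\{1,\dots,d\}\times\mathbb{R}$ and sends the points with $x_i\le\theta$ to its left child and the points with $x_i>\theta$ to its right child. It partitions a finite data set $X\subset\mathbb{R}^d$ into clusters, one per leaf, and $\mathrm{cost}_{\ell_2^2}(X,T)$ is the sum over the leaves of the squared Euclidean distances of the points of the cluster to the mean of the cluster. For a set of centers $C=\{c^1,\dots,c^k\}$, let $\mathrm{cost}_{\ell_2^2}(X,C)=\sum_{x\in X}\min_j\|x-c^j\|_2^2$. A map $\varphi:\mathbb{R}^d\to\mathbb{R}^d$ is coordinate cut preserving if for every cut $(i,\theta)$ there is a cut $(i',\theta')$ with $\{x:x_{i'}\le\theta'\}=\{x:\varphi(x)_i\le\theta\}$, and vice versa. It is a terminal embedding of $\ell_2^2$ into $\ell_1$ with terminals $C$ and distortion $\alpha$ if $\|\varphi(x)-\varphi(c)\|_1\le\|x-c\|_2^2\le\alpha\|\varphi(x)-\varphi(c)\|_1$ for all $x\in\mathbb{R}^d$, $c\in C$. Let $\mu$ be the sum over the $d$ coordinates of the Lebesgue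 measures on $\mathbb{R}$, a measure on $\Omega$. Random Cut Algorithm for distinct centers $c^1,\dots,c^k$. Start with the tree $T_0$ that consists of its root. While some leaf of $T_t$ contains two distinct centers, let $E_t$ be the set of pairs $(i,j)$ such that $c^i,c^j$ are in the same leaf, let $S_{ij}\subset\Omega$ be the set of cuts that separate $c^i$ from $c^j$, and let $D_t=\max_{(i,j)\in E_t}\|c^i-c^j\|_1$, $A_t=\bigcup_{(i,j)\in E_t}S_{ij}$, $B_t=\bigcup_{(i,j)\in E_t,\ \mu(S_{ij})\le D_t/k^3}S_{ij}$. Pick $\omega_t$ uniformly at random (with respect to $\mu$) from $R_t=A_t\setminus B_t$; apply the cut $\omega_t$ to every leaf of $T_t$ for which both sides of the cut contain a center of that leaf; call the new tree $T_{t+1}$. Theorem. There are a randomized algorithm, a polynomial $q$ and a constant $A$ with the following properties. For all $d,k\ge1$ and every set $C=\{c^1,\dots,c^k\}\subset\mathbb{R}^d$ of $k$ distinct centers there is a coordinate cut preserving terminal embedding $\varphi$ of $\ell_2^2$ into $\ell_1$ with terminals $C$ and distortion $8k$ such that for every finite data set $X\subset\mathbb{R}^d$ the algorithm, on input $X$,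 $C$, halts within $q(k+d)$ steps and outputs a threshold tree $T$ with $k$ leaves, each containing exactly one center, where $T$ is obtained by running the Random Cut Algorithm on the centers $\varphi(c^1),\dots,\varphi(c^k)$ and replacing every cut of the resulting tree by its preimage under $\varphi$; and $$\mathbb{E}[\mathrm{cost}_{\ell_2^2}(X,T)]\le A\cdot k\cdot\max(1,\log k)\cdot\max(1,\log\log k)\cdot\mathrm{cost}_{\ell_2^2}(X,C).$$ Here algorithms are programs for a real RAM, whose elementary steps are exact arithmetic operations ($+,-,\times,/,\sqrt{\ }$) and comparisons on real numbers, addition, subtraction and comparison of natural numbers, access to indexed memory, and drawing of independent random numbers that are uniform on $[0,1)$. -/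

import Mathlib

open MeasureTheory

namespace ExplainableKMeans

noncomputable section

/-! ## Points, distances, cuts -/

/-- Points of `ℝ^d`, given by their coordinates. -/
abbrev Pt (d : ℕ) := Fin d → ℝ

/-- The `ℓ₁` distance. -/
def l1Dist {d : ℕ} (x y : Pt d) : ℝ := ∑ i, |x i - y i|

/-- The squared Euclidean distance. -/
def sqDist {d : ℕ} (x y : Pt d) : ℝ := ∑ i, (x i - y i) ^ 2

/-- A coordinate cut `(i, θ)`; it splits `ℝ^d` into `{x | x i ≤ θ}` and `{x | x i > θ}`. -/
abbrev Cut (d : ℕ) := Fin d × ℝ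

/-- The measure on cuts: `μ(S) = ∑ i, Lebesgue {θ | (i, θ) ∈ S}`. -/
def cutMeasure (d : ℕ) : Measure (Cut d) := (Measure.count : Measure (Fin d)).prod volume

/-- The cuts that separate `x` from `y`, that is, exactly one of `x i > θ`, `y i > θ` holds. -/
def sepCuts {d : ℕ} (x y : Pt d) : Set (Cut d) :=
  {w | ¬ (w.2 < x w.1 ↔ w.2 < y w.1)}

/-! ## Threshold trees and clustering costs -/

/-- Threshold trees. An internal node `(i, θ)` sends the points with `x i ≤ θ` to its left child
and the points with `x i > θ` to its right child. -/
inductive ThresholdTree (d : ℕ) : Type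
  | leaf : ThresholdTree d
  | node (i : Fin d) (θ : ℝ) (l r : ThresholdTree d) : ThresholdTree d

/-- The leaf to which the tree assigns `x`, as the path from the root (`false` = left). -/
def ThresholdTree.leafOf {d : ℕ} : ThresholdTree d → Pt d → List Bool
  | .leaf, _ => []
  | .node i θ l r, x => if x i ≤ θ then false :: l.leafOf x else true :: r.leafOf x

/-- The number of leaves. -/
def ThresholdTree.numLeaves {d : ℕ} : ThresholdTree d → ℕ
  | .leaf => 1
  | .node _ _ l r => l.numLeaves + r.numLeaves

/-- The mean of the data points with index in `S`. -/
def mean {d n : ℕ} (X : Fin n → Pt d) (S : Finset (Fin n)) : Pt d :=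
  fun i => (∑ a ∈ S, X a i) / (S.card : ℝ)

/-- The `k`-means cost of the partition which the tree induces on the data points with index
in `S`: the sum over the leaves of the squared distances to the mean of the cluster. -/
def ThresholdTree.costOn {d n : ℕ} (X : Fin n → Pt d) : ThresholdTree d → Finset (Fin n) → ℝ
  | .leaf, S => ∑ a ∈ S, sqDist (X a) (mean X S)
  | .node i θ l r, S =>
      l.costOn X (S.filter fun a => X a i ≤ θ) + r.costOn X (S.filter fun a => θ < X a i)

/-- The `k`-means cost of a threshold tree on the data set `X`. -/
def treeCost {d n : ℕ} (X : Fin n → Pt d) (T : ThresholdTree d) : ℝ := T.costOn X Finset.univ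

/-- The `k`-means cost of the centers `C` on the data set `X`: every point pays the squared
distance to its closest center. -/
def centersCost {d n k : ℕ} (X : Fin n → Pt d) (C : Fin k → Pt d) : ℝ :=
  ∑ a, ⨅ j, sqDist (X a) (C j)

/-! ## Terminal embeddings -/

/-- Coordinate cut preserving maps of `ℝ^d` to itself. -/
def CutPreserving {d : ℕ} (φ : Pt d → Pt d) : Prop :=
  (∀ w : Cut d, ∃ w' : Cut d, {x : Pt d | x w'.1 ≤ w'.2} = {x | φ x w.1 ≤ w.2}) ∧
  (∀ w' : Cut d, ∃ w : Cut d, {x : Pt d | x w'.1 ≤ w'.2} = {x | φ x w.1 ≤ w.2})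

/-- Terminal embeddings of squared Euclidean distances into `ℓ₁`, with set of terminals `K` and
distortion `α`. -/
def IsTerminalEmbedding {d : ℕ} (φ : Pt d → Pt d) (K : Set (Pt d)) (α : ℝ) : Prop :=
  ∀ x : Pt d, ∀ y ∈ K,
    l1Dist (φ x) (φ y) ≤ sqDist x y ∧ sqDist x y ≤ α * l1Dist (φ x) (φ y)

/-- `IsPullback φ T' T`: the tree `T` is obtained from `T'` by replacing the cut at every internal
node by the coordinate cut that is its preimage under `φ`. -/
def IsPullback {d : ℕ} (φ : Pt d → Pt d) : ThresholdTree d → ThresholdTree d → Prop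
  | .leaf, .leaf => True
  | .node i' θ' l' r', .node i θ l r =>
      {x : Pt d | x i ≤ θ} = {x | φ x i' ≤ θ'} ∧ IsPullback φ l' l ∧ IsPullback φ r' r
  | _, _ => False

/-! ## The random threshold tree for `k`-medians in `ℓ₁` -/

section Algorithm

variable {d k : ℕ}

/-- The pairs of centers that lie in the same leaf of `T` (the set `E_t`). -/
def unsepPairs (C : Fin k → Pt d) (T : ThresholdTree d) : Set (Fin k × Fin k) :=
  {p | T.leafOf (C p.1) = T.leafOf (C p.2)}

/-- No leaf of `T` contains two distinct centers. -/
def AllSeparated (C : Fin k → Pt d) (T : ThresholdTree d) : Prop :=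
  ∀ p ∈ unsepPairs C T, C p.1 = C p.2

/-- The largest `ℓ₁` distance between two centers in the same leaf (the number `D_t`). -/
def maxDist (C : Fin k → Pt d) (T : ThresholdTree d) : ℝ :=
  ⨆ p : unsepPairs C T, l1Dist (C p.1.1) (C p.1.2)

/-- The cuts that separate some pair of centers in the same leaf (the set `A_t`). -/
def cutsA (C : Fin k → Pt d) (T : ThresholdTree d) : Set (Cut d) :=
  ⋃ p ∈ unsepPairs C T, sepCuts (C p.1) (C p.2)

/-- The cuts that separate some pair of centers which are in the same leaf and for which
`μ(S_ij) ≤ D_t / k³` (the set `B_t`). -/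
def cutsB (C : Fin k → Pt d) (T : ThresholdTree d) : Set (Cut d) :=
  ⋃ p ∈ {p | p ∈ unsepPairs C T ∧
      cutMeasure d (sepCuts (C p.1) (C p.2)) ≤ ENNReal.ofReal (maxDist C T / (k : ℝ) ^ 3)},
    sepCuts (C p.1) (C p.2)

/-- The set `R_t = A_t \ B_t` from which the cut is chosen. -/
def cutsR (C : Fin k → Pt d) (T : ThresholdTree d) : Set (Cut d) := cutsA C T \ cutsB C T

open Classical in
/-- Apply the cut `w` to every leaf of a tree whose root holds the centers with index in `S`. A leaf
gets two children if both sides of the cut contain a center of that leaf. -/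
def splitLeaves (C : Fin k → Pt d) (w : Cut d) : ThresholdTree d → Set (Fin k) → ThresholdTree d
  | .leaf, S =>
      if (∃ j ∈ S, C j w.1 ≤ w.2) ∧ (∃ j ∈ S, w.2 < C j w.1) then .node w.1 w.2 .leaf .leaf
      else .leaf
  | .node i θ l r, S =>
      .node i θ (splitLeaves C w l {j ∈ S | C j i ≤ θ}) (splitLeaves C w r {j ∈ S | θ < C j i})

/-- The uniform distribution on `[0, 1)`. -/
def uniform01 : Measure ℝ := volume.restrict (Set.Ico 0 1)

instance : IsProbabilityMeasure uniform01 := ⟨by simp [uniform01]⟩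

/-- An infinite sequence of independent random numbers, uniform on `[0, 1)`. -/
def seedMeasure : Measure (ℕ → ℝ) := Measure.infinitePi fun _ => uniform01

/-- The sequences of numbers in `[0, 1)`. -/
def Seeds : Set (ℕ → ℝ) := {u | ∀ j, u j ∈ Set.Ico (0 : ℝ) 1}

/-- `pick T u` turns a random number `u`, uniform on `[0, 1)`, into a uniformly random element
of `R_t`, for every tree `T = T_t` with which the algorithm has not finished. -/
def IsUniformChoice (C : Fin k → Pt d) (pick : ThresholdTree d → ℝ → Cut d) : Prop :=
  ∀ T, ¬ AllSeparated C T →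
    (∀ u ∈ Set.Ico (0 : ℝ) 1, pick T u ∈ cutsR C T) ∧
    Measure.map (pick T) uniform01 = ProbabilityTheory.cond (cutMeasure d) (cutsR C T)

open Classical in
/-- The tree `T_t` after `t` rounds, where round `t` uses the random number `u t`. Nothing changes
after all centers are separated. (The data points assigned to a node do not influence the
construction of the tree.) -/
def treeSeq (C : Fin k → Pt d) (pick : ThresholdTree d → ℝ → Cut d) (u : ℕ → ℝ) : ℕ → ThresholdTree d
  | 0 => .leaf
  | t + 1 =>
      if AllSeparated C (treeSeq C pick u t) then treeSeq C pick u t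
      else splitLeaves C (pick (treeSeq C pick u t) (u t)) (treeSeq C pick u t) Set.univ

/-- `T` is the tree that the algorithm returns on the random numbers `u`. -/
def Returns (C : Fin k → Pt d) (pick : ThresholdTree d → ℝ → Cut d) (u : ℕ → ℝ) (T : ThresholdTree d) : Prop :=
  ∃ t, AllSeparated C (treeSeq C pick u t) ∧ T = treeSeq C pick u t

end Algorithm

/-! ## A randomized real RAM

The memory consists of two-dimensional arrays of natural numbers and of two-dimensional arrays of
real numbers; arrays are named by natural numbers. A program is a fixed finite while-program. Natural
numbers can be added, subtracted (truncated at zero) and compared, and serve as indices. Real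
numbers admit exact `+`, `-`, `*`, `/`, `√` and comparisons; there is no rounding of reals to
integers. Random numbers uniform on `[0, 1)` can be drawn. -/

/-- Expressions for natural numbers; `get a i j` reads the cell `(i, j)` of array `a`. -/
inductive NExpr : Type
  | lit (c : ℕ) : NExpr
  | get (a : ℕ) (i j : NExpr) : NExpr
  | add (e f : NExpr) : NExpr
  | sub (e f : NExpr) : NExpr

/-- Expressions for real numbers; only rational constants occur. -/
inductive RExpr : Type
  | lit (q : ℚ) : RExpr
  | get (a : ℕ) (i j : NExpr) : RExpr
  | ofNat (e : NExpr) : RExpr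
  | add (e f : RExpr) : RExpr
  | sub (e f : RExpr) : RExpr
  | mul (e f : RExpr) : RExpr
  | div (e f : RExpr) : RExpr
  | sqrt (e : RExpr) : RExpr

/-- Tests. -/
inductive Test : Type
  | natLE (e f : NExpr) : Test
  | realLE (e f : RExpr) : Test
  | neg (b : Test) : Test
  | conj (b c : Test) : Test

/-- Programs. `sample a i j` draws a random number into the cell `(i, j)` of real array `a`. -/
inductive Prog : Type
  | skip : Prog
  | setNat (a : ℕ) (i j e : NExpr) : Prog
  | setReal (a : ℕ) (i j : NExpr) (e : RExpr) : Prog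
  | sample (a : ℕ) (i j : NExpr) : Prog
  | seq (p q : Prog) : Prog
  | ite (b : Test) (p q : Prog) : Prog
  | while (b : Test) (p : Prog) : Prog

/-- Memory, together with the number of random numbers drawn so far. -/
structure Mem where
  nat : ℕ → ℕ → ℕ → ℕ
  real : ℕ → ℕ → ℕ → ℝ
  drawn : ℕ

/-- Write `v` into the cell `(i, j)` of the array `a`. -/
def update {α : Type} (m : ℕ → ℕ → ℕ → α) (a i j : ℕ) (v : α) : ℕ → ℕ → ℕ → α :=
  fun a' i' j' => if a' = a ∧ i' = i ∧ j' = j then v else m a' i' j'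

def NExpr.eval (s : Mem) : NExpr → ℕ
  | .lit c => c
  | .get a i j => s.nat a (i.eval s) (j.eval s)
  | .add e f => e.eval s + f.eval s
  | .sub e f => e.eval s - f.eval s

def RExpr.eval (s : Mem) : RExpr → ℝ
  | .lit q => (q : ℝ)
  | .get a i j => s.real a (i.eval s) (j.eval s)
  | .ofNat e => ((e.eval s : ℕ) : ℝ)
  | .add e f => e.eval s + f.eval s
  | .sub e f => e.eval s - f.eval s
  | .mul e f => e.eval s * f.eval s
  | .div e f => e.eval s / f.eval s
  | .sqrt e => Real.sqrt (e.eval s)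

def Test.holds (s : Mem) : Test → Prop
  | .natLE e f => e.eval s ≤ f.eval s
  | .realLE e f => e.eval s ≤ f.eval s
  | .neg b => ¬ b.holds s
  | .conj b c => b.holds s ∧ c.holds s

/-- The number of elementary operations in the evaluation of an expression. -/
def NExpr.size : NExpr → ℕ
  | .lit _ => 1
  | .get _ i j => 1 + i.size + j.size
  | .add e f => 1 + e.size + f.size
  | .sub e f => 1 + e.size + f.size

def RExpr.size : RExpr → ℕ
  | .lit _ => 1
  | .get _ i j => 1 + i.size + j.size
  | .ofNat e => 1 + e.size
  | .add e f => 1 + e.size + f.size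
  | .sub e f => 1 + e.size + f.size
  | .mul e f => 1 + e.size + f.size
  | .div e f => 1 + e.size + f.size
  | .sqrt e => 1 + e.size

def Test.size : Test → ℕ
  | .natLE e f => 1 + e.size + f.size
  | .realLE e f => 1 + e.size + f.size
  | .neg b => 1 + b.size
  | .conj b c => 1 + b.size + c.size

/-- `Exec u p s t s'`: with the random numbers `u`, the program `p` started in the memory `s` halts
after exactly `t` elementary steps in the memory `s'`. -/
inductive Exec (u : ℕ → ℝ) : Prog → Mem → ℕ → Mem → Prop
  | skip (s : Mem) : Exec u .skip s 1 s
  | setNat (a : ℕ) (i j e : NExpr) (s : Mem) :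
      Exec u (.setNat a i j e) s (1 + i.size + j.size + e.size)
        { s with nat := update s.nat a (i.eval s) (j.eval s) (e.eval s) }
  | setReal (a : ℕ) (i j : NExpr) (e : RExpr) (s : Mem) :
      Exec u (.setReal a i j e) s (1 + i.size + j.size + e.size)
        { s with real := update s.real a (i.eval s) (j.eval s) (e.eval s) }
  | sample (a : ℕ) (i j : NExpr) (s : Mem) :
      Exec u (.sample a i j) s (1 + i.size + j.size)
        { s with
          real := update s.real a (i.eval s) (j.eval s) (u s.drawn)
          drawn := s.drawn + 1 }
  | seq {p q : Prog} {s s' s'' : Mem} {t t' : ℕ} :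
      Exec u p s t s' → Exec u q s' t' s'' → Exec u (.seq p q) s (t + t') s''
  | iteTrue {b : Test} {p q : Prog} {s s' : Mem} {t : ℕ} :
      b.holds s → Exec u p s t s' → Exec u (.ite b p q) s (1 + b.size + t) s'
  | iteFalse {b : Test} {p q : Prog} {s s' : Mem} {t : ℕ} :
      ¬ b.holds s → Exec u q s t s' → Exec u (.ite b p q) s (1 + b.size + t) s'
  | whileFalse {b : Test} {p : Prog} {s : Mem} :
      ¬ b.holds s → Exec u (.while b p) s (1 + b.size) s
  | whileTrue {b : Test} {p : Prog} {s s' s'' : Mem} {t t' : ℕ} :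
      b.holds s → Exec u p s t s' → Exec u (.while b p) s' t' s'' →
        Exec u (.while b p) s (1 + b.size + t + t') s''

/-- The initial memory: `n`, `d`, `k` are in the first row of natural array `0`, the data points are
the rows of real array `0` and the centers are the rows of real array `1`; all else is `0`. -/
def inputMem {n d k : ℕ} (X : Fin n → Pt d) (C : Fin k → Pt d) : Mem where
  nat a i j :=
    if a = 0 ∧ i = 0 then (if j = 0 then n else if j = 1 then d else if j = 2 then k else 0) else 0
  real a i j :=
    if h : j < d then
      if a = 0 then (if h' : i < n then X ⟨i, h'⟩ ⟨j, h⟩ else 0)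
      else if a = 1 then (if h' : i < k then C ⟨i, h'⟩ ⟨j, h⟩ else 0)
      else 0
    else 0
  drawn := 0

/-- `Stores s v T`: the memory `s` holds the tree `T` with root at address `v`. Row `v` of natural
array `1` is `0, …` for a leaf, and `1, i, a, b` for an internal node with coordinate `i` and
children at the addresses `a`, `b`; its threshold is in the cell `(v, 0)` of real array `2`. -/
inductive Stores {d : ℕ} (s : Mem) : ℕ → ThresholdTree d → Prop
  | leaf {v : ℕ} : s.nat 1 v 0 = 0 → Stores s v .leaf
  | node {v : ℕ} {i : Fin d} {l r : ThresholdTree d} :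
      s.nat 1 v 0 = 1 → s.nat 1 v 1 = (i : ℕ) →
      Stores s (s.nat 1 v 2) l → Stores s (s.nat 1 v 3) r →
      Stores s v (.node i (s.real 2 v 0) l r)

/-- With the random numbers `u`, the program `P` halts on the input `X`, `C` within `b` elementary
steps, and its output is the threshold tree `T` (with its root at address `0`). -/
def Outputs {n d k : ℕ} (P : Prog) (X : Fin n → Pt d) (C : Fin k → Pt d) (u : ℕ → ℝ) (b : ℕ)
    (T : ThresholdTree d) : Prop :=
  ∃ t s, t ≤ b ∧ Exec u P (inputMem X C) t s ∧ Stores s 0 T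

end

end ExplainableKMeans

/-!
# Explainable `k`-means through a terminal embedding into `ℓ₁`

The `i`-th coordinate of the embedding `termEmbed C` is the primitive of twice the distance to the set
of the `i`-th coordinates of the centers. From a center `c` on it grows at most like `(x - c) ^ 2`; on
the other hand, half of an interval of length `L` has distance at least `L / (4 k)` from `k` points,
so that it grows by at least `L ^ 2 / (4 k)` on every such interval (`sq_le_embed_sub`). The triangle
inequality for the square roots is not needed: a bound for the distance of the images of a data point
and of the center in its leaf bounds the squared distance up to a factor `8 k`. As each coordinate is
a strictly increasing bijection, cuts correspond to cuts.

It remains to bound, for the random cuts in `ℓ₁`, the expected distance of a point `x` to the center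
which ends up in the leaf of `x`, by `O(log k log log k)` times the distance to any given center `c`.
This depends on the cuts only through the sets of points that they separate, so it is treated in a
finite system of weighted cuts (`CutSystem`) as a Markov chain on partitions. Let `D` be the diameter
of a partition and `W` the weight of the cuts that may be chosen. A pair of centers in one cluster
with distance at least `θ` is separated with probability at least `D / (4 W)` while `D` is in
`[θ, 2 θ)`, so that the number `N` of such pairs drops by this fraction; hence `1 + log N` is a
potential which shows that the expected sum of `D / W` over the rounds with `D` in `[θ, 2 θ)` is
`O(log k)` (`occ_window_le`). A cut is available only while `D` stays within a factor `k ^ 3`, and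
if it separates `x` from `c`, then `x` ends up at distance at most `D` from `c`. This gives the
factor `O(log² k)` (`iterate_finalDist_le_crude`). For the better bound, consider the center nearest to
`x` among those that remain in its cluster after the separation. If its distance to `x` is below
`D / log⁴ k`, then the crude bound, applied to this center, costs only `O(D / log² k)`; and since this
distance can only grow and `D` can only shrink, it is at least `D / log⁴ k` at only `O(log log k)`
scales (`iterate_finalDist_le_refined`).

For the algorithm, the coordinates of the centers divide each axis into cells whose images under the
embedding have rational lengths in terms of the centers, and the cuts in one cell separate the same
centers. So a cut is chosen by choosing a cell with probability proportional to its length, if its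
cuts may be chosen, and a uniformly random cut in it (`cellPick`); its preimage is obtained by a
square root (`embed_gapPoint`). The program runs `k` rounds, which suffice as each round splits a
leaf, and consists of nested bounded loops (`LoopProg`), so that its running time is a polynomial by
construction (`exec_compile`). Its correctness is shown by loop invariants (`randomCut_stores`).
-/

open MeasureTheory

namespace ExplainableKMeans

noncomputable section

set_option linter.unusedSectionVars false

/-! ### Finite systems of weighted cuts -/

/-- A finite system of weighted cuts on a finite set `P` of points, some of which are centers. -/
structure CutSystem (P K Ω : Type) where
  center : K → P
  side : Ω → P → Prop
  weight : Ω → ℝ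
  weight_nonneg : ∀ ω, 0 ≤ weight ω

namespace CutSystem

variable {P K Ω : Type} [Fintype K] [Fintype Ω] (M : CutSystem P K Ω)

/-- The cut `ω` separates `p` from `q`. -/
def Sep (ω : Ω) (p q : P) : Prop := ¬ (M.side ω p ↔ M.side ω q)

open Classical in
/-- The cut semimetric: the total weight of the cuts that separate two points. -/
def dist (p q : P) : ℝ := ∑ ω, if M.Sep ω p q then M.weight ω else 0

/-- The largest distance between two centers that are related by `r`. -/
def diam (r : P → P → Prop) : ℝ :=
  ⨆ z : {z : K × K // r (M.center z.1) (M.center z.2)}, M.dist (M.center z.1.1) (M.center z.1.2)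

/-- The cut `ω` separates two related centers that are very close compared to the diameter. -/
def InB (r : P → P → Prop) (ω : Ω) : Prop :=
  ∃ i j, r (M.center i) (M.center j) ∧ M.Sep ω (M.center i) (M.center j) ∧
    M.dist (M.center i) (M.center j) ≤ M.diam r / (Fintype.card K : ℝ) ^ 3

/-- The cut `ω` may be chosen when the points are clustered according to `r`. -/
def Avail (r : P → P → Prop) (ω : Ω) : Prop :=
  (∃ i j, r (M.center i) (M.center j) ∧ M.Sep ω (M.center i) (M.center j)) ∧ ¬ M.InB r ω

open Classical in
/-- The total weight of the cuts that may be chosen. -/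
def mass (r : P → P → Prop) : ℝ := ∑ ω, if M.Avail r ω then M.weight ω else 0

/-- All centers are in different clusters. -/
def Done (r : P → P → Prop) : Prop := ∀ i j, r (M.center i) (M.center j) → i = j

/-- The clustering after the cut `ω` has been applied to every cluster that has centers on both
sides of the cut. -/
def step (r : P → P → Prop) (ω : Ω) : P → P → Prop := fun p q =>
  r p q ∧ ((M.side ω p ↔ M.side ω q) ∨
    ∀ i j, r p (M.center i) → r p (M.center j) → (M.side ω (M.center i) ↔ M.side ω (M.center j)))

open Classical in
/-- The expected value of `g` after a random cut. -/
def next (g : (P → P → Prop) → ℝ) (r : P → P → Prop) : ℝ :=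
  ∑ ω, if M.Avail r ω then M.weight ω / M.mass r * g (M.step r ω) else 0

open Classical in
/-- The expected value of `g` after one round of the process, which stands still once all centers
are in different clusters. -/
def avg (g : (P → P → Prop) → ℝ) (r : P → P → Prop) : ℝ :=
  if M.Done r then g r else M.next g r

open Classical in
/-- The expected sum of the values of `g` over the first `m` rounds in which a cut is made. -/
def occ (g : (P → P → Prop) → ℝ) : ℕ → (P → P → Prop) → ℝ
  | 0, _ => 0
  | m + 1, r => if M.Done r then 0 else g r + M.next (occ g m) r

/-- Clusterings in which every cluster contains a center. -/
structure Valid (r : P → P → Prop) : Prop where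
  equiv : Equivalence r
  center : ∀ p, ∃ i, r p (M.center i)

/-- `r'` is a valid refinement of `r`. -/
def Refines (r' r : P → P → Prop) : Prop := M.Valid r' ∧ ∀ p q, r' p q → r p q

variable {M}

lemma Sep.symm {ω : Ω} {p q : P} (h : M.Sep ω p q) : M.Sep ω q p := fun h' => h h'.symm

lemma dist_nonneg (p q : P) : 0 ≤ M.dist p q :=
  Finset.sum_nonneg fun ω _ => by split_ifs <;> simp [M.weight_nonneg]

lemma dist_comm (p q : P) : M.dist p q = M.dist q p := by
  classical
  unfold dist
  refine Finset.sum_congr rfl fun ω _ => ?_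
  by_cases h : M.Sep ω p q
  · rw [if_pos h, if_pos h.symm]
  · rw [if_neg h, if_neg fun h' => h h'.symm]

lemma dist_self (p : P) : M.dist p p = 0 := by simp [dist, Sep]

lemma dist_triangle (p q s : P) : M.dist p s ≤ M.dist p q + M.dist q s := by
  unfold dist
  rw [← Finset.sum_add_distrib]
  refine Finset.sum_le_sum fun ω _ => ?_
  have := M.weight_nonneg ω
  by_cases h1 : M.Sep ω p q <;> by_cases h2 : M.Sep ω q s <;> by_cases h3 : M.Sep ω p s <;>
    simp [h1, h2, h3, this]
  exact absurd ((not_not.1 h1).trans (not_not.1 h2)) h3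

lemma diam_bdd (r : P → P → Prop) : BddAbove (Set.range
    fun z : {z : K × K // r (M.center z.1) (M.center z.2)} =>
      M.dist (M.center z.1.1) (M.center z.1.2)) := (Set.finite_range _).bddAbove

lemma dist_le_diam {r : P → P → Prop} {i j : K} (h : r (M.center i) (M.center j)) :
    M.dist (M.center i) (M.center j) ≤ M.diam r :=
  le_ciSup (M.diam_bdd r) ⟨(i, j), h⟩

lemma diam_nonneg (r : P → P → Prop) : 0 ≤ M.diam r :=
  Real.iSup_nonneg fun _ => dist_nonneg _ _

lemma diam_mono {r r' : P → P → Prop} (h : ∀ p q, r' p q → r p q) : M.diam r' ≤ M.diam r :=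
  Real.iSup_le (fun z => dist_le_diam (h _ _ z.2)) (diam_nonneg r)

lemma exists_dist_eq_diam {r : P → P → Prop} {i : K} (hi : r (M.center i) (M.center i)) :
    ∃ i j, r (M.center i) (M.center j) ∧ M.dist (M.center i) (M.center j) = M.diam r := by
  have : Nonempty {z : K × K // r (M.center z.1) (M.center z.2)} := ⟨⟨(i, i), hi⟩⟩
  obtain ⟨z, hz⟩ := exists_eq_ciSup_of_finite
    (f := fun z : {z : K × K // r (M.center z.1) (M.center z.2)} =>
      M.dist (M.center z.1.1) (M.center z.1.2))
  exact ⟨_, _, z.2, hz⟩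

lemma Valid.step {r : P → P → Prop} (hr : M.Valid r) (ω : Ω) : M.Valid (M.step r ω) := by
  have e := hr.equiv
  refine ⟨⟨fun p => ⟨e.refl p, Or.inl Iff.rfl⟩, ?_, ?_⟩, ?_⟩
  · rintro p q ⟨h, h'⟩
    refine ⟨e.symm h, h'.imp Iff.symm fun h'' i j hi hj => h'' i j (e.trans h hi) (e.trans h hj)⟩
  · rintro p q s ⟨h, h'⟩ ⟨k, k'⟩
    refine ⟨e.trans h k, ?_⟩
    rcases h' with h' | h'
    · rcases k' with k' | k'
      · exact Or.inl (h'.trans k')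
      · exact Or.inr fun i j hi hj => k' i j (e.trans (e.symm h) hi) (e.trans (e.symm h) hj)
    · exact Or.inr h'
  · intro p
    by_cases h : ∃ i, r p (M.center i) ∧ (M.side ω p ↔ M.side ω (M.center i))
    · obtain ⟨i, hi, hi'⟩ := h
      exact ⟨i, hi, Or.inl hi'⟩
    · push Not at h
      obtain ⟨i, hi⟩ := hr.center p
      refine ⟨i, hi, Or.inr fun a b ha hb => ?_⟩
      have h1 := h a ha
      have h2 := h b hb
      tauto

lemma Refines.refl {r : P → P → Prop} (hr : M.Valid r) : M.Refines r r := ⟨hr, fun _ _ h => h⟩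

lemma Refines.trans {r r' r'' : P → P → Prop} (h : M.Refines r'' r') (h' : M.Refines r' r) :
    M.Refines r'' r := ⟨h.1, fun p q hpq => h'.2 p q (h.2 p q hpq)⟩

lemma Refines.step {r : P → P → Prop} (hr : M.Valid r) (ω : Ω) : M.Refines (M.step r ω) r :=
  ⟨hr.step ω, fun _ _ h => h.1⟩

/-! ### The mass of the available cuts -/

open Classical in
/-- Most of the cuts between two related centers may be chosen, if their distance is comparable to the
diameter: fewer than `k²` ordered pairs of centers are very close, so that the cuts that separate
them have total weight at most `k (k - 1) / k³ ≤ 1 / 4` times the diameter. -/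
lemma mass_sep_ge [Nontrivial K] {r : P → P → Prop} {i j : K}
    (hij : r (M.center i) (M.center j)) :
    M.dist (M.center i) (M.center j) - M.diam r / 4 ≤
      ∑ ω, if M.Avail r ω ∧ M.Sep ω (M.center i) (M.center j) then M.weight ω else 0 := by
  set k : ℝ := (Fintype.card K : ℝ) with hk
  have hk2 : (2 : ℝ) ≤ k := by
    rw [hk]; exact_mod_cast Fintype.one_lt_card (α := K)
  have hB : (∑ ω, if M.InB r ω then M.weight ω else 0) ≤ M.diam r / 4 := by
    let near : Finset (K × K) := Finset.univ.offDiag.filter fun z =>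
      r (M.center z.1) (M.center z.2) ∧ M.dist (M.center z.1) (M.center z.2) ≤ M.diam r / k ^ 3
    have h1 : (∑ ω, if M.InB r ω then M.weight ω else 0) ≤
        ∑ ω, ∑ z ∈ near, if M.Sep ω (M.center z.1) (M.center z.2) then M.weight ω else 0 := by
      refine Finset.sum_le_sum fun ω _ => ?_
      have hnn : ∀ z ∈ near, 0 ≤ (if M.Sep ω (M.center z.1) (M.center z.2) then M.weight ω else 0) :=
        fun z _ => by split_ifs <;> simp [M.weight_nonneg]
      split_ifs with h
      · obtain ⟨a, b, hab, hs, hd⟩ := h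
        have hne : a ≠ b := by rintro rfl; exact hs Iff.rfl
        have hmem : (a, b) ∈ near := by simp [near, hne, hab]; exact hd
        refine le_trans ?_ (Finset.single_le_sum hnn hmem)
        simp [hs]
      · exact Finset.sum_nonneg hnn
    rw [Finset.sum_comm] at h1
    have h2 : ∀ z ∈ near, (∑ ω, if M.Sep ω (M.center z.1) (M.center z.2) then M.weight ω else 0) ≤
        M.diam r / k ^ 3 := fun z hz => (Finset.mem_filter.1 hz).2.2
    have h3 := Finset.sum_le_sum h2
    rw [Finset.sum_const, nsmul_eq_mul] at h3
    have h4 : ((near.card : ℕ) : ℝ) ≤ k * k - k := by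
      have : near.card ≤ Fintype.card K * Fintype.card K - Fintype.card K := by
        refine (Finset.card_filter_le _ _).trans ?_
        simp [Finset.offDiag_card]
      have h5 : Fintype.card K ≤ Fintype.card K * Fintype.card K := Nat.le_mul_self _
      calc ((near.card : ℕ) : ℝ) ≤ ((Fintype.card K * Fintype.card K - Fintype.card K : ℕ) : ℝ) := by
            exact_mod_cast this
        _ = _ := by rw [Nat.cast_sub h5]; push_cast; rfl
    have hD := M.diam_nonneg r
    have h6 : (k * k - k) * (M.diam r / k ^ 3) ≤ M.diam r / 4 := by
      rw [mul_div_assoc', div_le_div_iff₀ (by positivity) (by norm_num)]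
      have : (k * k - k) * 4 ≤ k ^ 3 := by nlinarith [mul_nonneg (by linarith : 0 ≤ k) (sq_nonneg (k - 2))]
      nlinarith
    have h7 : 0 ≤ M.diam r / k ^ 3 := by positivity
    nlinarith [mul_le_mul_of_nonneg_right h4 h7]
  have h : M.dist (M.center i) (M.center j) ≤
      (∑ ω, if M.Avail r ω ∧ M.Sep ω (M.center i) (M.center j) then M.weight ω else 0) +
        ∑ ω, if M.InB r ω then M.weight ω else 0 := by
    rw [← Finset.sum_add_distrib]
    refine Finset.sum_le_sum fun ω _ => ?_
    have := M.weight_nonneg ω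
    by_cases h1 : M.Sep ω (M.center i) (M.center j)
    · by_cases h2 : M.InB r ω
      · simp only [h1, h2, if_true]; split_ifs <;> linarith
      · have : M.Avail r ω := ⟨⟨i, j, hij, h1⟩, h2⟩
        simp [h1, h2, this]
    · simp only [h1, and_false, if_false]; split_ifs <;> linarith
  linarith

variable (M) in
/-- Distinct centers have positive distance. -/
def Separated : Prop := ∀ i j, i ≠ j → 0 < M.dist (M.center i) (M.center j)

lemma diam_pos (hM : M.Separated) {r : P → P → Prop} (hd : ¬ M.Done r) : 0 < M.diam r := by
  unfold Done at hd; push Not at hd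
  obtain ⟨i, j, h, hij⟩ := hd
  exact (hM i j hij).trans_le (dist_le_diam h)

lemma mass_pos (hM : M.Separated) {r : P → P → Prop} (hr : M.Valid r) (hd : ¬ M.Done r) :
    0 < M.mass r := by
  classical
  have hD := diam_pos hM hd
  have hd' := hd
  unfold Done at hd'; push Not at hd'
  obtain ⟨a, b, -, hab⟩ := hd'
  have : Nontrivial K := ⟨a, b, hab⟩
  obtain ⟨i, j, hij, h⟩ := exists_dist_eq_diam (M := M) (hr.equiv.refl (M.center a))
  have h1 := mass_sep_ge hij
  have h2 : (∑ ω, if M.Avail r ω ∧ M.Sep ω (M.center i) (M.center j) then M.weight ω else 0) ≤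
      M.mass r := Finset.sum_le_sum fun ω _ => by
    have := M.weight_nonneg ω
    split_ifs <;> first | linarith | tauto
  linarith

lemma mass_nonneg (r : P → P → Prop) : 0 ≤ M.mass r :=
  Finset.sum_nonneg fun ω _ => by split_ifs <;> simp [M.weight_nonneg]

/-! ### Expectations -/

lemma next_const (hM : M.Separated) {r : P → P → Prop} (hr : M.Valid r) (hd : ¬ M.Done r) (c : ℝ) :
    M.next (fun _ => c) r = c := by
  classical
  have h := (mass_pos hM hr hd).ne'
  have : M.next (fun _ => c) r = (∑ ω, if M.Avail r ω then M.weight ω else 0) * (c / M.mass r) := by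
    unfold next
    rw [Finset.sum_mul]
    refine Finset.sum_congr rfl fun ω _ => ?_
    split_ifs <;> ring
  rw [this]
  change M.mass r * _ = c
  field_simp

lemma next_add (f g : (P → P → Prop) → ℝ) (r : P → P → Prop) :
    M.next (fun s => f s + g s) r = M.next f r + M.next g r := by
  unfold next
  rw [← Finset.sum_add_distrib]
  refine Finset.sum_congr rfl fun ω _ => ?_
  split_ifs <;> ring

lemma next_mul (c : ℝ) (g : (P → P → Prop) → ℝ) (r : P → P → Prop) :
    M.next (fun s => c * g s) r = c * M.next g r := by
  unfold next
  rw [Finset.mul_sum]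
  refine Finset.sum_congr rfl fun ω _ => ?_
  split_ifs <;> ring

lemma next_sum {α : Type} (t : Finset α) (g : α → (P → P → Prop) → ℝ) (r : P → P → Prop) :
    M.next (fun s => ∑ a ∈ t, g a s) r = ∑ a ∈ t, M.next (g a) r := by
  unfold next
  rw [Finset.sum_comm]
  refine Finset.sum_congr rfl fun ω _ => ?_
  split_ifs
  · rw [Finset.mul_sum]
  · simp

lemma next_mono {f g : (P → P → Prop) → ℝ} {r : P → P → Prop}
    (h : ∀ ω, M.Avail r ω → f (M.step r ω) ≤ g (M.step r ω)) : M.next f r ≤ M.next g r := by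
  unfold next
  refine Finset.sum_le_sum fun ω _ => ?_
  split_ifs with ha
  · exact mul_le_mul_of_nonneg_left (h ω ha) (div_nonneg (M.weight_nonneg ω) (mass_nonneg r))
  · exact le_rfl

lemma next_nonneg {g : (P → P → Prop) → ℝ} (h : ∀ s, 0 ≤ g s) (r : P → P → Prop) :
    0 ≤ M.next g r := by
  refine Finset.sum_nonneg fun ω _ => ?_
  split_ifs with ha
  · exact mul_nonneg (div_nonneg (M.weight_nonneg ω) (mass_nonneg r)) (h _)
  · exact le_rfl

lemma occ_nonneg {g : (P → P → Prop) → ℝ} (h : ∀ s, 0 ≤ g s) (m : ℕ) (r : P → P → Prop) :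
    0 ≤ M.occ g m r := by
  induction m generalizing r with
  | zero => exact le_rfl
  | succ m ih =>
    unfold occ; split_ifs
    · exact le_rfl
    · exact add_nonneg (h r) (next_nonneg ih r)

/-- A function `V ≥ 0` that decreases by at least `g` in expectation bounds the expected sum of
the values of `g`. -/
lemma occ_le_of_drift {g V : (P → P → Prop) → ℝ} {r₀ : P → P → Prop}
    (hV : ∀ r, 0 ≤ V r)
    (h : ∀ r, M.Refines r r₀ → ¬ M.Done r → g r + M.next V r ≤ V r) (m : ℕ) :
    ∀ r, M.Refines r r₀ → M.occ g m r ≤ V r := by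
  induction m with
  | zero => intro r _; exact hV r
  | succ m ih =>
    intro r hr
    unfold occ; split_ifs with hd
    · exact hV r
    · refine le_trans ?_ (h r hr hd)
      gcongr
      exact next_mono fun ω _ => ih _ ((Refines.step hr.1 ω).trans hr)

lemma occ_mono {f g : (P → P → Prop) → ℝ} {r₀ : P → P → Prop}
    (h : ∀ r, M.Refines r r₀ → ¬ M.Done r → f r ≤ g r) (m : ℕ) :
    ∀ r, M.Refines r r₀ → M.occ f m r ≤ M.occ g m r := by
  induction m with
  | zero => intro r _; exact le_rfl
  | succ m ih =>
    intro r hr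
    unfold occ; split_ifs with hd
    · exact le_rfl
    · exact add_le_add (h r hr hd) (next_mono fun ω _ => ih _ ((Refines.step hr.1 ω).trans hr))

lemma iterate_avg_le (hM : M.Separated) {g : (P → P → Prop) → ℝ} {r₀ : P → P → Prop} {B : ℝ}
    (h : ∀ r, M.Refines r r₀ → g r ≤ B) (m : ℕ) :
    ∀ r, M.Refines r r₀ → M.avg^[m] g r ≤ B := by
  induction m with
  | zero => exact h
  | succ m ih =>
    intro r hr
    rw [Function.iterate_succ_apply']
    unfold avg; split_ifs with hd
    · exact ih r hr
    · refine (next_mono (g := fun _ => B) fun ω _ => ih _ ((Refines.step hr.1 ω).trans hr)).trans ?_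
      rw [next_const hM hr.1 hd]

lemma iterate_avg_mono {f g : (P → P → Prop) → ℝ} {r₀ : P → P → Prop}
    (h : ∀ r, M.Refines r r₀ → f r ≤ g r) (m : ℕ) :
    ∀ r, M.Refines r r₀ → M.avg^[m] f r ≤ M.avg^[m] g r := by
  induction m with
  | zero => exact h
  | succ m ih =>
    intro r hr
    rw [Function.iterate_succ_apply', Function.iterate_succ_apply']
    unfold avg; split_ifs with hd
    · exact ih r hr
    · exact next_mono fun ω _ => ih _ ((Refines.step hr.1 ω).trans hr)

lemma iterate_avg_add_const (hM : M.Separated) (g : (P → P → Prop) → ℝ) (c : ℝ) (m : ℕ) :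
    ∀ r, M.Valid r → M.avg^[m] (fun s => c + g s) r = c + M.avg^[m] g r := by
  induction m with
  | zero => intro r _; rfl
  | succ m ih =>
    intro r hr
    rw [Function.iterate_succ_apply', Function.iterate_succ_apply']
    by_cases hd : M.Done r
    · rw [avg, if_pos hd, avg, if_pos hd, ih r hr]
    · rw [avg, if_neg hd, avg, if_neg hd]
      conv_rhs => rw [← next_const hM hr hd c, ← next_add]
      refine Finset.sum_congr rfl fun ω _ => ?_
      rw [ih _ (hr.step ω)]

/-! ### The time spent in a range of diameters -/

/-- The function `N ↦ 1 + log N`, continued by `0 ↦ 0`. -/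
def logPot (N : ℕ) : ℝ := if N = 0 then 0 else 1 + Real.log N

lemma logPot_nonneg (N : ℕ) : 0 ≤ logPot N := by
  unfold logPot; split_ifs with h
  · exact le_rfl
  · have : (1 : ℝ) ≤ N := by exact_mod_cast Nat.pos_of_ne_zero h
    have := Real.log_nonneg this
    linarith

/-- The tangent to the logarithm at `N` lies above its graph. -/
lemma logPot_le {N N' : ℕ} (hN : N ≠ 0) : logPot N' ≤ logPot N - ((N : ℝ) - N') / N := by
  have hN' : (0 : ℝ) < N := by exact_mod_cast Nat.pos_of_ne_zero hN
  unfold logPot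
  rw [if_neg hN]
  split_ifs with h
  · have : (1 : ℝ) ≤ N := by exact_mod_cast Nat.pos_of_ne_zero hN
    have := Real.log_nonneg this
    rw [h, Nat.cast_zero, sub_zero, div_self hN'.ne']
    linarith
  · have h0 : (0 : ℝ) < N' := by exact_mod_cast Nat.pos_of_ne_zero h
    have := Real.log_le_sub_one_of_pos (div_pos h0 hN')
    rw [Real.log_div h0.ne' hN'.ne'] at this
    have h2 : ((N : ℝ) - N') / N = 1 - N' / N := by field_simp
    linarith

lemma logPot_mono {N N' : ℕ} (h : N' ≤ N) : logPot N' ≤ logPot N := by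
  by_cases hN : N = 0
  · have : N' = 0 := by omega
    rw [hN, this]
  · have := logPot_le (N' := N') hN
    have h1 : (N' : ℝ) ≤ N := by exact_mod_cast h
    have h2 : 0 ≤ ((N : ℝ) - N') / N := div_nonneg (by linarith) (by positivity)
    linarith

open Classical in
variable (M) in
/-- The pairs of related centers with distance at least `θ`. -/
def farPairs (θ : ℝ) (r : P → P → Prop) : Finset (K × K) :=
  Finset.univ.filter fun z =>
    r (M.center z.1) (M.center z.2) ∧ θ ≤ M.dist (M.center z.1) (M.center z.2)

lemma farPairs_mono {θ : ℝ} {r r' : P → P → Prop} (h : ∀ p q, r' p q → r p q) :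
    M.farPairs θ r' ⊆ M.farPairs θ r := by
  intro z hz
  simp only [farPairs, Finset.mem_filter, Finset.mem_univ, true_and] at hz ⊢
  exact ⟨h _ _ hz.1, hz.2⟩

lemma step_sep {r : P → P → Prop} (hr : M.Valid r) {ω : Ω} {i j : K}
    (h : M.Sep ω (M.center i) (M.center j)) : ¬ M.step r ω (M.center i) (M.center j) := by
  rintro ⟨h1, h2 | h2⟩
  · exact h h2
  · exact h (h2 i j (hr.equiv.refl _) h1)

/-- While the diameter is in `[θ, 2 θ)`, every far pair is separated with probability at least
`diam r / 4 / mass r`, and the potential of their number drops by that much in expectation. -/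
lemma next_logPot_le [Nontrivial K] (hM : M.Separated) {θ : ℝ} {r : P → P → Prop}
    (hr : M.Valid r) (hd : ¬ M.Done r) (h1 : θ ≤ M.diam r) (h2 : M.diam r < 2 * θ) :
    M.next (fun s => logPot (M.farPairs θ s).card) r ≤
      logPot (M.farPairs θ r).card - M.diam r / 4 / M.mass r := by
  classical
  set F := M.farPairs θ r with hF
  have hm := mass_pos hM hr hd
  have hcard : F.card ≠ 0 := by
    obtain ⟨i₀⟩ : Nonempty K := inferInstance
    obtain ⟨i, j, hij, h⟩ := exists_dist_eq_diam (M := M) (hr.equiv.refl (M.center i₀))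
    refine Finset.card_ne_zero_of_mem (a := (i, j)) ?_
    simp [hF, farPairs, hij, h, h1]
  have hcard' : (0 : ℝ) < F.card := by exact_mod_cast Nat.pos_of_ne_zero hcard
  have key : ∀ ω, logPot (M.farPairs θ (M.step r ω)).card ≤
      logPot F.card - (∑ z ∈ F, if M.Sep ω (M.center z.1) (M.center z.2) then (1 : ℝ) else 0) / F.card := by
    intro ω
    refine (logPot_le hcard).trans ?_
    gcongr
    rw [← Finset.sum_filter, Finset.sum_const, nsmul_eq_mul, mul_one, le_sub_iff_add_le]
    rw [← Nat.cast_add, Nat.cast_le]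
    rw [← Finset.card_union_of_disjoint]
    · refine Finset.card_le_card (Finset.union_subset (Finset.filter_subset _ _)
        (farPairs_mono fun _ _ h => h.1))
    · rw [Finset.disjoint_left]
      intro z hz hz'
      exact step_sep hr (Finset.mem_filter.1 hz).2 (Finset.mem_filter.1 hz').2.1
  have hnext : M.next (fun s => logPot (M.farPairs θ s).card) r ≤
      ∑ ω, if M.Avail r ω then M.weight ω / M.mass r * (logPot F.card -
        (∑ z ∈ F, if M.Sep ω (M.center z.1) (M.center z.2) then (1 : ℝ) else 0) / F.card) else 0 := by
    refine Finset.sum_le_sum fun ω _ => ?_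
    split_ifs
    · exact mul_le_mul_of_nonneg_left (key ω) (div_nonneg (M.weight_nonneg ω) hm.le)
    · exact le_rfl
  refine hnext.trans ?_
  have e1 : (∑ ω, if M.Avail r ω then M.weight ω / M.mass r * (logPot F.card -
        (∑ z ∈ F, if M.Sep ω (M.center z.1) (M.center z.2) then (1 : ℝ) else 0) / F.card) else 0) =
      M.next (fun _ => logPot F.card) r - (∑ z ∈ F, ∑ ω,
        if M.Avail r ω ∧ M.Sep ω (M.center z.1) (M.center z.2) then M.weight ω else 0) /
          (M.mass r * F.card) := by
    unfold next
    rw [Finset.sum_comm, Finset.sum_div, ← Finset.sum_sub_distrib]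
    refine Finset.sum_congr rfl fun ω _ => ?_
    by_cases ha : M.Avail r ω
    · simp only [ha, if_true, true_and]
      have : (∑ z ∈ F, if M.Sep ω (M.center z.1) (M.center z.2) then M.weight ω else 0) =
          M.weight ω * ∑ z ∈ F, if M.Sep ω (M.center z.1) (M.center z.2) then (1 : ℝ) else 0 := by
        rw [Finset.mul_sum]; refine Finset.sum_congr rfl fun z _ => ?_
        split_ifs <;> simp
      rw [this]
      field_simp
    · simp [ha]
  rw [e1, next_const hM hr hd]
  have e2 : (F.card : ℝ) * (M.diam r / 4) ≤ ∑ z ∈ F, ∑ ω,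
        if M.Avail r ω ∧ M.Sep ω (M.center z.1) (M.center z.2) then M.weight ω else 0 := by
    rw [← nsmul_eq_mul]
    refine Finset.card_nsmul_le_sum _ _ _ fun z hz => ?_
    simp only [hF, farPairs, Finset.mem_filter, Finset.mem_univ, true_and] at hz
    have := mass_sep_ge hz.1
    linarith [hz.2]
  have e3 : M.diam r / 4 / M.mass r ≤ (∑ z ∈ F, ∑ ω,
        if M.Avail r ω ∧ M.Sep ω (M.center z.1) (M.center z.2) then M.weight ω else 0) /
          (M.mass r * F.card) := by
    rw [div_le_div_iff₀ hm (by positivity)]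
    nlinarith
  linarith

variable (M) in
open Classical in
/-- The diameter divided by the mass of the available cuts, in the states with property `Q`. Its
expected sum over the rounds is called the exposure in the states with property `Q`. -/
def rate (Q : (P → P → Prop) → Prop) (r : P → P → Prop) : ℝ :=
  if Q r then M.diam r / M.mass r else 0

lemma rate_nonneg (Q : (P → P → Prop) → Prop) (r : P → P → Prop) : 0 ≤ M.rate Q r := by
  unfold rate; split_ifs
  · exact div_nonneg (diam_nonneg r) (mass_nonneg r)
  · exact le_rfl

variable (K) in
/-- The bound `4 n (1 + 2 log k)` on the exposure at `n` consecutive scales. -/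
def scaleBound (n : ℕ) : ℝ := 4 * n * (1 + 2 * Real.log (Fintype.card K))

lemma log_card_nonneg : 0 ≤ Real.log (Fintype.card K) := Real.log_natCast_nonneg _

lemma scaleBound_nonneg (n : ℕ) : 0 ≤ scaleBound K n := by
  have := log_card_nonneg (K := K)
  unfold scaleBound; positivity

/-- The exposure while the diameter is in `[a, 2^n a)`. -/
lemma occ_window_le [Nontrivial K] (hM : M.Separated) {a : ℝ} (n : ℕ)
    {r₀ : P → P → Prop} (hr₀ : M.Valid r₀) (m : ℕ) :
    M.occ (M.rate fun r => a ≤ M.diam r ∧ M.diam r < a * 2 ^ n) m r₀ ≤ scaleBound K n := by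
  classical
  let V : (P → P → Prop) → ℝ := fun r =>
    ∑ s ∈ Finset.range n, 4 * logPot (M.farPairs (a * 2 ^ s) r).card
  have hV : ∀ r, 0 ≤ V r := fun r => Finset.sum_nonneg fun s _ =>
    mul_nonneg (by norm_num) (logPot_nonneg _)
  have hdrift : ∀ r, M.Refines r r₀ → ¬ M.Done r →
      M.rate (fun r => a ≤ M.diam r ∧ M.diam r < a * 2 ^ n) r + M.next V r ≤ V r := by
    intro r hr hd
    have hmono : ∀ s, M.next (fun t => 4 * logPot (M.farPairs (a * 2 ^ s) t).card) r ≤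
        4 * logPot (M.farPairs (a * 2 ^ s) r).card := by
      intro s
      conv_rhs => rw [← next_const hM hr.1 hd (4 * logPot (M.farPairs (a * 2 ^ s) r).card)]
      refine next_mono fun ω _ => ?_
      have := logPot_mono (Finset.card_le_card (farPairs_mono (M := M) (θ := a * 2 ^ s)
        (fun p q (h : M.step r ω p q) => h.1)))
      linarith
    simp only [V]
    rw [next_sum]
    unfold rate
    split_ifs with hw
    · -- the dyadic scale of the diameter
      have hex : ∃ s, M.diam r < a * 2 ^ (s + 1) := ⟨n, hw.2.trans_le (by
        have := diam_nonneg (M := M) r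
        have ha : 0 ≤ a := by
          by_contra hneg
          push Not at hneg
          have : a * 2 ^ n < 0 := mul_neg_of_neg_of_pos hneg (by positivity)
          linarith [hw.2]
        gcongr <;> norm_num)⟩
      obtain ⟨s, hs, hmin⟩ : ∃ s, M.diam r < a * 2 ^ (s + 1) ∧ a * 2 ^ s ≤ M.diam r := by
        refine ⟨Nat.find hex, Nat.find_spec hex, ?_⟩
        rcases h0 : Nat.find hex with _ | s
        · simpa using hw.1
        · have := Nat.find_min hex (m := s) (by omega)
          push Not at this
          exact this
      have hsn : s < n := by
        by_contra hcon
        have ha : 0 ≤ a := by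
          by_contra hneg
          push Not at hneg
          have : a * 2 ^ n < 0 := mul_neg_of_neg_of_pos hneg (by positivity)
          linarith [hw.2, diam_nonneg (M := M) r]
        have : a * 2 ^ n ≤ a * 2 ^ s := by
          gcongr
          · norm_num
          · omega
        linarith [hw.2]
      have hmem : s ∈ Finset.range n := Finset.mem_range.2 hsn
      rw [← Finset.add_sum_erase _ _ hmem, ← Finset.add_sum_erase _ _ hmem, ← add_assoc]
      refine add_le_add ?_ (Finset.sum_le_sum fun s' _ => hmono s')
      rw [next_mul]
      have := next_logPot_le hM hr.1 hd hmin (by rw [pow_succ] at hs; linarith)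
      have e : M.diam r / M.mass r = 4 * (M.diam r / 4 / M.mass r) := by ring
      rw [e]
      linarith
    · rw [zero_add]
      exact Finset.sum_le_sum fun s _ => hmono s
  refine (occ_le_of_drift hV hdrift m r₀ (Refines.refl hr₀)).trans ?_
  have hk : 0 < Fintype.card K := Fintype.card_pos
  have hl := log_card_nonneg (K := K)
  have hb : ∀ s ∈ Finset.range n, 4 * logPot (M.farPairs (a * 2 ^ s) r₀).card ≤
      4 * (1 + 2 * Real.log (Fintype.card K)) := by
    intro s _
    refine mul_le_mul_of_nonneg_left ?_ (by norm_num)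
    have : (M.farPairs (a * 2 ^ s) r₀).card ≤ Fintype.card K * Fintype.card K := by
      refine (Finset.card_filter_le _ _).trans ?_
      simp
    refine (logPot_mono this).trans ?_
    unfold logPot
    rw [if_neg (by positivity)]
    push_cast
    rw [Real.log_mul (by positivity) (by positivity)]
    linarith
  refine (Finset.sum_le_card_nsmul _ _ _ hb).trans (le_of_eq ?_)
  rw [Finset.card_range, nsmul_eq_mul]; unfold scaleBound; ring

/-- If, from each state with property `Q` on, the diameter stays within a range of `n` scales as
long as `Q` holds, then the exposure in the states with property `Q` is that of `n` scales. -/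
lemma occ_rate_le [Nontrivial K] (hM : M.Separated) (Q : (P → P → Prop) → Prop) (n : ℕ)
    (h : ∀ r, M.Valid r → ¬ M.Done r → Q r → ∃ a, ∀ r', M.Refines r' r → ¬ M.Done r' → Q r' →
      a ≤ M.diam r' ∧ M.diam r' < a * 2 ^ n) (m : ℕ) :
    ∀ r, M.Valid r → M.occ (M.rate Q) m r ≤ scaleBound K n := by
  classical
  induction m with
  | zero => intro r _; exact scaleBound_nonneg n
  | succ m ih =>
    intro r hr
    by_cases hd : M.Done r
    · unfold occ; rw [if_pos hd]; exact scaleBound_nonneg n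
    by_cases hQ : Q r
    · obtain ⟨a, ha⟩ := h r hr hd hQ
      refine le_trans ?_ (occ_window_le hM (a := a) n hr (m + 1))
      refine occ_mono (r₀ := r) (fun r' hr' hd' => ?_) _ r (Refines.refl hr)
      by_cases hQ' : Q r'
      · unfold rate; rw [if_pos hQ', if_pos (ha r' hr' hd' hQ')]
      · unfold rate; rw [if_neg hQ']; exact rate_nonneg (M := M) (fun r => a ≤ M.diam r ∧ M.diam r < a * 2 ^ n) r'
    · unfold occ; rw [if_neg hd]
      have : M.rate Q r = 0 := by unfold rate; rw [if_neg hQ]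
      rw [this, zero_add, ← next_const hM hr hd (scaleBound K n)]
      exact next_mono fun ω _ => ih _ (hr.step ω)

end CutSystem

namespace CutSystem

variable {P K Ω : Type} [Fintype K] [Fintype Ω] {M : CutSystem P K Ω}

/-! ### The expected distance to the final center -/

lemma occ_add (f g : (P → P → Prop) → ℝ) (m : ℕ) (r : P → P → Prop) :
    M.occ (fun s => f s + g s) m r = M.occ f m r + M.occ g m r := by
  induction m generalizing r with
  | zero => simp [occ]
  | succ m ih =>
    by_cases hd : M.Done r
    · simp [occ, hd]
    · simp only [occ, if_neg hd]
      rw [funext ih, next_add]; ring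

lemma occ_mul (c : ℝ) (g : (P → P → Prop) → ℝ) (m : ℕ) (r : P → P → Prop) :
    M.occ (fun s => c * g s) m r = c * M.occ g m r := by
  induction m generalizing r with
  | zero => simp [occ]
  | succ m ih =>
    by_cases hd : M.Done r
    · simp [occ, hd]
    · simp only [occ, if_neg hd]
      rw [funext ih, next_mul]; ring

open Classical in
variable (M) in
/-- The distance from the center `c` to the center in the cluster of `x`, once all centers are in
different clusters, and `0` before. -/
def finalDist (c : K) (x : P) (r : P → P → Prop) : ℝ :=
  if M.Done r then ∑ j, if r x (M.center j) then M.dist (M.center c) (M.center j) else 0 else 0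

lemma finalDist_eq {c j : K} {x : P} {r : P → P → Prop} (hr : M.Valid r) (hd : M.Done r)
    (hj : r x (M.center j)) : M.finalDist c x r = M.dist (M.center c) (M.center j) := by
  classical
  unfold finalDist
  rw [if_pos hd, Finset.sum_eq_single j]
  · rw [if_pos hj]
  · intro i _ hij
    rw [if_neg]
    exact fun hi => hij (hd _ _ (hr.equiv.trans (hr.equiv.symm hi) hj))
  · simp

lemma finalDist_le {c : K} {x : P} {r : P → P → Prop} (hr : M.Valid r) {B : ℝ} (hB : 0 ≤ B)
    (h : ∀ j, r x (M.center j) → M.dist (M.center c) (M.center j) ≤ B) :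
    M.finalDist c x r ≤ B := by
  by_cases hd : M.Done r
  · obtain ⟨j, hj⟩ := hr.center x
    rw [finalDist_eq hr hd hj]; exact h j hj
  · unfold finalDist; rw [if_neg hd]; exact hB

variable (M) in
/-- The cut `ω` separates `x` from the center `c` of its cluster. -/
def Lost (c : K) (x : P) (r : P → P → Prop) (ω : Ω) : Prop :=
  r x (M.center c) ∧ ¬ M.step r ω x (M.center c)

lemma Lost.sep {c : K} {x : P} {r : P → P → Prop} {ω : Ω} (h : M.Lost c x r ω) :
    M.Sep ω x (M.center c) := fun h' => h.2 ⟨h.1, Or.inl h'⟩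

lemma Lost.exists_not_sep {c : K} {x : P} {r : P → P → Prop} {ω : Ω} (hr : M.Valid r)
    (h : M.Lost c x r ω) : ∃ j, r x (M.center j) ∧ ¬ M.Sep ω x (M.center j) := by
  obtain ⟨j, hj, h1 | h1⟩ := (hr.step ω).center x
  · exact ⟨j, hj, not_not.2 h1⟩
  · exact absurd ⟨h.1, Or.inr h1⟩ h.2

open Classical in
/-- If the expected final distance after the loss of `c` by the cut `ω` is at most `a + G ω r`,
then the expected final distance is at most `a` plus the expected sum of the `G ω r`, weighted with
the probabilities of the losses. -/
lemma iterate_finalDist_le (hM : M.Separated) {c : K} {x : P} {a : ℝ} (ha : 0 ≤ a)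
    {G : Ω → (P → P → Prop) → ℝ} (hG : ∀ ω r, 0 ≤ G ω r)
    (h : ∀ r ω, M.Valid r → ¬ M.Done r → M.Avail r ω → M.Lost c x r ω → ∀ m,
      M.avg^[m] (M.finalDist c x) (M.step r ω) ≤ a + G ω r) (m : ℕ) :
    ∀ r, M.Valid r → r x (M.center c) → M.avg^[m] (M.finalDist c x) r ≤
      a + ∑ ω, (if M.Sep ω x (M.center c) then M.weight ω else 0) *
        M.occ (fun s => if M.Avail s ω ∧ M.Lost c x s ω then G ω s / M.mass s else 0) m r := by
  set g : Ω → (P → P → Prop) → ℝ :=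
    fun ω s => if M.Avail s ω ∧ M.Lost c x s ω then G ω s / M.mass s else 0 with hg
  have hg0 : ∀ ω s, 0 ≤ g ω s := fun ω s => by
    simp only [hg]; split_ifs
    · exact div_nonneg (hG _ _) (mass_nonneg _)
    · exact le_rfl
  have hw : ∀ ω, 0 ≤ (if M.Sep ω x (M.center c) then M.weight ω else 0) := fun ω => by
    split_ifs <;> simp [M.weight_nonneg]
  have hS : ∀ m r, 0 ≤ ∑ ω, (if M.Sep ω x (M.center c) then M.weight ω else 0) * M.occ (g ω) m r :=
    fun m r => Finset.sum_nonneg fun ω _ => mul_nonneg (hw ω) (occ_nonneg (hg0 ω) _ _)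
  have hdone : ∀ r, M.Valid r → M.Done r → r x (M.center c) → ∀ m,
      M.avg^[m] (M.finalDist c x) r = 0 := by
    intro r hr hd hc m
    induction m with
    | zero => exact (finalDist_eq hr hd hc).trans (dist_self _)
    | succ m ih => rw [Function.iterate_succ_apply', avg, if_pos hd, ih]
  induction m with
  | zero =>
    intro r hr hc
    refine le_trans ?_ (add_nonneg ha (hS 0 r))
    by_cases hd : M.Done r
    · exact (hdone r hr hd hc 0).le
    · simp only [Function.iterate_zero, id]
      unfold finalDist; rw [if_neg hd]
  | succ m ih =>
    intro r hr hc
    by_cases hd : M.Done r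
    · rw [hdone r hr hd hc]; exact add_nonneg ha (hS _ r)
    rw [Function.iterate_succ_apply', avg, if_neg hd]
    set S : (P → P → Prop) → ℝ := fun s =>
      ∑ ω, (if M.Sep ω x (M.center c) then M.weight ω else 0) * M.occ (g ω) m s with hSdef
    have h1 : M.next (M.avg^[m] (M.finalDist c x)) r ≤
        M.next (fun s => a + S s) r +
          ∑ ω, (if M.Sep ω x (M.center c) then M.weight ω else 0) * g ω r := by
      unfold next
      rw [← Finset.sum_add_distrib]
      refine Finset.sum_le_sum fun ω _ => ?_
      by_cases hav : M.Avail r ω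
      · rw [if_pos hav, if_pos hav]
        have hp : 0 ≤ M.weight ω / M.mass r := div_nonneg (M.weight_nonneg ω) (mass_nonneg r)
        by_cases hl : M.Lost c x r ω
        · have e : (if M.Sep ω x (M.center c) then M.weight ω else 0) * g ω r =
              M.weight ω / M.mass r * G ω r := by
            simp only [hg, hl.sep, hav, hl, if_true, and_self]; ring
          rw [e, ← mul_add]
          refine mul_le_mul_of_nonneg_left ?_ hp
          have := h r ω hr hd hav hl m
          have := hS m (M.step r ω)
          simp only [hSdef]; linarith
        · have hc' : M.step r ω x (M.center c) := by
            by_contra hcon; exact hl ⟨hc, hcon⟩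
          have := mul_le_mul_of_nonneg_left (ih _ (hr.step ω) hc') hp
          have h2 := mul_nonneg (hw ω) (hg0 ω r)
          simp only [hSdef]; linarith
      · rw [if_neg hav, if_neg hav, zero_add]
        exact mul_nonneg (hw ω) (hg0 ω r)
    refine h1.trans (le_of_eq ?_)
    rw [next_add, next_const hM hr hd]
    simp only [hSdef]
    rw [next_sum, add_assoc, ← Finset.sum_add_distrib]
    congr 1
    refine Finset.sum_congr rfl fun ω _ => ?_
    rw [next_mul, occ, if_neg hd]
    ring

/-- From a state in which the cut `ω` is available on, the diameter stays within a factor `k³` as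
long as `ω` is available. -/
lemma avail_window {ω : Ω} {n : ℕ} (hn : (Fintype.card K : ℝ) ^ 3 ≤ 2 ^ n) (r : P → P → Prop)
    (_ : M.Valid r) (_ : ¬ M.Done r) (hav : M.Avail r ω) :
    ∃ a, ∀ r', M.Refines r' r → ¬ M.Done r' → M.Avail r' ω →
      a ≤ M.diam r' ∧ M.diam r' < a * 2 ^ n := by
  classical
  obtain ⟨⟨i, j, hij, hs⟩, hB⟩ := hav
  have : Nonempty K := ⟨i⟩
  let F : Finset (K × K) := Finset.univ.filter fun z =>
    r (M.center z.1) (M.center z.2) ∧ M.Sep ω (M.center z.1) (M.center z.2)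
  have hF : F.Nonempty := ⟨(i, j), by simp [F, hij, hs]⟩
  obtain ⟨⟨a, b⟩, hab, hmin⟩ := F.exists_min_image
    (fun z => M.dist (M.center z.1) (M.center z.2)) hF
  simp only [F, Finset.mem_filter, Finset.mem_univ, true_and] at hab hmin
  refine ⟨M.dist (M.center a) (M.center b), fun r' hr' _ hav' => ⟨?_, ?_⟩⟩
  · obtain ⟨⟨i', j', hij', hs'⟩, -⟩ := hav'
    exact (hmin (i', j') ⟨hr'.2 _ _ hij', hs'⟩).trans (dist_le_diam hij')
  · have h1 : M.diam r / (Fintype.card K : ℝ) ^ 3 < M.dist (M.center a) (M.center b) := by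
      by_contra hcon
      exact hB ⟨a, b, hab.1, hab.2, not_lt.1 hcon⟩
    have hk : (0 : ℝ) < Fintype.card K := by exact_mod_cast Fintype.card_pos
    rw [div_lt_iff₀ (by positivity)] at h1
    calc M.diam r' ≤ M.diam r := diam_mono hr'.2
      _ < _ := h1
      _ ≤ _ := mul_le_mul_of_nonneg_left hn (dist_nonneg _ _)

lemma iterate_finalDist_step_le_diam (hM : M.Separated) {c : K} {x : P} {r : P → P → Prop} {ω : Ω}
    (hr : M.Valid r) (hc : r x (M.center c)) (m : ℕ) :
    M.avg^[m] (M.finalDist c x) (M.step r ω) ≤ M.diam r := by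
  refine iterate_avg_le hM (r₀ := M.step r ω) (fun r' hr' => ?_) m _ (Refines.refl (hr.step ω))
  refine finalDist_le hr'.1 (diam_nonneg _) fun j hj => dist_le_diam ?_
  exact hr.equiv.trans (hr.equiv.symm hc) (hr'.2 _ _ hj).1

open Classical in
/-- The crude bound: the expected distance to the final center exceeds the distance to any given
center of the cluster by a factor `O(log² k)` at most. -/
lemma iterate_finalDist_le_crude [Nontrivial K] (hM : M.Separated) {n : ℕ}
    (hn : (Fintype.card K : ℝ) ^ 3 ≤ 2 ^ n) (c : K) (x : P) (m : ℕ) {r : P → P → Prop}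
    (hr : M.Valid r) (hc : r x (M.center c)) :
    M.avg^[m] (M.finalDist c x) r ≤ scaleBound K n * M.dist x (M.center c) := by
  refine (iterate_finalDist_le hM le_rfl (G := fun _ r => M.diam r) (fun _ _ => diam_nonneg _)
    (fun r ω hr hd hav hl m => ?_) m r hr hc).trans ?_
  · rw [zero_add]; exact iterate_finalDist_step_le_diam hM hr hl.1 m
  · rw [zero_add, mul_comm (scaleBound K n)]
    unfold dist
    rw [Finset.sum_mul]
    refine Finset.sum_le_sum fun ω _ => ?_
    refine mul_le_mul_of_nonneg_left ?_ (by split_ifs <;> simp [M.weight_nonneg])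
    refine le_trans ?_ (occ_rate_le hM (fun r => M.Avail r ω) n (avail_window hn) m r hr)
    refine occ_mono (r₀ := r) (fun s _ _ => ?_) m r (Refines.refl hr)
    unfold rate
    split_ifs with h1 h2
    · exact le_rfl
    · exact absurd h1.1 h2
    · exact div_nonneg (diam_nonneg _) (mass_nonneg _)
    · exact le_rfl

variable (M) in
/-- The cut `ω` separates `x` from the center `c`, and every center that remains in the cluster
of `x` is at distance at least `diam r / Λ`. -/
def FarFallback (Λ : ℝ) (c : K) (x : P) (ω : Ω) (r : P → P → Prop) : Prop :=
  M.Lost c x r ω ∧ 2 * M.dist x (M.center c) < M.diam r ∧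
    ∀ j, r x (M.center j) → ¬ M.Sep ω x (M.center j) → M.diam r ≤ Λ * M.dist x (M.center j)

/-- The distance to the nearest remaining center grows and the diameter shrinks, so that they are
within a factor `Λ` at few scales only. -/
lemma farFallback_window {Λ : ℝ} {n : ℕ} (hn : 2 * Λ < 2 ^ n) {c : K} {x : P} {ω : Ω}
    (r : P → P → Prop) (hr : M.Valid r) (_ : ¬ M.Done r) (hQ : M.FarFallback Λ c x ω r) :
    ∃ a, ∀ r', M.Refines r' r → ¬ M.Done r' → M.FarFallback Λ c x ω r' →
      a ≤ M.diam r' ∧ M.diam r' < a * 2 ^ n := by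
  classical
  let F : Finset K := Finset.univ.filter fun j => r x (M.center j) ∧ ¬ M.Sep ω x (M.center j)
  have hF : F.Nonempty := by
    obtain ⟨j, hj⟩ := hQ.1.exists_not_sep hr
    exact ⟨j, by simpa [F] using hj⟩
  obtain ⟨j₀, hj₀, hmin⟩ := F.exists_min_image (fun j => M.dist x (M.center j)) hF
  simp only [F, Finset.mem_filter, Finset.mem_univ, true_and] at hj₀ hmin
  have hup := hQ.2.2 j₀ hj₀.1 hj₀.2
  have hf := dist_nonneg (M := M) x (M.center c)
  have hpos : 0 < M.dist x (M.center j₀) := by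
    by_contra hcon
    have h0 : M.dist x (M.center j₀) = 0 := le_antisymm (not_lt.1 hcon) (dist_nonneg _ _)
    rw [h0, mul_zero] at hup
    linarith [hQ.2.1]
  refine ⟨M.dist x (M.center j₀) / 2, fun r' hr' _ hQ' => ⟨?_, ?_⟩⟩
  · obtain ⟨j, hj, hj'⟩ := hQ'.1.exists_not_sep hr'.1
    have h1 := hmin j ⟨hr'.2 _ _ hj, hj'⟩
    have h2 := dist_triangle (M := M) x (M.center c) (M.center j)
    have h3 : M.dist (M.center c) (M.center j) ≤ M.diam r' :=
      dist_le_diam (hr'.1.equiv.trans (hr'.1.equiv.symm hQ'.1.1) hj)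
    linarith [hQ'.2.1]
  · have h1 := diam_mono (M := M) hr'.2
    have := mul_lt_mul_of_pos_right hn hpos
    linarith

open Classical in
/-- The refined bound. If the nearest remaining center is much closer than the diameter, the crude
bound is applied to it; the other case occurs at few scales. -/
lemma iterate_finalDist_le_refined [Nontrivial K] (hM : M.Separated) {n n' : ℕ} {Λ : ℝ}
    (hn : (Fintype.card K : ℝ) ^ 3 ≤ 2 ^ n) (hΛ : 0 < Λ) (hn' : 2 * Λ < 2 ^ n')
    (c : K) (x : P) (m : ℕ) {r : P → P → Prop} (hr : M.Valid r) (hc : r x (M.center c)) :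
    M.avg^[m] (M.finalDist c x) r ≤
      (2 + scaleBound K n' + (1 + scaleBound K n) / Λ * scaleBound K n) *
        M.dist x (M.center c) := by
  set B := scaleBound K n with hBdef
  have hB : 0 ≤ B := scaleBound_nonneg n
  have hβ : 0 ≤ (1 + B) / Λ := by positivity
  have hf := dist_nonneg (M := M) x (M.center c)
  refine (iterate_finalDist_le hM (a := 2 * M.dist x (M.center c)) (by positivity)
    (G := fun ω r => (if M.FarFallback Λ c x ω r then M.diam r else 0) +
      (1 + B) / Λ * M.diam r)
    (fun ω r => ?_) (fun r ω hr hd hav hl m => ?_) m r hr hc).trans ?_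
  · have := diam_nonneg (M := M) r
    split_ifs <;> positivity
  · have hD := diam_nonneg (M := M) r
    have hβD := mul_nonneg hβ hD
    have htriv := iterate_finalDist_step_le_diam (ω := ω) hM hr hl.1 m
    by_cases h2 : M.diam r ≤ 2 * M.dist x (M.center c)
    · split_ifs <;> linarith
    by_cases hfar : M.FarFallback Λ c x ω r
    · rw [if_pos hfar]; linarith
    · rw [if_neg hfar]
      unfold FarFallback at hfar
      push Not at hfar h2
      obtain ⟨j, hj, hj', hlt⟩ := hfar hl h2
      have hstep : M.step r ω x (M.center j) := ⟨hj, Or.inl (not_not.1 hj')⟩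
      have h3 : M.avg^[m] (M.finalDist c x) (M.step r ω) ≤
          M.avg^[m] (fun s => M.dist (M.center c) (M.center j) + M.finalDist j x s)
            (M.step r ω) := by
        refine iterate_avg_mono (r₀ := M.step r ω) (fun s hs => ?_) m _ (Refines.refl (hr.step ω))
        by_cases hds : M.Done s
        · obtain ⟨i, hi⟩ := hs.1.center x
          rw [finalDist_eq hs.1 hds hi, finalDist_eq hs.1 hds hi]
          exact dist_triangle _ _ _
        · unfold finalDist; rw [if_neg hds, if_neg hds, add_zero]; exact dist_nonneg _ _
      rw [iterate_avg_add_const hM _ _ _ _ (hr.step ω)] at h3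
      have h4 := iterate_finalDist_le_crude hM hn j x m (hr.step ω) hstep
      have h5 := dist_triangle (M := M) (M.center c) x (M.center j)
      rw [dist_comm (M.center c) x] at h5
      have h6 : (1 + B) * M.dist x (M.center j) ≤ (1 + B) / Λ * M.diam r := by
        rw [div_mul_eq_mul_div, le_div_iff₀ hΛ]
        nlinarith
      rw [← hBdef] at h4
      linarith
  · have key : ∀ ω, M.occ (fun s => if M.Avail s ω ∧ M.Lost c x s ω then
        ((if M.FarFallback Λ c x ω s then M.diam s else 0) + (1 + B) / Λ * M.diam s) / M.mass s
          else 0) m r ≤ scaleBound K n' + (1 + B) / Λ * B := by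
      intro ω
      have h1 := occ_rate_le hM (M.FarFallback Λ c x ω) n' (farFallback_window hn') m r hr
      have h2 := mul_le_mul_of_nonneg_left
        (occ_rate_le hM (fun r => M.Avail r ω) n (avail_window hn) m r hr) hβ
      rw [← occ_mul] at h2
      refine le_trans ?_ (add_le_add h1 h2)
      rw [← occ_add]
      refine occ_mono (r₀ := r) (fun s _ _ => ?_) m r (Refines.refl hr)
      have h3 := rate_nonneg (M := M) (M.FarFallback Λ c x ω) s
      have h4 := rate_nonneg (M := M) (fun r => M.Avail r ω) s
      by_cases hs : M.Avail s ω ∧ M.Lost c x s ω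
      · rw [if_pos hs]
        unfold rate
        rw [if_pos hs.1]
        refine le_of_eq ?_
        split_ifs <;> ring
      · rw [if_neg hs]; positivity
    have h5 : (∑ ω, (if M.Sep ω x (M.center c) then M.weight ω else 0) *
        M.occ (fun s => if M.Avail s ω ∧ M.Lost c x s ω then
        ((if M.FarFallback Λ c x ω s then M.diam s else 0) + (1 + B) / Λ * M.diam s) / M.mass s
          else 0) m r) ≤
        M.dist x (M.center c) * (scaleBound K n' + (1 + B) / Λ * B) := by
      unfold dist
      rw [Finset.sum_mul]
      exact Finset.sum_le_sum fun ω _ => mul_le_mul_of_nonneg_left (key ω)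
        (by split_ifs <;> simp [M.weight_nonneg])
    linarith

/-- The factor `max 1 (log k) * max 1 (log (log k))`. -/
def logFactor (k : ℕ) : ℝ := max 1 (Real.log k) * max 1 (Real.log (Real.log k))

/-- The expected distance to the final center is `O(log k log log k)` times the distance to any
given center. -/
theorem iterate_finalDist_le_logFactor [Nontrivial K] (hM : M.Separated)
    (c : K) (x : P) (m : ℕ) {r : P → P → Prop} (hr : M.Valid r) (hc : r x (M.center c)) :
    M.avg^[m] (M.finalDist c x) r ≤
      8000 * logFactor (Fintype.card K) * M.dist x (M.center c) := by
  set k := Fintype.card K with hk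
  set L := max 1 (Real.log k) with hL
  set LL := max 1 (Real.log (Real.log k)) with hLL
  have hk2 : 2 ≤ k := Fintype.one_lt_card
  have hkpos : (0 : ℝ) < k := by positivity
  have hL1 : 1 ≤ L := le_max_left _ _
  have hLL1 : 1 ≤ LL := le_max_left _ _
  have hlogk : Real.log k ≤ L := le_max_right _ _
  have hlogL : Real.log L ≤ LL := by
    rcases le_total (Real.log k) 1 with h | h
    · rw [hL, max_eq_left h, Real.log_one]; linarith
    · rw [hL, max_eq_right h]; exact le_max_right _ _
  have hlog2 := Real.log_two_gt_d9
  have hceil : ∀ y : ℝ, 0 < y → y ≤ 2 ^ ⌈2 * Real.log y⌉₊ := by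
    intro y hy
    by_cases hy1 : y < 1
    · exact hy1.le.trans (one_le_pow₀ (by norm_num))
    push Not at hy1
    have h0 := Real.log_nonneg hy1
    have h1 := Nat.le_ceil (2 * Real.log y)
    rw [← Real.log_le_log_iff hy (by positivity), Real.log_pow]
    nlinarith
  set n := ⌈2 * Real.log ((k : ℝ) ^ 3)⌉₊ with hn
  set n' := ⌈2 * Real.log (4 * L ^ 4)⌉₊ with hn'
  have h1 : (k : ℝ) ^ 3 ≤ 2 ^ n := hceil _ (by positivity)
  have h2 : 2 * L ^ 4 < 2 ^ n' := by
    have := hceil (4 * L ^ 4) (by positivity)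
    have h3 : 0 < L ^ 4 := by positivity
    linarith
  have hb := iterate_finalDist_le_refined hM h1 (by positivity : 0 < L ^ 4) h2 c x m hr hc
  refine hb.trans (mul_le_mul_of_nonneg_right ?_ (dist_nonneg _ _))
  have hlk0 : 0 ≤ Real.log k := Real.log_natCast_nonneg _
  have hn_le : (n : ℝ) ≤ 7 * L := by
    have := Nat.ceil_lt_add_one (a := 2 * Real.log ((k : ℝ) ^ 3)) (by
      rw [Real.log_pow]; push_cast; linarith)
    rw [← hn, Real.log_pow] at this; push_cast at this
    linarith
  have hn'_le : (n' : ℝ) ≤ 13 * LL := by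
    have e : Real.log (4 * L ^ 4) = 2 * Real.log 2 + 4 * Real.log L := by
      rw [Real.log_mul (by norm_num) (by positivity), Real.log_pow,
        show (4 : ℝ) = 2 ^ 2 by norm_num, Real.log_pow]; norm_num
    have hl0 : 0 ≤ Real.log L := Real.log_nonneg hL1
    have := Nat.ceil_lt_add_one (a := 2 * Real.log (4 * L ^ 4)) (by rw [e]; linarith)
    rw [← hn', e] at this
    have := Real.log_two_lt_d9
    linarith
  have hB : scaleBound K n ≤ 84 * L ^ 2 := by
    unfold scaleBound
    rw [← hk]
    have h3 : 1 + 2 * Real.log k ≤ 3 * L := by linarith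
    have h4 : 4 * (n : ℝ) ≤ 28 * L := by linarith
    calc 4 * (n : ℝ) * (1 + 2 * Real.log k) ≤ 28 * L * (3 * L) :=
          mul_le_mul h4 h3 (by linarith) (by linarith)
      _ = _ := by ring
  have hB' : scaleBound K n' ≤ 156 * (L * LL) := by
    unfold scaleBound
    rw [← hk]
    have h3 : 1 + 2 * Real.log k ≤ 3 * L := by linarith
    have h4 : 4 * (n' : ℝ) ≤ 52 * LL := by linarith
    calc 4 * (n' : ℝ) * (1 + 2 * Real.log k) ≤ 52 * LL * (3 * L) :=
          mul_le_mul h4 h3 (by linarith) (by linarith)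
      _ = _ := by ring
  have hB0 := scaleBound_nonneg (K := K) n
  have hL2 : 1 ≤ L ^ 2 := one_le_pow₀ hL1
  have h5 : (1 + scaleBound K n) / L ^ 4 * scaleBound K n ≤ 85 * 84 := by
    rw [div_mul_eq_mul_div, div_le_iff₀ (by positivity)]
    calc (1 + scaleBound K n) * scaleBound K n ≤ (85 * L ^ 2) * (84 * L ^ 2) :=
          mul_le_mul (by linarith) hB hB0 (by positivity)
      _ = _ := by ring
  have h6 : 1 ≤ L * LL := one_le_mul_of_one_le_of_one_le hL1 hLL1
  have : logFactor k = L * LL := rfl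
  rw [this]
  linarith

end CutSystem

/-! ### The terminal embedding -/

/-- The primitive of twice the distance to `Y`; one coordinate of the terminal embedding. -/
def embed (Y : Set ℝ) (x : ℝ) : ℝ := ∫ t in (0 : ℝ)..x, 2 * Metric.infDist t Y

lemma embed_integrable (Y : Set ℝ) (a b : ℝ) :
    IntervalIntegrable (fun t => 2 * Metric.infDist t Y) volume a b :=
  ((Metric.continuous_infDist_pt Y).const_mul 2).intervalIntegrable a b

lemma embed_sub (Y : Set ℝ) (a b : ℝ) :
    embed Y b - embed Y a = ∫ t in a..b, 2 * Metric.infDist t Y :=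
  intervalIntegral.integral_interval_sub_left (embed_integrable Y 0 b) (embed_integrable Y 0 a)

lemma embed_mono (Y : Set ℝ) : Monotone (embed Y) := by
  intro a b hab
  rw [← sub_nonneg, embed_sub]
  exact intervalIntegral.integral_nonneg hab fun t _ =>
    mul_nonneg (by norm_num) Metric.infDist_nonneg

lemma integral_two_mul_sub (y a b : ℝ) :
    ∫ t in a..b, 2 * (t - y) = (b - y) ^ 2 - (a - y) ^ 2 := by
  have : ∀ t ∈ Set.uIcc a b, HasDerivAt (fun t => (t - y) ^ 2) (2 * (t - y)) t := by
    intro t _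
    simpa using ((hasDerivAt_id' t).sub_const y).fun_pow 2
  rw [intervalIntegral.integral_eq_sub_of_hasDerivAt this]
  exact (continuous_const.mul (continuous_id.sub continuous_const)).intervalIntegrable _ _

lemma abs_embed_sub_le {Y : Set ℝ} {c : ℝ} (hc : c ∈ Y) (x : ℝ) :
    |embed Y x - embed Y c| ≤ (x - c) ^ 2 := by
  have hd : ∀ t, Metric.infDist t Y ≤ |t - c| := fun t => by
    rw [← Real.dist_eq]; exact Metric.infDist_le_dist_of_mem hc
  have hcont : Continuous fun t => 2 * (t - c) :=
    continuous_const.mul (continuous_id.sub continuous_const)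
  rcases le_total c x with h | h
  · rw [abs_of_nonneg (sub_nonneg.2 (embed_mono Y h)), embed_sub]
    calc _ ≤ ∫ t in c..x, 2 * (t - c) := by
          refine intervalIntegral.integral_mono_on h (embed_integrable Y c x)
            (hcont.intervalIntegrable _ _) fun t ht => ?_
          have := hd t
          rw [abs_of_nonneg (by linarith [ht.1])] at this
          linarith
      _ = _ := by rw [integral_two_mul_sub]; ring
  · rw [abs_sub_comm, abs_of_nonneg (sub_nonneg.2 (embed_mono Y h)), embed_sub]
    calc _ ≤ ∫ t in x..c, -(2 * (t - c)) := by
          refine intervalIntegral.integral_mono_on h (embed_integrable Y x c)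
            (hcont.neg.intervalIntegrable _ _) fun t ht => ?_
          have := hd t
          rw [abs_of_nonpos (by linarith [ht.2])] at this
          linarith
      _ = _ := by rw [intervalIntegral.integral_neg, integral_two_mul_sub]; ring

/-- At least half of an interval of length `L` has distance at least `L / (4 k)` from any `k`
points, so that `embed Y` grows by at least `L ^ 2 / (4 k)` on it. -/
lemma sq_le_embed_sub {Y : Set ℝ} (hY : Y.Finite) (hne : Y.Nonempty) {k : ℕ} (hk : 0 < k)
    (hcard : Y.ncard ≤ k) {a b : ℝ} (hab : a ≤ b) :
    (b - a) ^ 2 ≤ 4 * k * (embed Y b - embed Y a) := by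
  have hk' : (0 : ℝ) < k := by exact_mod_cast hk
  set δ := (b - a) / (4 * k) with hδ
  have hδ0 : 0 ≤ δ := div_nonneg (by linarith) (by positivity)
  have hδk : 4 * k * δ = b - a := by rw [hδ]; field_simp
  rw [embed_sub, intervalIntegral.integral_of_le hab]
  have hint : Integrable (fun t => 2 * Metric.infDist t Y) (volume.restrict (Set.Ioc a b)) := by
    have := embed_integrable Y a b
    rwa [intervalIntegrable_iff_integrableOn_Ioc_of_le hab] at this
  have hmarkov := mul_meas_ge_le_integral_of_nonneg
    (Filter.Eventually.of_forall fun t => mul_nonneg (by norm_num : (0 : ℝ) ≤ 2) Metric.infDist_nonneg)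
    hint (2 * δ)
  have hmeas : MeasurableSet {t : ℝ | 2 * δ ≤ 2 * Metric.infDist t Y} :=
    measurableSet_le measurable_const ((Metric.continuous_infDist_pt Y).const_mul 2).measurable
  have hcompl := measureReal_add_measureReal_compl (μ := volume.restrict (Set.Ioc a b)) hmeas
  have huniv : (volume.restrict (Set.Ioc a b)).real Set.univ = b - a := by
    simp [Measure.real, hab]
  have hsmall : (volume.restrict (Set.Ioc a b)).real {t : ℝ | 2 * δ ≤ 2 * Metric.infDist t Y}ᶜ ≤
      k * (2 * δ) := by
    have hsub : {t : ℝ | 2 * δ ≤ 2 * Metric.infDist t Y}ᶜ ⊆ ⋃ y ∈ hY.toFinset, Metric.ball y δ := by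
      intro t ht
      simp only [Set.mem_compl_iff, Set.mem_ofPred_eq, not_le] at ht
      obtain ⟨y, hy, hty⟩ := (Metric.infDist_lt_iff hne).1 (by linarith : Metric.infDist t Y < δ)
      simp only [Set.mem_iUnion]
      exact ⟨y, hY.mem_toFinset.2 hy, hty⟩
    refine (measureReal_mono hsub (measure_ne_top_of_subset (Set.subset_univ _) (by simp))).trans ((measureReal_biUnion_finset_le _ _).trans ?_)
    have hball : ∀ y ∈ hY.toFinset, (volume.restrict (Set.Ioc a b)).real (Metric.ball y δ) ≤
        2 * δ := fun y _ => by
      have h1 := ENNReal.toReal_mono (by rw [Real.volume_ball]; exact ENNReal.ofReal_ne_top) (Measure.restrict_le_self (μ := volume)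
        (s := Set.Ioc a b) (Metric.ball y δ))
      rw [Real.volume_ball, ENNReal.toReal_ofReal (by linarith)] at h1
      exact h1
    refine (Finset.sum_le_card_nsmul _ _ _ hball).trans ?_
    rw [nsmul_eq_mul, ← Set.ncard_eq_toFinset_card Y hY]
    exact mul_le_mul_of_nonneg_right (by exact_mod_cast hcard) (by linarith)
  rw [huniv] at hcompl
  nlinarith

lemma embed_strictMono {Y : Set ℝ} (hY : Y.Finite) (hne : Y.Nonempty) : StrictMono (embed Y) := by
  intro a b hab
  have h := sq_le_embed_sub hY hne ((Set.ncard_pos hY).2 hne) le_rfl hab.le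
  have hk : (0 : ℝ) < Y.ncard := by exact_mod_cast (Set.ncard_pos hY).2 hne
  have h1 : 0 < (b - a) ^ 2 := pow_pos (sub_pos.2 hab) 2
  by_contra hcon
  push Not at hcon
  nlinarith

lemma embed_continuous (Y : Set ℝ) : Continuous (embed Y) :=
  intervalIntegral.continuous_primitive (fun a b => embed_integrable Y a b) 0

lemma embed_surjective {Y : Set ℝ} (hY : Y.Finite) (hne : Y.Nonempty) :
    Function.Surjective (embed Y) := by
  have hk : (0 : ℝ) < Y.ncard := by exact_mod_cast (Set.ncard_pos hY).2 hne
  have hkey : ∀ a b : ℝ, a + 1 ≤ b → (b - a) ≤ 4 * Y.ncard * (embed Y b - embed Y a) := by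
    intro a b hab
    have := sq_le_embed_sub hY hne ((Set.ncard_pos hY).2 hne) le_rfl (by linarith : a ≤ b)
    nlinarith
  refine (embed_continuous Y).surjective ?_ ?_
  · refine Filter.tendsto_atTop_mono' _ (f₁ := fun b => b / (4 * Y.ncard) + embed Y 0) ?_ ?_
    · filter_upwards [Filter.eventually_ge_atTop 1] with b hb
      have := hkey 0 b (by linarith)
      rw [← le_sub_iff_add_le, div_le_iff₀ (by positivity)]
      linarith
    · exact Filter.tendsto_atTop_add_const_right _ _
        (Filter.tendsto_id.atTop_div_const (by positivity))
  · refine Filter.tendsto_atBot_mono' _ (f₁ := fun b => b / (4 * Y.ncard) + embed Y 0) ?_ ?_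
    · filter_upwards [Filter.eventually_le_atBot (-1)] with b hb
      have := hkey b 0 (by linarith)
      rw [← sub_le_iff_le_add, le_div_iff₀ (by positivity)]
      linarith
    · exact Filter.tendsto_atBot_add_const_right _ _
        (Filter.tendsto_id.atBot_div_const (by positivity))

/-- The inverse of `embed Y`. -/
def embedInv (Y : Set ℝ) : ℝ → ℝ := Function.invFun (embed Y)

lemma embed_embedInv {Y : Set ℝ} (hY : Y.Finite) (hne : Y.Nonempty) (θ : ℝ) :
    embed Y (embedInv Y θ) = θ := Function.invFun_eq (embed_surjective hY hne θ)

lemma embedInv_eq {Y : Set ℝ} (hY : Y.Finite) (hne : Y.Nonempty) {x θ : ℝ} (h : embed Y x = θ) :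
    embedInv Y θ = x := (embed_strictMono hY hne).injective ((embed_embedInv hY hne θ).trans h.symm)

section Gap

variable {Y : Set ℝ} {y z : ℝ}

lemma infDist_left (hy : y ∈ Y) (hgap : ∀ w ∈ Y, w ≤ y ∨ z ≤ w) {t : ℝ} (h1 : y ≤ t)
    (h2 : t ≤ (y + z) / 2) : Metric.infDist t Y = t - y := by
  refine le_antisymm ?_ ((Metric.le_infDist ⟨y, hy⟩).2 fun w hw => ?_)
  · refine (Metric.infDist_le_dist_of_mem hy).trans (le_of_eq ?_)
    rw [Real.dist_eq, abs_of_nonneg (by linarith)]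
  · rw [Real.dist_eq]
    rcases hgap w hw with h | h
    · exact le_trans (by linarith) (le_abs_self _)
    · exact le_trans (by linarith) (neg_le_abs _)

lemma infDist_right (hz : z ∈ Y) (hgap : ∀ w ∈ Y, w ≤ y ∨ z ≤ w) {t : ℝ} (h1 : (y + z) / 2 ≤ t)
    (h2 : t ≤ z) : Metric.infDist t Y = z - t := by
  refine le_antisymm ?_ ((Metric.le_infDist ⟨z, hz⟩).2 fun w hw => ?_)
  · refine (Metric.infDist_le_dist_of_mem hz).trans (le_of_eq ?_)
    rw [Real.dist_eq, abs_of_nonpos (by linarith)]; ring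
  · rw [Real.dist_eq]
    rcases hgap w hw with h | h
    · exact le_trans (by linarith) (le_abs_self _)
    · exact le_trans (by linarith) (neg_le_abs _)

lemma embed_left (hy : y ∈ Y) (hgap : ∀ w ∈ Y, w ≤ y ∨ z ≤ w) {t : ℝ} (h1 : y ≤ t)
    (h2 : t ≤ (y + z) / 2) : embed Y t = embed Y y + (t - y) ^ 2 := by
  have : embed Y t - embed Y y = ∫ s in y..t, 2 * (s - y) := by
    rw [embed_sub]
    refine intervalIntegral.integral_congr fun s hs => ?_
    rw [Set.uIcc_of_le h1] at hs
    simp only [infDist_left hy hgap hs.1 (hs.2.trans h2)]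
  rw [integral_two_mul_sub] at this
  linarith [this, sub_self y, sq (y - y)]

lemma embed_right (hz : z ∈ Y) (hgap : ∀ w ∈ Y, w ≤ y ∨ z ≤ w) {t : ℝ} (h1 : (y + z) / 2 ≤ t)
    (h2 : t ≤ z) : embed Y t = embed Y z - (z - t) ^ 2 := by
  have : embed Y z - embed Y t = ∫ s in t..z, -(2 * (s - z)) := by
    rw [embed_sub]
    refine intervalIntegral.integral_congr fun s hs => ?_
    rw [Set.uIcc_of_le h2] at hs
    simp only [infDist_right hz hgap (h1.trans hs.1) hs.2]
    ring
  rw [intervalIntegral.integral_neg, integral_two_mul_sub] at this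
  linarith [this, sub_self z, sq (z - z), sq (t - z), sq (z - t)]

/-- The image of a gap between neighbors of `Y` has half the square of its length. -/
lemma embed_gap (hy : y ∈ Y) (hz : z ∈ Y) (hyz : y ≤ z) (hgap : ∀ w ∈ Y, w ≤ y ∨ z ≤ w) :
    embed Y z = embed Y y + (z - y) ^ 2 / 2 := by
  have h1 := embed_left hy hgap (t := (y + z) / 2) (by linarith) le_rfl
  have h2 := embed_right hz hgap (t := (y + z) / 2) le_rfl (by linarith)
  linarith [sq (z - y), sq ((y + z) / 2 - y), sq (z - (y + z) / 2)]

open Classical in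
/-- The point of the gap between the neighbors `y`, `z` with the given value of `embed Y`, relative
to that of `y`. -/
def gapPoint (y z off : ℝ) : ℝ :=
  if off ≤ (z - y) ^ 2 / 4 then y + √off else z - √((z - y) ^ 2 / 2 - off)

lemma embed_gapPoint (hy : y ∈ Y) (hz : z ∈ Y) (hyz : y ≤ z) (hgap : ∀ w ∈ Y, w ≤ y ∨ z ≤ w)
    {off : ℝ} (h0 : 0 ≤ off) (h1 : off < (z - y) ^ 2 / 2) :
    embed Y (gapPoint y z off) = embed Y y + off := by
  unfold gapPoint
  split_ifs with h
  · have hs : √off ≤ (z - y) / 2 := by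
      rw [Real.sqrt_le_left (by linarith)]; linarith [sq (z - y), sq ((z - y) / 2)]
    rw [embed_left hy hgap (by linarith [Real.sqrt_nonneg off]) (by linarith),
      add_sub_cancel_left, Real.sq_sqrt h0]
  · push Not at h
    have hs : √((z - y) ^ 2 / 2 - off) ≤ (z - y) / 2 := by
      rw [Real.sqrt_le_left (by linarith)]; linarith [sq (z - y), sq ((z - y) / 2)]
    rw [embed_right hz hgap (by linarith) (by linarith [Real.sqrt_nonneg ((z - y) ^ 2 / 2 - off)]),
      sub_sub_cancel, Real.sq_sqrt (by linarith), embed_gap hy hz hyz hgap]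
    ring

end Gap

section Embedding

variable {d k : ℕ}

/-- The set of the `i`-th coordinates of the centers. -/
def coords (C : Fin k → Pt d) (i : Fin d) : Set ℝ := Set.range fun j => C j i

lemma coords_finite (C : Fin k → Pt d) (i : Fin d) : (coords C i).Finite := Set.finite_range _

lemma coords_nonempty (hk : 0 < k) (C : Fin k → Pt d) (i : Fin d) : (coords C i).Nonempty :=
  ⟨_, ⟨0, hk⟩, rfl⟩

lemma coords_ncard_le (C : Fin k → Pt d) (i : Fin d) : (coords C i).ncard ≤ k := by
  unfold coords
  rw [← Set.image_univ]
  exact (Set.ncard_image_le Set.finite_univ).trans (by simp)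

/-- The terminal embedding: coordinate `i` is mapped by `embed`. -/
def termEmbed (C : Fin k → Pt d) (x : Pt d) : Pt d := fun i => embed (coords C i) (x i)

lemma termEmbed_le_iff (hk : 0 < k) (C : Fin k → Pt d) (x : Pt d) (i : Fin d) (θ : ℝ) :
    termEmbed C x i ≤ θ ↔ x i ≤ embedInv (coords C i) θ := by
  have hf := coords_finite C i
  have hn := coords_nonempty hk C i
  rw [← (embed_strictMono hf hn).le_iff_le (b := embedInv _ _), embed_embedInv hf hn]
  rfl

lemma termEmbed_coord_lt_iff (hk : 0 < k) (C : Fin k → Pt d) (x y : Pt d) (i : Fin d) :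
    termEmbed C x i < termEmbed C y i ↔ x i < y i :=
  (embed_strictMono (coords_finite C i) (coords_nonempty hk C i)).lt_iff_lt

lemma termEmbed_injective (hk : 0 < k) (C : Fin k → Pt d) : Function.Injective (termEmbed C) := by
  intro x y h
  funext i
  exact (embed_strictMono (coords_finite C i) (coords_nonempty hk C i)).injective (congrFun h i)

lemma termEmbed_cutPreserving (hk : 0 < k) (C : Fin k → Pt d) : CutPreserving (termEmbed C) := by
  constructor
  · rintro ⟨i, θ⟩
    refine ⟨(i, embedInv (coords C i) θ), ?_⟩
    ext x
    exact (termEmbed_le_iff hk C x i θ).symm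
  · rintro ⟨i, θ⟩
    refine ⟨(i, embed (coords C i) θ), ?_⟩
    ext x
    exact ((embed_strictMono (coords_finite C i) (coords_nonempty hk C i)).le_iff_le).symm

lemma l1Dist_termEmbed_le (C : Fin k → Pt d) (x : Pt d) (j : Fin k) :
    l1Dist (termEmbed C x) (termEmbed C (C j)) ≤ sqDist x (C j) :=
  Finset.sum_le_sum fun i _ => abs_embed_sub_le (Set.mem_range_self j) (x i)

lemma sqDist_le_l1Dist_termEmbed (hk : 0 < k) (C : Fin k → Pt d) (x y : Pt d) :
    sqDist x y ≤ 8 * (k : ℝ) * l1Dist (termEmbed C x) (termEmbed C y) := by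
  have hk' : (0 : ℝ) < k := by exact_mod_cast hk
  unfold sqDist l1Dist
  rw [Finset.mul_sum]
  refine Finset.sum_le_sum fun i _ => ?_
  have hb := fun {a b : ℝ} (hab : a ≤ b) => sq_le_embed_sub (coords_finite C i)
    (coords_nonempty hk C i) hk (coords_ncard_le C i) hab
  have habs := abs_nonneg (termEmbed C x i - termEmbed C y i)
  rcases le_total (x i) (y i) with h | h
  · have h1 := hb h
    have h2 := neg_le_abs (termEmbed C x i - termEmbed C y i)
    have h3 : 0 ≤ termEmbed C y i - termEmbed C x i := sub_nonneg.2 (embed_mono _ h)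
    have h4 : termEmbed C y i - termEmbed C x i = embed (coords C i) (y i) - embed (coords C i) (x i) := rfl
    have h5 := mul_le_mul_of_nonneg_left h2 hk'.le
    have h6 := mul_nonneg hk'.le habs
    rw [← h4] at h1
    nlinarith
  · have h1 := hb h
    have h2 := le_abs_self (termEmbed C x i - termEmbed C y i)
    have h4 : termEmbed C x i - termEmbed C y i = embed (coords C i) (x i) - embed (coords C i) (y i) := rfl
    have h5 := mul_le_mul_of_nonneg_left h2 hk'.le
    have h6 := mul_nonneg hk'.le habs
    rw [← h4] at h1
    nlinarith

lemma termEmbed_isTerminalEmbedding (hk : 0 < k) (C : Fin k → Pt d) :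
    IsTerminalEmbedding (termEmbed C) (Set.range C) (8 * (k : ℝ)) := by
  rintro x _ ⟨j, rfl⟩
  exact ⟨l1Dist_termEmbed_le C x j, sqDist_le_l1Dist_termEmbed hk C x (C j)⟩

end Embedding

/-! ### Choosing a random cut from a union of intervals -/

lemma cutMeasure_apply {d : ℕ} {S : Set (Cut d)} (hS : MeasurableSet S) :
    cutMeasure d S = ∑ i, volume {θ : ℝ | (i, θ) ∈ S} := by
  unfold cutMeasure
  rw [Measure.prod_apply hS, lintegral_count, tsum_fintype]
  rfl

section Allocation

variable {d k : ℕ} (base w : Fin d × Fin k → ℝ)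

/-- The weights of the cells in the order of their numbers `a + k * i`. -/
def linWeight (n : ℕ) : ℝ := if h : n < d * k then w (finProdFinEquiv.symm ⟨n, h⟩) else 0

/-- The total weight of the first `n` cells. -/
def cumWeight (n : ℕ) : ℝ := ∑ m ∈ Finset.range n, linWeight w m

/-- The number of a cell. -/
def cellNum (c : Fin d × Fin k) : ℕ := finProdFinEquiv c

/-- The total weight of the cells. -/
def totalWeight : ℝ := ∑ c, w c

/-- The interval of the numbers in `[0, totalWeight)` that select the cell `c`. -/
def cellRange (c : Fin d × Fin k) : Set ℝ :=
  {r | cumWeight w (cellNum c) ≤ r ∧ r < cumWeight w (cellNum c) + w c}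

open Classical in
/-- Select a cell with probability proportional to its weight, and a uniformly random point of the
interval of length `w c` that starts at `base c`. -/
def allocate (w₀ : Cut d) (u : ℝ) : Cut d :=
  if h : ∃ c, u * totalWeight w ∈ cellRange w c then
    (h.choose.1, base h.choose + (u * totalWeight w - cumWeight w (cellNum h.choose)))
  else w₀

variable {base w}

lemma linWeight_cellNum (c : Fin d × Fin k) : linWeight w (cellNum c) = w c := by
  unfold linWeight cellNum
  rw [dif_pos (finProdFinEquiv c).2]
  exact congrArg w (finProdFinEquiv.symm_apply_apply c)

lemma cumWeight_succ (n : ℕ) : cumWeight w (n + 1) = cumWeight w n + linWeight w n :=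
  Finset.sum_range_succ _ _

lemma cumWeight_total : cumWeight w (d * k) = totalWeight w := by
  unfold cumWeight totalWeight
  rw [Finset.sum_range, ← finProdFinEquiv.symm.sum_comp]
  refine Finset.sum_congr rfl fun n _ => ?_
  unfold linWeight
  rw [dif_pos n.2]

variable (hw : ∀ c, 0 ≤ w c)
include hw

lemma linWeight_nonneg (n : ℕ) : 0 ≤ linWeight w n := by
  unfold linWeight; split_ifs <;> simp [hw]

lemma cumWeight_mono : Monotone (cumWeight w) := fun _ _ h =>
  Finset.sum_le_sum_of_subset_of_nonneg (Finset.range_mono h) fun _ _ _ => linWeight_nonneg hw _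

lemma cellRange_disjoint {c c' : Fin d × Fin k} {r : ℝ} (h : r ∈ cellRange w c)
    (h' : r ∈ cellRange w c') : c = c' := by
  have key : ∀ c c' : Fin d × Fin k, r ∈ cellRange w c → r ∈ cellRange w c' →
      cellNum c' ≤ cellNum c := by
    intro c c' h h'
    by_contra hcon
    have h1 := cumWeight_mono hw (Nat.succ_le_of_lt (not_le.1 hcon))
    rw [Nat.succ_eq_add_one, cumWeight_succ, linWeight_cellNum] at h1
    exact absurd h.2 (not_lt.2 (h1.trans h'.1))
  have := le_antisymm (key c' c h' h) (key c c' h h')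
  exact finProdFinEquiv.injective (Fin.ext this)

lemma exists_mem_cellRange {r : ℝ} (h0 : 0 ≤ r) (h1 : r < totalWeight w) :
    ∃ c, r ∈ cellRange w c := by
  rw [← cumWeight_total] at h1
  have hex : ∃ n, r < cumWeight w n := ⟨_, h1⟩
  have hN : Nat.find hex ≤ d * k := Nat.find_min' hex h1
  rcases hn : Nat.find hex with _ | n
  · have := Nat.find_spec hex
    rw [hn] at this
    simp only [cumWeight, Finset.range_zero, Finset.sum_empty] at this
    linarith
  · have hlt : n < d * k := by omega
    refine ⟨finProdFinEquiv.symm ⟨n, hlt⟩, ?_⟩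
    have e : cellNum (finProdFinEquiv.symm ⟨n, hlt⟩ : Fin d × Fin k) = n := by
      rw [cellNum, Equiv.apply_symm_apply]
    have hspec := Nat.find_spec hex
    rw [hn, cumWeight_succ] at hspec
    have hmin := Nat.find_min hex (m := n) (by omega)
    unfold cellRange
    refine ⟨?_, ?_⟩
    · rw [e]; exact not_lt.1 hmin
    · rw [← linWeight_cellNum (w := w), e]; exact hspec

lemma cellRange_subset (c : Fin d × Fin k) {r : ℝ} (h : r ∈ cellRange w c) :
    0 ≤ r ∧ r < totalWeight w := by
  refine ⟨le_trans (Finset.sum_nonneg fun n _ => linWeight_nonneg hw n) h.1, h.2.trans_le ?_⟩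
  rw [← linWeight_cellNum (w := w), ← cumWeight_succ, ← cumWeight_total]
  exact cumWeight_mono hw (Nat.succ_le_of_lt (finProdFinEquiv c).2)

lemma allocate_of_mem {w₀ : Cut d} {u : ℝ} {c : Fin d × Fin k}
    (h : u * totalWeight w ∈ cellRange w c) : allocate base w w₀ u =
      (c.1, base c + (u * totalWeight w - cumWeight w (cellNum c))) := by
  have hex : ∃ c, u * totalWeight w ∈ cellRange w c := ⟨c, h⟩
  have e : hex.choose = c := cellRange_disjoint hw hex.choose_spec h
  unfold allocate
  rw [dif_pos hex, e]

omit hw in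
lemma allocate_of_forall_notMem {w₀ : Cut d} {u : ℝ}
    (h : ∀ c, u * totalWeight w ∉ cellRange w c) : allocate base w w₀ u = w₀ :=
  dif_neg (not_exists.2 h)

omit hw in
lemma measurableSet_cellRange (c : Fin d × Fin k) :
    MeasurableSet {u : ℝ | u * totalWeight w ∈ cellRange w c} := by
  have : Measurable fun u : ℝ => u * totalWeight w := measurable_id.mul_const _
  exact (measurableSet_le measurable_const this).inter (measurableSet_lt this measurable_const)

omit hw in
lemma measurable_cell (c : Fin d × Fin k) : Measurable fun u : ℝ =>
    ((c.1, base c + (u * totalWeight w - cumWeight w (cellNum c))) : Cut d) :=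
  measurable_const.prodMk (((measurable_id.mul_const _).sub_const _).const_add _)

lemma measurable_allocate (w₀ : Cut d) : Measurable (allocate base w w₀) := by
  intro B hB
  have : allocate base w w₀ ⁻¹' B =
      (⋃ c, {u : ℝ | u * totalWeight w ∈ cellRange w c} ∩ (fun u : ℝ =>
        ((c.1, base c + (u * totalWeight w - cumWeight w (cellNum c))) : Cut d)) ⁻¹' B) ∪
      ((⋃ c, {u : ℝ | u * totalWeight w ∈ cellRange w c})ᶜ ∩ {_u : ℝ | w₀ ∈ B}) := by
    ext u
    simp only [Set.mem_preimage, Set.mem_union, Set.mem_iUnion, Set.mem_inter_iff,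
      Set.mem_ofPred_eq, Set.mem_compl_iff, not_exists]
    by_cases h : ∃ c, u * totalWeight w ∈ cellRange w c
    · obtain ⟨c, hc⟩ := h
      rw [allocate_of_mem hw hc]
      constructor
      · intro hu; exact Or.inl ⟨c, hc, hu⟩
      · rintro (⟨c', hc', hu⟩ | ⟨hu, -⟩)
        · rwa [cellRange_disjoint hw hc hc']
        · exact absurd hc (hu c)
    · rw [not_exists] at h
      rw [allocate_of_forall_notMem h]
      constructor
      · intro hu; exact Or.inr ⟨h, hu⟩
      · rintro (⟨c', hc', -⟩ | ⟨-, hu⟩)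
        · exact absurd hc' (h c')
        · exact hu
  rw [this]
  refine (MeasurableSet.iUnion fun c => (measurableSet_cellRange c).inter (measurable_cell c hB)).union
    ((MeasurableSet.iUnion fun c => measurableSet_cellRange c).compl.inter (MeasurableSet.const _))

variable {R : Set (Cut d)}
  (hR : ∀ i θ, (i, θ) ∈ R ↔ ∃ a, θ ∈ Set.Ico (base (i, a)) (base (i, a) + w (i, a)))
include hR

lemma allocate_mem (w₀ : Cut d) (hW : 0 < totalWeight w) {u : ℝ} (hu : u ∈ Set.Ico (0 : ℝ) 1) :
    allocate base w w₀ u ∈ R := by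
  obtain ⟨c, hc⟩ := exists_mem_cellRange hw (mul_nonneg hu.1 hW.le)
    (by nlinarith [hu.2] : u * totalWeight w < totalWeight w)
  rw [allocate_of_mem hw hc, hR]
  exact ⟨c.2, by linarith [hc.1], by linarith [hc.2]⟩

omit hw in
lemma measurableSet_of_cells : MeasurableSet R := by
  have : R = ⋃ c : Fin d × Fin k, {c.1} ×ˢ Set.Ico (base c) (base c + w c) := by
    ext ⟨i, θ⟩
    rw [hR]
    simp only [Set.mem_iUnion, Set.mem_prod, Set.mem_singleton_iff, Prod.exists]
    constructor
    · rintro ⟨a, ha⟩; exact ⟨i, a, rfl, ha⟩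
    · rintro ⟨_, a, rfl, ha⟩; exact ⟨a, ha⟩
  rw [this]
  exact MeasurableSet.iUnion fun c => (MeasurableSet.singleton _).prod measurableSet_Ico

variable (hdisj : ∀ i a a' θ, θ ∈ Set.Ico (base (i, a)) (base (i, a) + w (i, a)) →
  θ ∈ Set.Ico (base (i, a')) (base (i, a') + w (i, a')) → a = a')
include hdisj

omit hw in
lemma cutMeasure_inter_cells {B : Set (Cut d)} (hB : MeasurableSet B) :
    cutMeasure d (R ∩ B) =
      ∑ c : Fin d × Fin k, volume (Set.Ico (base c) (base c + w c) ∩ {θ | (c.1, θ) ∈ B}) := by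
  rw [cutMeasure_apply ((measurableSet_of_cells hR).inter hB), Fintype.sum_prod_type]
  refine Finset.sum_congr rfl fun i _ => ?_
  have : {θ : ℝ | (i, θ) ∈ R ∩ B} =
      ⋃ a, Set.Ico (base (i, a)) (base (i, a) + w (i, a)) ∩ {θ | (i, θ) ∈ B} := by
    ext θ
    simp only [Set.mem_ofPred_eq, Set.mem_inter_iff, hR, Set.mem_iUnion]
    exact exists_and_right.symm
  rw [this, measure_iUnion, tsum_fintype]
  · intro a a' haa'
    rw [Function.onFun, Set.disjoint_left]
    rintro θ ⟨h1, -⟩ ⟨h2, -⟩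
    exact haa' (hdisj i a a' θ h1 h2)
  · intro a
    exact measurableSet_Ico.inter (measurable_prodMk_left hB)

lemma cutMeasure_cells : cutMeasure d R = ENNReal.ofReal (totalWeight w) := by
  have h := cutMeasure_inter_cells hR hdisj MeasurableSet.univ
  rw [Set.inter_univ] at h
  rw [h, totalWeight, ENNReal.ofReal_sum_of_nonneg fun c _ => hw c]
  refine Finset.sum_congr rfl fun c _ => ?_
  have : {θ : ℝ | (c.1, θ) ∈ (Set.univ : Set (Cut d))} = Set.univ := by ext; simp
  rw [this, Set.inter_univ, Real.volume_Ico, add_sub_cancel_left]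

/-- The allocation turns the uniform distribution on `[0, 1)` into the uniform distribution on the
union of the cells. -/
lemma map_allocate (w₀ : Cut d) (hW : 0 < totalWeight w) :
    Measure.map (allocate base w w₀) uniform01 =
      ProbabilityTheory.cond (cutMeasure d) R := by
  ext B hB
  rw [Measure.map_apply (measurable_allocate hw w₀) hB, ProbabilityTheory.cond_apply
    (measurableSet_of_cells hR), cutMeasure_inter_cells hR hdisj hB, cutMeasure_cells hw hR hdisj,
    uniform01, Measure.restrict_apply (measurable_allocate hw w₀ hB), Finset.mul_sum]
  have hset : allocate base w w₀ ⁻¹' B ∩ Set.Ico 0 1 =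
      ⋃ c, {u : ℝ | u * totalWeight w ∈ cellRange w c} ∩ (fun u : ℝ =>
        ((c.1, base c + (u * totalWeight w - cumWeight w (cellNum c))) : Cut d)) ⁻¹' B := by
    ext u
    simp only [Set.mem_inter_iff, Set.mem_preimage, Set.mem_iUnion, Set.mem_ofPred_eq]
    constructor
    · rintro ⟨hu, hu'⟩
      obtain ⟨c, hc⟩ := exists_mem_cellRange hw (mul_nonneg hu'.1 hW.le)
        (by nlinarith [hu'.2] : u * totalWeight w < totalWeight w)
      rw [allocate_of_mem hw hc] at hu
      exact ⟨c, hc, hu⟩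
    · rintro ⟨c, hc, hu⟩
      rw [allocate_of_mem hw hc]
      obtain ⟨h1, h2⟩ := cellRange_subset hw c hc
      exact ⟨hu, nonneg_of_mul_nonneg_left h1 hW, by nlinarith⟩
  rw [hset, measure_iUnion, tsum_fintype]
  · refine Finset.sum_congr rfl fun c _ => ?_
    set W := totalWeight w
    set v := base c - cumWeight w (cellNum c) with hv
    have : {u : ℝ | u * W ∈ cellRange w c} ∩ (fun u : ℝ =>
        ((c.1, base c + (u * W - cumWeight w (cellNum c))) : Cut d)) ⁻¹' B =
        (fun u => u * W) ⁻¹' ((fun r => r + v) ⁻¹'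
          (Set.Ico (base c) (base c + w c) ∩ {θ | (c.1, θ) ∈ B})) := by
      ext u
      simp only [Set.mem_inter_iff, Set.mem_preimage, Set.mem_ofPred_eq, cellRange, Set.mem_Ico]
      have e : base c + (u * W - cumWeight w (cellNum c)) = u * W + v := by rw [hv]; ring
      rw [e]
      refine and_congr_left fun _ => and_congr ?_ ?_ <;> rw [hv] <;> constructor <;> intro <;> linarith
    rw [this, Real.volume_preimage_mul_right hW.ne', measure_preimage_add_right,
      abs_of_pos (inv_pos.2 hW), ENNReal.ofReal_inv_of_pos hW]
  · intro c c' hcc'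
    rw [Function.onFun, Set.disjoint_left]
    rintro u ⟨h1, -⟩ ⟨h2, -⟩
    exact hcc' (cellRange_disjoint hw h1 h2)
  · exact fun c => (measurableSet_cellRange c).inter (measurable_cell c hB)

end Allocation

/-! ### The cuts of `ℝ^d` as a finite cut system -/

lemma measurableSet_sepCuts {d : ℕ} (x y : Pt d) : MeasurableSet (sepCuts x y) := by
  have h : ∀ z : Pt d, MeasurableSet {w : Cut d | w.2 < z w.1} := fun z =>
    measurableSet_lt measurable_snd ((measurable_of_finite z).comp measurable_fst)
  have : sepCuts x y = ({w : Cut d | w.2 < x w.1} ∩ {w : Cut d | w.2 < y w.1}ᶜ) ∪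
      ({w : Cut d | w.2 < y w.1} ∩ {w : Cut d | w.2 < x w.1}ᶜ) := by
    ext w
    simp only [sepCuts, Set.mem_ofPred_eq, Set.mem_union, Set.mem_inter_iff, Set.mem_compl_iff]
    tauto
  rw [this]
  exact ((h x).inter (h y).compl).union ((h y).inter (h x).compl)

lemma cutMeasure_sepCuts {d : ℕ} (x y : Pt d) :
    cutMeasure d (sepCuts x y) = ENNReal.ofReal (l1Dist x y) := by
  rw [cutMeasure_apply (measurableSet_sepCuts x y), l1Dist,
    ENNReal.ofReal_sum_of_nonneg fun i _ => abs_nonneg _]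
  refine Finset.sum_congr rfl fun i _ => ?_
  have : {θ : ℝ | (i, θ) ∈ sepCuts x y} = Set.Ico (min (x i) (y i)) (max (x i) (y i)) := by
    ext θ
    simp only [sepCuts, Set.mem_ofPred_eq, Set.mem_Ico, min_le_iff, lt_max_iff]
    rcases lt_or_ge θ (x i) with h1 | h1 <;> rcases lt_or_ge θ (y i) with h2 | h2 <;>
      simp [h1, h2, not_lt.2, not_le.2]
  rw [this, Real.volume_Ico, max_sub_min_eq_abs']

lemma l1Dist_nonneg {d : ℕ} (x y : Pt d) : 0 ≤ l1Dist x y :=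
  Finset.sum_nonneg fun _ _ => abs_nonneg _

lemma l1Dist_pos {d : ℕ} {x y : Pt d} (h : x ≠ y) : 0 < l1Dist x y := by
  obtain ⟨i, hi⟩ := Function.ne_iff.1 h
  exact (abs_pos.2 (sub_ne_zero.2 hi)).trans_le
    (Finset.single_le_sum (f := fun i => |x i - y i|) (fun _ _ => abs_nonneg _) (Finset.mem_univ i))

lemma l1Dist_triangle {d : ℕ} (x y z : Pt d) : l1Dist x z ≤ l1Dist x y + l1Dist y z := by
  unfold l1Dist
  rw [← Finset.sum_add_distrib]
  exact Finset.sum_le_sum fun i _ => abs_sub_le _ _ _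

section Bridge

variable {d k : ℕ} {P : Type} [Fintype P] [DecidableEq P] (pts : P → Pt d) (ctr : Fin k → P)

/-- The set of the points on the right side of the cut `w`. -/
def pattern (w : Cut d) : P → Prop := fun p => w.2 < pts p w.1

lemma measurable_pattern : Measurable (pattern pts) :=
  measurable_pi_lambda _ fun p => measurable_to_prop (by
    have : (fun w : Cut d => pattern pts w p) ⁻¹' {True} = {w : Cut d | w.2 < pts p w.1} := by
      ext w; simp [pattern]
    rw [this]
    exact measurableSet_lt measurable_snd ((measurable_of_finite (pts p)).comp measurable_fst))

/-- The cuts that separate some pair of centers. -/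
def allCuts : Set (Cut d) := ⋃ i, ⋃ j, sepCuts (pts (ctr i)) (pts (ctr j))

lemma measurableSet_allCuts : MeasurableSet (allCuts pts ctr) :=
  MeasurableSet.iUnion fun _ => MeasurableSet.iUnion fun _ => measurableSet_sepCuts _ _

lemma cutMeasure_allCuts_ne_top : cutMeasure d (allCuts pts ctr) ≠ ⊤ := by
  refine ne_top_of_le_ne_top ?_ (measure_iUnion_le _)
  rw [tsum_fintype]
  refine ENNReal.sum_ne_top.2 fun i _ => ne_top_of_le_ne_top ?_ (measure_iUnion_le _)
  rw [tsum_fintype]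
  refine ENNReal.sum_ne_top.2 fun j _ => ?_
  rw [cutMeasure_sepCuts]; exact ENNReal.ofReal_ne_top

/-- The cut system of the points `pts`: cuts with the same right side are identified, and their
weight is the measure of those of them that separate two centers. -/
def cutSystem : CutSystem P (Fin k) (P → Prop) where
  center := ctr
  side ω p := ω p
  weight ω := (cutMeasure d).real (allCuts pts ctr ∩ pattern pts ⁻¹' {ω})
  weight_nonneg _ := measureReal_nonneg

open Classical in
lemma sum_weight_eq (Z : (P → Prop) → Prop) :
    (∑ ω, if Z ω then (cutSystem pts ctr).weight ω else 0) =
      (cutMeasure d).real (allCuts pts ctr ∩ {w | Z (pattern pts w)}) := by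
  rw [← Finset.sum_filter]
  have : allCuts pts ctr ∩ {w | Z (pattern pts w)} =
      ⋃ ω ∈ Finset.univ.filter Z, allCuts pts ctr ∩ pattern pts ⁻¹' {ω} := by
    ext w; simp
  rw [this, measureReal_biUnion_finset _ _ fun ω _ => measure_ne_top_of_subset
    Set.inter_subset_left (cutMeasure_allCuts_ne_top pts ctr)]
  · rfl
  · intro ω _ ω' _ h
    rw [Function.onFun, Set.disjoint_left]
    rintro w ⟨-, h1⟩ ⟨-, h2⟩
    exact h (h1.symm.trans h2)
  · exact fun ω _ => (measurableSet_allCuts pts ctr).inter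
      (measurable_pattern pts (MeasurableSet.singleton ω))

lemma cutSystem_dist (p q : P) : (cutSystem pts ctr).dist p q =
    (cutMeasure d).real (allCuts pts ctr ∩ sepCuts (pts p) (pts q)) := by
  classical
  unfold CutSystem.dist
  convert sum_weight_eq pts ctr fun ω => (cutSystem pts ctr).Sep ω p q
  rfl

/-- Cuts that separate no two centers have weight `0`, so that this is only an inequality. -/
lemma cutSystem_dist_le (p q : P) : (cutSystem pts ctr).dist p q ≤ l1Dist (pts p) (pts q) := by
  rw [cutSystem_dist]
  have h : (cutMeasure d).real (sepCuts (pts p) (pts q)) = l1Dist (pts p) (pts q) := by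
    rw [Measure.real, cutMeasure_sepCuts, ENNReal.toReal_ofReal (l1Dist_nonneg _ _)]
  rw [← h]
  refine measureReal_mono Set.inter_subset_right ?_
  rw [cutMeasure_sepCuts]; exact ENNReal.ofReal_ne_top

lemma cutSystem_dist_center (i j : Fin k) :
    (cutSystem pts ctr).dist (ctr i) (ctr j) = l1Dist (pts (ctr i)) (pts (ctr j)) := by
  rw [cutSystem_dist, Set.inter_eq_self_of_subset_right, Measure.real, cutMeasure_sepCuts,
    ENNReal.toReal_ofReal (l1Dist_nonneg _ _)]
  exact (Set.subset_iUnion _ j).trans (Set.subset_iUnion (fun i => ⋃ j, sepCuts (pts (ctr i)) (pts (ctr j))) i)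

variable (hinj : Function.Injective fun j => pts (ctr j))

include hinj in
lemma cutSystem_separated : (cutSystem pts ctr).Separated := fun i j hij => by
  change 0 < (cutSystem pts ctr).dist (ctr i) (ctr j)
  rw [cutSystem_dist_center]
  exact l1Dist_pos fun h => hij (hinj h)

/-- Two points are related if they are in the same leaf. -/
def treeRel (T : ThresholdTree d) : P → P → Prop := fun p q => T.leafOf (pts p) = T.leafOf (pts q)

variable (T : ThresholdTree d)

include hinj in
lemma allSeparated_iff : AllSeparated (fun j => pts (ctr j)) T ↔
    (cutSystem pts ctr).Done (treeRel pts T) := by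
  constructor
  · intro h i j hij; exact hinj (h (i, j) hij)
  · rintro h ⟨i, j⟩ hij
    have e : i = j := h i j hij
    simp only [e]

lemma maxDist_eq : maxDist (fun j => pts (ctr j)) T = (cutSystem pts ctr).diam (treeRel pts T) := by
  unfold maxDist CutSystem.diam
  exact iSup_congr fun z => (cutSystem_dist_center pts ctr _ _).symm

lemma mem_cutsB_iff (w : Cut d) : w ∈ cutsB (fun j => pts (ctr j)) T ↔
    (cutSystem pts ctr).InB (treeRel pts T) (pattern pts w) := by
  have hD : 0 ≤ maxDist (fun j => pts (ctr j)) T / (k : ℝ) ^ 3 := by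
    rw [maxDist_eq pts ctr]
    exact div_nonneg (CutSystem.diam_nonneg _) (by positivity)
  simp only [cutsB, Set.mem_iUnion, Set.mem_ofPred_eq, exists_prop, Prod.exists, cutMeasure_sepCuts,
    ENNReal.ofReal_le_ofReal_iff hD, CutSystem.InB, Fintype.card_fin]
  refine exists_congr fun i => exists_congr fun j => ?_
  rw [maxDist_eq pts ctr, ← cutSystem_dist_center pts ctr i j]
  change _ ↔ treeRel pts T (ctr i) (ctr j) ∧ w ∈ sepCuts (pts (ctr i)) (pts (ctr j)) ∧ _
  constructor
  · rintro ⟨⟨h1, h2⟩, h3⟩; exact ⟨h1, h3, h2⟩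
  · rintro ⟨h1, h3, h2⟩; exact ⟨⟨h1, h2⟩, h3⟩

lemma mem_cutsR_iff (w : Cut d) : w ∈ cutsR (fun j => pts (ctr j)) T ↔
    (cutSystem pts ctr).Avail (treeRel pts T) (pattern pts w) := by
  unfold cutsR CutSystem.Avail
  rw [Set.mem_sdiff, mem_cutsB_iff]
  refine and_congr_left fun _ => ?_
  simp only [cutsA, Set.mem_iUnion, exists_prop, Prod.exists]
  rfl

lemma cutsR_subset_allCuts : cutsR (fun j => pts (ctr j)) T ⊆ allCuts pts ctr := by
  rintro w ⟨hw, -⟩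
  simp only [cutsA, Set.mem_iUnion] at hw
  obtain ⟨p, -, hp⟩ := hw
  exact Set.mem_iUnion.2 ⟨p.1, Set.mem_iUnion.2 ⟨p.2, hp⟩⟩

lemma measurableSet_cutsR : MeasurableSet (cutsR (fun j => pts (ctr j)) T) := by
  have : cutsR (fun j => pts (ctr j)) T =
      pattern pts ⁻¹' {ω | (cutSystem pts ctr).Avail (treeRel pts T) ω} := by
    ext w; exact mem_cutsR_iff pts ctr T w
  rw [this]
  exact measurable_pattern pts (Set.toFinite _).measurableSet

lemma cutMeasure_cutsR : (cutMeasure d).real (cutsR (fun j => pts (ctr j)) T) =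
    (cutSystem pts ctr).mass (treeRel pts T) := by
  classical
  unfold CutSystem.mass
  have h := sum_weight_eq pts ctr fun ω => (cutSystem pts ctr).Avail (treeRel pts T) ω
  have e : allCuts pts ctr ∩ {w | (cutSystem pts ctr).Avail (treeRel pts T) (pattern pts w)} =
      cutsR (fun j => pts (ctr j)) T := by
    ext w
    rw [Set.mem_inter_iff, Set.mem_ofPred_eq, ← mem_cutsR_iff]
    exact ⟨fun h => h.2, fun h => ⟨cutsR_subset_allCuts pts ctr T h, h⟩⟩
  rw [e] at h
  rw [← h]

open Classical in
lemma cond_pattern (ω : P → Prop) :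
    (ProbabilityTheory.cond (cutMeasure d) (cutsR (fun j => pts (ctr j)) T)).real
        (pattern pts ⁻¹' {ω}) =
      if (cutSystem pts ctr).Avail (treeRel pts T) ω then
        (cutSystem pts ctr).weight ω / (cutSystem pts ctr).mass (treeRel pts T) else 0 := by
  rw [Measure.real, ProbabilityTheory.cond_apply (measurableSet_cutsR pts ctr T), ENNReal.toReal_mul,
    ENNReal.toReal_inv, ← cutMeasure_cutsR]
  split_ifs with h
  · have : cutsR (fun j => pts (ctr j)) T ∩ pattern pts ⁻¹' {ω} =
        allCuts pts ctr ∩ pattern pts ⁻¹' {ω} := by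
      ext w
      simp only [Set.mem_inter_iff, Set.mem_preimage, Set.mem_singleton_iff]
      refine and_congr_left fun hw => ⟨fun h' => cutsR_subset_allCuts pts ctr T h', fun _ => ?_⟩
      rw [mem_cutsR_iff, hw]; exact h
    rw [this, div_eq_inv_mul]; rfl
  · have : cutsR (fun j => pts (ctr j)) T ∩ pattern pts ⁻¹' {ω} = ∅ := by
      ext w
      simp only [Set.mem_inter_iff, Set.mem_preimage, Set.mem_singleton_iff,
        Set.mem_empty_iff_false, iff_false, not_and]
      intro hw hw'
      rw [mem_cutsR_iff, hw'] at hw; exact h hw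
    rw [this]; simp

/-- The expectation of a function of the sides of the points of a random cut. -/
lemma integral_pattern {f : ℝ → Cut d} (hf : Measurable f)
    (hmap : Measure.map f uniform01 =
      ProbabilityTheory.cond (cutMeasure d) (cutsR (fun j => pts (ctr j)) T))
    (g : (P → P → Prop) → ℝ) :
    ∫ u, g ((cutSystem pts ctr).step (treeRel pts T) (pattern pts (f u))) ∂uniform01 =
      (cutSystem pts ctr).next g (treeRel pts T) := by
  classical
  let G : (P → Prop) → ℝ := fun ω => g ((cutSystem pts ctr).step (treeRel pts T) ω)
  have hm : Measurable fun u => pattern pts (f u) := (measurable_pattern pts).comp hf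
  have h1 : ∫ u, G (pattern pts (f u)) ∂uniform01 =
      ∫ ω, G ω ∂(Measure.map (fun u => pattern pts (f u)) uniform01) :=
    (integral_map hm.aemeasurable (measurable_of_finite G).aestronglyMeasurable).symm
  have : IsProbabilityMeasure (Measure.map (fun u => pattern pts (f u)) uniform01) :=
    Measure.isProbabilityMeasure_map hm.aemeasurable
  change ∫ u, G (pattern pts (f u)) ∂uniform01 = _
  rw [h1, integral_fintype (Integrable.of_finite)]
  unfold CutSystem.next
  refine Finset.sum_congr rfl fun ω _ => ?_
  have h2 : (Measure.map (fun u => pattern pts (f u)) uniform01).real {ω} =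
      (Measure.map f uniform01).real (pattern pts ⁻¹' {ω}) := by
    rw [Measure.real, Measure.real, Measure.map_apply hm (MeasurableSet.singleton ω),
      Measure.map_apply hf (measurable_pattern pts (MeasurableSet.singleton ω))]
    rfl
  rw [h2, hmap, cond_pattern]
  split_ifs <;> simp [G]

/-- The effect of `splitLeaves` on the partition into leaves. -/
lemma leafOf_splitLeaves (C : Fin k → Pt d) (w : Cut d) (T : ThresholdTree d) (S : Set (Fin k))
    (x y : Pt d) : (splitLeaves C w T S).leafOf x = (splitLeaves C w T S).leafOf y ↔
      T.leafOf x = T.leafOf y ∧ ((w.2 < x w.1 ↔ w.2 < y w.1) ∨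
        ∀ i ∈ S, ∀ j ∈ S, T.leafOf x = T.leafOf (C i) → T.leafOf x = T.leafOf (C j) →
          (w.2 < C i w.1 ↔ w.2 < C j w.1)) := by
  induction T generalizing S with
  | leaf =>
    simp only [splitLeaves, ThresholdTree.leafOf, true_and, true_implies]
    split_ifs with h
    · obtain ⟨⟨i, hi, hi'⟩, j, hj, hj'⟩ := h
      have hno : ¬ ∀ i ∈ S, ∀ j ∈ S, (w.2 < C i w.1 ↔ w.2 < C j w.1) := fun hall =>
        absurd ((hall i hi j hj).2 hj') (not_lt.2 hi')
      rw [or_iff_left hno]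
      simp only [ThresholdTree.leafOf]
      by_cases h1 : x w.1 ≤ w.2 <;> by_cases h2 : y w.1 ≤ w.2 <;>
        simp [h1, h2, not_lt.2, lt_of_not_ge]
    · simp only [ThresholdTree.leafOf, true_iff]
      right
      intro i hi j hj
      by_contra hcon
      rw [not_iff] at hcon
      by_cases hj' : w.2 < C j w.1
      · exact h ⟨⟨i, hi, not_lt.1 fun h' => (hcon.2 hj') h'⟩, j, hj, hj'⟩
      · exact h ⟨⟨j, hj, not_lt.1 hj'⟩, i, hi, by
          by_contra h'; exact hj' (hcon.1 h')⟩
  | node i θ l r ihl ihr =>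
    simp only [splitLeaves, ThresholdTree.leafOf]
    by_cases hx : x i ≤ θ <;> by_cases hy : y i ≤ θ
    · simp only [hx, hy, if_true, List.cons.injEq, true_and]
      rw [ihl]
      refine and_congr_right fun _ => or_congr_right ?_
      constructor
      · intro h a ha b hb hxa hxb
        by_cases hac : C a i ≤ θ <;> by_cases hbc : C b i ≤ θ <;> simp [hac, hbc] at hxa hxb
        exact h a ⟨ha, hac⟩ b ⟨hb, hbc⟩ hxa hxb
      · rintro h a ⟨ha, hac⟩ b ⟨hb, hbc⟩ hxa hxb
        exact h a ha b hb (by simpa [hac] using hxa) (by simpa [hbc] using hxb)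
    · simp [hx, hy]
    · simp [hx, hy]
    · simp only [hx, hy, if_false, List.cons.injEq, true_and]
      rw [ihr]
      refine and_congr_right fun _ => or_congr_right ?_
      constructor
      · intro h a ha b hb hxa hxb
        by_cases hac : C a i ≤ θ <;> by_cases hbc : C b i ≤ θ <;> simp [hac, hbc] at hxa hxb
        exact h a ⟨ha, not_le.1 hac⟩ b ⟨hb, not_le.1 hbc⟩ hxa hxb
      · rintro h a ⟨ha, hac⟩ b ⟨hb, hbc⟩ hxa hxb
        exact h a ha b hb (by simpa [not_le.2 hac] using hxa) (by simpa [not_le.2 hbc] using hxb)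

lemma treeRel_splitLeaves (w : Cut d) :
    treeRel pts (splitLeaves (fun j => pts (ctr j)) w T Set.univ) =
      (cutSystem pts ctr).step (treeRel pts T) (pattern pts w) := by
  funext p q
  refine propext ((leafOf_splitLeaves _ w T Set.univ (pts p) (pts q)).trans ?_)
  refine and_congr_right fun _ => or_congr Iff.rfl ?_
  exact ⟨fun h i j => h i trivial j trivial, fun h i _ j _ => h i j⟩

end Bridge

/-! ### The partitions into leaves as a Markov chain -/

instance : IsProbabilityMeasure seedMeasure := by unfold seedMeasure; infer_instance

lemma treeSeq_congr {d k : ℕ} {C : Fin k → Pt d} {pick : ThresholdTree d → ℝ → Cut d}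
    {u u' : ℕ → ℝ} (t : ℕ) (h : ∀ i < t, u i = u' i) :
    treeSeq C pick u t = treeSeq C pick u' t := by
  induction t with
  | zero => rfl
  | succ t ih =>
    unfold treeSeq
    rw [ih fun i hi => h i (by omega), h t (by omega)]

section Chain

variable {d k : ℕ} {P : Type} [Fintype P] [DecidableEq P] (pts : P → Pt d) (ctr : Fin k → P)

/-- The relation on the centers that is induced by a tree. -/
def centerRel (C : Fin k → Pt d) (T : ThresholdTree d) : Fin k → Fin k → Prop :=
  fun i j => T.leafOf (C i) = T.leafOf (C j)

variable (pk : (Fin k → Fin k → Prop) → ℝ → Cut d)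

/-- A choice of cuts that depends only on the partition of the centers. -/
def relPick (C : Fin k → Pt d) (T : ThresholdTree d) : ℝ → Cut d := pk (centerRel C T)

open Classical in
/-- One round of the process, on the level of the partitions into leaves. -/
def relStep (r : P → P → Prop) (v : ℝ) : P → P → Prop :=
  if (cutSystem pts ctr).Done r then r
  else (cutSystem pts ctr).step r (pattern pts (pk (fun i j => r (ctr i) (ctr j)) v))

variable {pk} (hpk : ∀ E, Measurable (pk E)) (hinj : Function.Injective fun j => pts (ctr j))

include hinj in
lemma treeRel_treeSeq_succ (u : ℕ → ℝ) (t : ℕ) :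
    treeRel pts (treeSeq (fun j => pts (ctr j)) (relPick pk fun j => pts (ctr j)) u (t + 1)) =
      relStep pts ctr pk
        (treeRel pts (treeSeq (fun j => pts (ctr j)) (relPick pk fun j => pts (ctr j)) u t)) (u t) := by
  unfold relStep
  rw [treeSeq]
  have hs := allSeparated_iff pts ctr hinj
    (treeSeq (fun j => pts (ctr j)) (relPick pk fun j => pts (ctr j)) u t)
  by_cases h : AllSeparated (fun j => pts (ctr j))
    (treeSeq (fun j => pts (ctr j)) (relPick pk fun j => pts (ctr j)) u t)
  · rw [if_pos h, if_pos (hs.1 h)]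
  · rw [if_neg h, if_neg fun h' => h (hs.2 h')]
    exact treeRel_splitLeaves pts ctr _ _

include hpk in
lemma measurable_relStep (r : P → P → Prop) : Measurable (relStep pts ctr pk r) := by
  unfold relStep
  split_ifs
  · exact measurable_const
  · exact (measurable_of_finite (α := P → Prop) fun ω => (cutSystem pts ctr).step r ω).comp
      ((measurable_pattern pts).comp (hpk _))

include hpk hinj in
lemma measurable_treeRel_treeSeq (t : ℕ) : Measurable fun u : ℕ → ℝ =>
    treeRel pts (treeSeq (fun j => pts (ctr j)) (relPick pk fun j => pts (ctr j)) u t) := by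
  induction t with
  | zero => exact (measurable_const : Measurable fun _ : ℕ → ℝ => treeRel pts .leaf)
  | succ t ih =>
    simp only [treeRel_treeSeq_succ pts ctr hinj]
    have h : Measurable fun z : (P → P → Prop) × ℝ => relStep pts ctr pk z.1 z.2 :=
      measurable_from_prod_countable_right fun r => measurable_relStep pts ctr hpk r
    exact h.comp (ih.prodMk (measurable_pi_apply t))

include hpk hinj in
/-- The tree after `t` rounds is a function of the first `t` random numbers. -/
lemma indepFun_treeRel_treeSeq (t : ℕ) : ProbabilityTheory.IndepFun (fun u : ℕ → ℝ =>
    treeRel pts (treeSeq (fun j => pts (ctr j)) (relPick pk fun j => pts (ctr j)) u t))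
    (fun u => u t) seedMeasure := by
  have hind : ProbabilityTheory.iIndepFun (fun (i : ℕ) (u : ℕ → ℝ) => u i) seedMeasure :=
    ProbabilityTheory.iIndepFun_infinitePi (P := fun _ => uniform01) (X := fun _ x => x)
      (fun _ => measurable_id)
  have h := hind.indepFun_finset (Finset.range t) {t} (by simp) fun i => measurable_pi_apply i
  let ext : (Finset.range t → ℝ) → ℕ → ℝ := fun y i => if h : i ∈ Finset.range t then y ⟨i, h⟩ else 0
  have hext : Measurable ext := measurable_pi_lambda _ fun i => by
    by_cases hi : i ∈ Finset.range t
    · simp only [ext, hi, dif_pos]; exact measurable_pi_apply _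
    · simp only [ext, hi]; exact measurable_const
  have h' := h.comp ((measurable_treeRel_treeSeq pts ctr hpk hinj t).comp hext)
    (measurable_pi_apply (⟨t, Finset.mem_singleton_self t⟩ : ({t} : Finset ℕ)))
  have e : ((fun u : ℕ → ℝ =>
      treeRel pts (treeSeq (fun j => pts (ctr j)) (relPick pk fun j => pts (ctr j)) u t)) ∘ ext) ∘
      (fun (u : ℕ → ℝ) (i : Finset.range t) => u i) = fun u : ℕ → ℝ =>
      treeRel pts (treeSeq (fun j => pts (ctr j)) (relPick pk fun j => pts (ctr j)) u t) := by
    funext u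
    simp only [Function.comp]
    rw [treeSeq_congr t]
    intro i hi
    simp [ext, hi]
  rw [e] at h'
  exact h'

include hpk hinj in
/-- The expectation of a function of the partition after `t` rounds. -/
theorem integral_treeRel_treeSeq
    (hu : IsUniformChoice (fun j => pts (ctr j)) (relPick pk fun j => pts (ctr j)))
    (g : (P → P → Prop) → ℝ) (t : ℕ) :
    ∫ u, g (treeRel pts
      (treeSeq (fun j => pts (ctr j)) (relPick pk fun j => pts (ctr j)) u t)) ∂seedMeasure =
      (cutSystem pts ctr).avg^[t] g (fun _ _ => True) := by
  induction t generalizing g with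
  | zero =>
    have : ∀ u, treeRel pts (treeSeq (fun j => pts (ctr j)) (relPick pk fun j => pts (ctr j)) u 0) =
        fun _ _ => True := fun u => by
      funext p q; simp [treeRel, treeSeq, ThresholdTree.leafOf]
    simp [this]
  | succ t ih =>
    rw [Function.iterate_succ_apply, ← ih]
    simp only [treeRel_treeSeq_succ pts ctr hinj]
    set X := fun u : ℕ → ℝ =>
      treeRel pts (treeSeq (fun j => pts (ctr j)) (relPick pk fun j => pts (ctr j)) u t) with hX
    have hXm : Measurable X := measurable_treeRel_treeSeq pts ctr hpk hinj t
    have hg : Measurable g := measurable_of_finite g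
    have hstep : Measurable fun z : (P → P → Prop) × ℝ => relStep pts ctr pk z.1 z.2 :=
      measurable_from_prod_countable_right fun r => measurable_relStep pts ctr hpk r
    have hlaw : Measure.map (fun u : ℕ → ℝ => u t) seedMeasure = uniform01 :=
      Measure.infinitePi_map_eval (μ := fun _ : ℕ => uniform01) t
    have hprod := (ProbabilityTheory.indepFun_iff_map_prod_eq_prod_map_map hXm.aemeasurable
      (measurable_pi_apply t).aemeasurable).1 (indepFun_treeRel_treeSeq pts ctr hpk hinj t)
    rw [hlaw] at hprod
    have : IsProbabilityMeasure (Measure.map X seedMeasure) :=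
      Measure.isProbabilityMeasure_map hXm.aemeasurable
    obtain ⟨B, hB⟩ := (Set.finite_range fun r => ‖g r‖).bddAbove
    have hint : Integrable (fun z : (P → P → Prop) × ℝ => g (relStep pts ctr pk z.1 z.2))
        ((Measure.map X seedMeasure).prod uniform01) :=
      Integrable.of_bound (hg.comp hstep).aestronglyMeasurable B
        (Filter.Eventually.of_forall fun z => hB ⟨_, rfl⟩)
    calc ∫ u, g (relStep pts ctr pk (X u) (u t)) ∂seedMeasure
        = ∫ z, g (relStep pts ctr pk z.1 z.2) ∂(Measure.map (fun u => (X u, u t)) seedMeasure) :=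
          (integral_map (hXm.prodMk (measurable_pi_apply t)).aemeasurable
            (hg.comp hstep).aestronglyMeasurable).symm
      _ = ∫ r, ∫ v, g (relStep pts ctr pk r v) ∂uniform01 ∂(Measure.map X seedMeasure) := by
          rw [hprod, integral_prod _ hint]
      _ = ∫ u, ∫ v, g (relStep pts ctr pk (X u) v) ∂uniform01 ∂seedMeasure :=
          integral_map hXm.aemeasurable
            (measurable_of_finite fun r => ∫ v, g (relStep pts ctr pk r v) ∂uniform01).aestronglyMeasurable
      _ = _ := by
          refine integral_congr_ae (Filter.Eventually.of_forall fun u => ?_)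
          change ∫ v, g (relStep pts ctr pk (X u) v) ∂uniform01 = (cutSystem pts ctr).avg g (X u)
          rw [CutSystem.avg]
          by_cases hd : (cutSystem pts ctr).Done (X u)
          · simp [relStep, hd]
          · have hsep := fun h => hd ((allSeparated_iff pts ctr hinj _).1 h)
            rw [if_neg hd]
            simp only [relStep, hd, if_false]
            exact integral_pattern pts ctr _ (hpk _) (hu _ hsep).2 g

end Chain

/-! ### Leaves and costs of threshold trees -/

section Trees

variable {d k : ℕ}

/-- Every leaf of the tree contains one of the centers with index in `S`. -/
def LeavesInhabited (C : Fin k → Pt d) : ThresholdTree d → Set (Fin k) → Prop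
  | .leaf, S => S.Nonempty
  | .node i θ l r, S => LeavesInhabited C l {j ∈ S | C j i ≤ θ} ∧
      LeavesInhabited C r {j ∈ S | θ < C j i}

lemma LeavesInhabited.split {C : Fin k → Pt d} (w : Cut d) {T : ThresholdTree d} {S : Set (Fin k)}
    (h : LeavesInhabited C T S) : LeavesInhabited C (splitLeaves C w T S) S := by
  induction T generalizing S with
  | leaf =>
    unfold splitLeaves
    split_ifs with hs
    · obtain ⟨⟨i, hi, hi'⟩, j, hj, hj'⟩ := hs
      exact ⟨⟨i, hi, hi'⟩, ⟨j, hj, hj'⟩⟩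
    · exact h
  | node i θ l r ihl ihr => exact ⟨ihl h.1, ihr h.2⟩

lemma ncard_split (C : Fin k → Pt d) (i : Fin d) (θ : ℝ) (S : Set (Fin k)) :
    {j ∈ S | C j i ≤ θ}.ncard + {j ∈ S | θ < C j i}.ncard = S.ncard := by
  rw [← Set.ncard_union_eq]
  · congr 1
    ext j
    simp only [Set.mem_union, Set.mem_ofPred_eq, ← and_or_left, le_or_gt, and_true]
  · rw [Set.disjoint_left]
    rintro j ⟨-, h1⟩ ⟨-, h2⟩
    exact absurd h1 (not_le.2 h2)

lemma LeavesInhabited.numLeaves_le {C : Fin k → Pt d} {T : ThresholdTree d} {S : Set (Fin k)}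
    (h : LeavesInhabited C T S) : T.numLeaves ≤ S.ncard := by
  induction T generalizing S with
  | leaf => exact (Set.ncard_pos (Set.toFinite _)).2 h
  | node i θ l r ihl ihr =>
    rw [← ncard_split C i θ S]
    exact add_le_add (ihl h.1) (ihr h.2)

lemma ncard_le_numLeaves {C : Fin k → Pt d} {T : ThresholdTree d} {S : Set (Fin k)}
    (h : ∀ a ∈ S, ∀ b ∈ S, T.leafOf (C a) = T.leafOf (C b) → a = b) : S.ncard ≤ T.numLeaves := by
  induction T generalizing S with
  | leaf =>
    exact (Set.ncard_le_one (Set.toFinite _)).2 fun a ha b hb => h a ha b hb rfl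
  | node i θ l r ihl ihr =>
    rw [← ncard_split C i θ S]
    refine add_le_add (ihl fun a ha b hb hab => h a ha.1 b hb.1 ?_)
      (ihr fun a ha b hb hab => h a ha.1 b hb.1 ?_)
    · simp only [ThresholdTree.leafOf, if_pos ha.2, if_pos hb.2, hab]
    · simp only [ThresholdTree.leafOf, if_neg (not_le.2 ha.2), if_neg (not_le.2 hb.2), hab]

lemma numLeaves_le_split (C : Fin k → Pt d) (w : Cut d) (T : ThresholdTree d) (S : Set (Fin k)) :
    T.numLeaves ≤ (splitLeaves C w T S).numLeaves := by
  induction T generalizing S with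
  | leaf => unfold splitLeaves; split_ifs <;> simp [ThresholdTree.numLeaves]
  | node i θ l r ihl ihr => exact add_le_add (ihl _) (ihr _)

lemma numLeaves_lt_split {C : Fin k → Pt d} {w : Cut d} {T : ThresholdTree d} {S : Set (Fin k)}
    {a b : Fin k} (ha : a ∈ S) (hb : b ∈ S) (hab : T.leafOf (C a) = T.leafOf (C b))
    (ha' : C a w.1 ≤ w.2) (hb' : w.2 < C b w.1) :
    T.numLeaves < (splitLeaves C w T S).numLeaves := by
  induction T generalizing S with
  | leaf =>
    unfold splitLeaves
    rw [if_pos ⟨⟨a, ha, ha'⟩, b, hb, hb'⟩]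
    simp [ThresholdTree.numLeaves]
  | node i θ l r ihl ihr =>
    simp only [ThresholdTree.leafOf] at hab
    by_cases h1 : C a i ≤ θ <;> by_cases h2 : C b i ≤ θ <;> simp [h1, h2] at hab
    · exact add_lt_add_of_lt_of_le (ihl ⟨ha, h1⟩ ⟨hb, h2⟩ hab) (numLeaves_le_split _ _ _ _)
    · exact add_lt_add_of_le_of_lt (numLeaves_le_split _ _ _ _)
        (ihr ⟨ha, not_le.1 h1⟩ ⟨hb, not_le.1 h2⟩ hab)

section Rounds

variable {C : Fin k → Pt d} {pick : ThresholdTree d → ℝ → Cut d}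

lemma treeSeq_leavesInhabited (hk : 0 < k) (u : ℕ → ℝ) (t : ℕ) :
    LeavesInhabited C (treeSeq C pick u t) Set.univ := by
  induction t with
  | zero => exact ⟨⟨0, hk⟩, trivial⟩
  | succ t ih =>
    unfold treeSeq
    split_ifs
    · exact ih
    · exact ih.split _

/-- Every round in which a cut is made splits a leaf. -/
lemma treeSeq_numLeaves (hu : IsUniformChoice C pick) {u : ℕ → ℝ} (hs : u ∈ Seeds) (t : ℕ) :
    AllSeparated C (treeSeq C pick u t) ∨ t + 1 ≤ (treeSeq C pick u t).numLeaves := by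
  induction t with
  | zero => exact Or.inr le_rfl
  | succ t ih =>
    unfold treeSeq
    by_cases h : AllSeparated C (treeSeq C pick u t)
    · rw [if_pos h]; exact Or.inl h
    · rw [if_neg h]
      right
      have h1 := ih.resolve_left h
      obtain ⟨hmem, -⟩ := (hu _ h).1 (u t) (hs t)
      simp only [cutsA, Set.mem_iUnion] at hmem
      obtain ⟨⟨a, b⟩, hab, hsep⟩ := hmem
      change (treeSeq C pick u t).leafOf (C a) = (treeSeq C pick u t).leafOf (C b) at hab
      set w := pick (treeSeq C pick u t) (u t)
      have : (treeSeq C pick u t).numLeaves <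
          (splitLeaves C w (treeSeq C pick u t) Set.univ).numLeaves := by
        change ¬ (w.2 < C a w.1 ↔ w.2 < C b w.1) at hsep
        by_cases h2 : w.2 < C a w.1
        · have h3 : ¬ w.2 < C b w.1 := fun h' => hsep ⟨fun _ => h', fun _ => h2⟩
          exact numLeaves_lt_split trivial trivial hab.symm (not_lt.1 h3) h2
        · have h3 : w.2 < C b w.1 := by
            by_contra h'; exact hsep ⟨fun h => absurd h h2, fun h => absurd h h'⟩
          exact numLeaves_lt_split trivial trivial hab (not_lt.1 h2) h3
      omega

/-- After `k` rounds all centers are separated. -/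
lemma treeSeq_allSeparated (hk : 0 < k) (hu : IsUniformChoice C pick) {u : ℕ → ℝ}
    (hs : u ∈ Seeds) : AllSeparated C (treeSeq C pick u k) := by
  refine (treeSeq_numLeaves hu hs k).resolve_right fun h => ?_
  have := (treeSeq_leavesInhabited (C := C) (pick := pick) hk u k).numLeaves_le
  simp only [Set.ncard_univ, Nat.card_fin] at this
  omega

lemma treeSeq_numLeaves_eq (hC : Function.Injective C) (hk : 0 < k) (hu : IsUniformChoice C pick)
    {u : ℕ → ℝ} (hs : u ∈ Seeds) : (treeSeq C pick u k).numLeaves = k := by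
  refine le_antisymm ?_ ?_
  · simpa using (treeSeq_leavesInhabited (C := C) (pick := pick) hk u k).numLeaves_le
  · have := ncard_le_numLeaves (C := C) (T := treeSeq C pick u k) (S := Set.univ)
      fun a _ b _ hab => hC (treeSeq_allSeparated hk hu hs (a, b) hab)
    simpa using this

end Rounds

section Pull

/-- Replace every cut by its preimage under the terminal embedding. -/
def pullTree (C : Fin k → Pt d) : ThresholdTree d → ThresholdTree d
  | .leaf => .leaf
  | .node i θ l r => .node i (embedInv (coords C i) θ) (pullTree C l) (pullTree C r)

lemma isPullback_pullTree (hk : 0 < k) (C : Fin k → Pt d) (T : ThresholdTree d) :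
    IsPullback (termEmbed C) T (pullTree C T) := by
  induction T with
  | leaf => trivial
  | node i θ l r ihl ihr =>
    refine ⟨?_, ihl, ihr⟩
    ext x
    exact (termEmbed_le_iff hk C x i θ).symm

lemma leafOf_pullTree (hk : 0 < k) (C : Fin k → Pt d) (T : ThresholdTree d) (x : Pt d) :
    (pullTree C T).leafOf x = T.leafOf (termEmbed C x) := by
  induction T with
  | leaf => rfl
  | node i θ l r ihl ihr =>
    simp only [pullTree, ThresholdTree.leafOf, termEmbed_le_iff hk, ihl, ihr]

lemma numLeaves_pullTree (C : Fin k → Pt d) (T : ThresholdTree d) :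
    (pullTree C T).numLeaves = T.numLeaves := by
  induction T with
  | leaf => rfl
  | node i θ l r ihl ihr => simp only [pullTree, ThresholdTree.numLeaves, ihl, ihr]

end Pull

section Cost

variable {n : ℕ} (X : Fin n → Pt d)

lemma sum_sqDist_mean_le (S : Finset (Fin n)) (c : Pt d) :
    ∑ a ∈ S, sqDist (X a) (mean X S) ≤ ∑ a ∈ S, sqDist (X a) c := by
  unfold sqDist
  rw [Finset.sum_comm, Finset.sum_comm (s := S)]
  refine Finset.sum_le_sum fun i _ => ?_
  rcases S.eq_empty_or_nonempty with rfl | hS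
  · simp
  have hc : (0 : ℝ) < S.card := by exact_mod_cast hS.card_pos
  have hm : ∑ a ∈ S, X a i = S.card * mean X S i := by
    unfold mean; field_simp
  have e : ∀ z : ℝ, ∑ a ∈ S, (X a i - z) ^ 2 =
      ∑ a ∈ S, X a i ^ 2 - 2 * z * (S.card * mean X S i) + S.card * z ^ 2 := by
    intro z
    rw [← hm, Finset.mul_sum, ← Finset.sum_sub_distrib, ← nsmul_eq_mul, ← Finset.sum_const,
      ← Finset.sum_add_distrib]
    exact Finset.sum_congr rfl fun a _ => by ring
  rw [e, e]
  nlinarith [mul_nonneg hc.le (sq_nonneg (mean X S i - c i))]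

lemma filter_not_le (S : Finset (Fin n)) (i : Fin d) (θ : ℝ) (g : Fin n → ℝ) :
    ∑ a ∈ S.filter (fun a => X a i ≤ θ), g a + ∑ a ∈ S.filter (fun a => θ < X a i), g a =
      ∑ a ∈ S, g a := by
  rw [← Finset.sum_filter_add_sum_filter_not S (fun a => X a i ≤ θ)]
  simp only [not_le]

/-- Every leaf may be charged with an arbitrary center instead of its mean. -/
lemma costOn_le (T : ThresholdTree d) (S : Finset (Fin n)) (g : List Bool → Pt d) :
    T.costOn X S ≤ ∑ a ∈ S, sqDist (X a) (g (T.leafOf (X a))) := by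
  induction T generalizing S g with
  | leaf =>
    simpa only [ThresholdTree.costOn, ThresholdTree.leafOf] using sum_sqDist_mean_le X S (g [])
  | node i θ l r ihl ihr =>
    rw [← filter_not_le X S i θ]
    refine add_le_add ((ihl _ fun p => g (false :: p)).trans (le_of_eq ?_))
      ((ihr _ fun p => g (true :: p)).trans (le_of_eq ?_))
    · refine Finset.sum_congr rfl fun a ha => ?_
      rw [ThresholdTree.leafOf, if_pos (Finset.mem_filter.1 ha).2]
    · refine Finset.sum_congr rfl fun a ha => ?_
      rw [ThresholdTree.leafOf, if_neg (not_le.2 (Finset.mem_filter.1 ha).2)]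

/-- The cost is determined by the partition into leaves. -/
lemma costOn_eq (T : ThresholdTree d) (S : Finset (Fin n)) :
    T.costOn X S = ∑ a ∈ S, sqDist (X a)
      (mean X (S.filter fun b => T.leafOf (X b) = T.leafOf (X a))) := by
  induction T generalizing S with
  | leaf => simp [ThresholdTree.costOn, ThresholdTree.leafOf]
  | node i θ l r ihl ihr =>
    rw [← filter_not_le X S i θ, ThresholdTree.costOn, ihl, ihr]
    congr 1
    · refine Finset.sum_congr rfl fun a ha => ?_
      rw [Finset.filter_filter]
      have h := (Finset.mem_filter.1 ha).2
      congr 2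
      refine Finset.filter_congr fun b _ => ?_
      by_cases hb : X b i ≤ θ <;> simp [ThresholdTree.leafOf, h, hb]
    · refine Finset.sum_congr rfl fun a ha => ?_
      rw [Finset.filter_filter]
      have h := (Finset.mem_filter.1 ha).2
      congr 2
      refine Finset.filter_congr fun b _ => ?_
      by_cases hb : X b i ≤ θ
      · simp [ThresholdTree.leafOf, not_le.2 h, hb, not_lt.2 hb]
      · simp [ThresholdTree.leafOf, not_le.2 h, hb, not_le.1 hb]

end Cost
end Trees

/-! ### The cells between neighboring centers -/

section Cells

variable {d k : ℕ} (C : Fin k → Pt d)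

open Classical in
/-- The smallest `i`-th coordinate of a center that exceeds that of center `a`; it is the
coordinate of `a` itself if there is none. -/
def nextVal (i : Fin d) (a : Fin k) : ℝ :=
  if h : (Finset.univ.filter fun b => C a i < C b i).Nonempty then
    (Finset.univ.filter fun b => C a i < C b i).inf' h fun b => C b i
  else C a i

lemma nextVal_spec (i : Fin d) (a : Fin k) :
    (nextVal C i a = C a i ∧ ∀ b, C b i ≤ C a i) ∨
    ∃ b, nextVal C i a = C b i ∧ C a i < C b i ∧ ∀ b', C b' i ≤ C a i ∨ C b i ≤ C b' i := by
  classical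
  unfold nextVal
  split_ifs with h
  · right
    obtain ⟨b, hb, he⟩ := Finset.exists_mem_eq_inf' h fun b => C b i
    refine ⟨b, he, (Finset.mem_filter.1 hb).2, fun b' => ?_⟩
    by_cases hb' : C b' i ≤ C a i
    · exact Or.inl hb'
    · right
      rw [← he]
      exact Finset.inf'_le _ (by simpa using hb')
  · left
    refine ⟨rfl, fun b => ?_⟩
    by_contra hb
    exact h ⟨b, by simpa using hb⟩

lemma nextVal_eq_of_spec {i : Fin d} {a : Fin k} {z : ℝ}
    (hz : (z = C a i ∧ ∀ b, C b i ≤ C a i) ∨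
      ∃ b, z = C b i ∧ C a i < z ∧ ∀ b', C b' i ≤ C a i ∨ z ≤ C b' i) : z = nextVal C i a := by
  rcases nextVal_spec C i a with ⟨h1, h2⟩ | ⟨b, h1, h2, h3⟩
  · rcases hz with ⟨h4, -⟩ | ⟨b, h4, h5, -⟩
    · rw [h1, h4]
    · exact absurd (h2 b) (by rw [← h4]; exact not_le.2 h5)
  · rcases hz with ⟨-, h5⟩ | ⟨b', h4, h5, h6⟩
    · exact absurd (h5 b) (not_le.2 h2)
    · rw [h1]
      refine le_antisymm ((h6 b).resolve_left (not_le.2 h2)) ?_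
      rw [h4] at h5 ⊢
      exact (h3 b').resolve_left (not_le.2 h5)

/-- The length of the image of the cell `c = (i, a)` under the embedding: the cell is the interval from the
`i`-th coordinate of `a` to the next one. Among centers with equal coordinates only the one with
the least index has a cell. -/
def cellWt (c : Fin d × Fin k) : ℝ :=
  open Classical in
  if ∃ b < c.2, C b c.1 = C c.2 c.1 then 0 else (nextVal C c.1 c.2 - C c.2 c.1) ^ 2 / 2

lemma cellWt_nonneg (c : Fin d × Fin k) : 0 ≤ cellWt C c := by
  unfold cellWt; split_ifs
  · exact le_rfl
  · positivity

/-- The left end of the image of the cell `c`. -/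
def cellBase (c : Fin d × Fin k) : ℝ := termEmbed C (C c.2) c.1

/-- The image of the cell `c`. -/
def cellIco (c : Fin d × Fin k) : Set ℝ := Set.Ico (cellBase C c) (cellBase C c + cellWt C c)

variable {C}

lemma cell_gap {c : Fin d × Fin k} {θ : ℝ} (h : θ ∈ cellIco C c) :
    (∀ b < c.2, C b c.1 ≠ C c.2 c.1) ∧ cellWt C c = (nextVal C c.1 c.2 - C c.2 c.1) ^ 2 / 2 ∧
    ∃ b, nextVal C c.1 c.2 = C b c.1 ∧ C c.2 c.1 < C b c.1 ∧
      ∀ b', C b' c.1 ≤ C c.2 c.1 ∨ C b c.1 ≤ C b' c.1 := by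
  have hpos : 0 < cellWt C c := by linarith [h.1, h.2]
  have hno : ¬ ∃ b < c.2, C b c.1 = C c.2 c.1 := by
    intro hex
    unfold cellWt at hpos; rw [if_pos hex] at hpos; exact lt_irrefl _ hpos
  have he : cellWt C c = (nextVal C c.1 c.2 - C c.2 c.1) ^ 2 / 2 := by
    unfold cellWt; rw [if_neg hno]
  refine ⟨fun b hb hbe => hno ⟨b, hb, hbe⟩, he, (nextVal_spec C c.1 c.2).resolve_left ?_⟩
  rintro ⟨h1, -⟩
  rw [he, h1] at hpos
  simp at hpos

lemma cellBase_add_cellWt {c : Fin d × Fin k} {b : Fin k}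
    (h1 : ∀ b < c.2, C b c.1 ≠ C c.2 c.1)
    (h2 : nextVal C c.1 c.2 = C b c.1) (h3 : C c.2 c.1 < C b c.1)
    (h4 : ∀ b', C b' c.1 ≤ C c.2 c.1 ∨ C b c.1 ≤ C b' c.1) :
    cellBase C c + cellWt C c = termEmbed C (C b) c.1 := by
  have hno : ¬ ∃ b < c.2, C b c.1 = C c.2 c.1 := fun ⟨b, hb, hbe⟩ => h1 b hb hbe
  unfold cellWt cellBase termEmbed
  rw [if_neg hno, h2]
  refine (embed_gap (Set.mem_range_self c.2) (Set.mem_range_self b) h3.le ?_).symm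
  rintro _ ⟨b', rfl⟩
  exact h4 b'

/-- A cut in a cell separates the centers up to its left end from the others. -/
lemma lt_termEmbed_iff_of_mem (hk : 0 < k) {c : Fin d × Fin k} {θ : ℝ} (h : θ ∈ cellIco C c)
    (p : Fin k) : θ < termEmbed C (C p) c.1 ↔ C c.2 c.1 < C p c.1 := by
  obtain ⟨h1, -, b, h2, h3, h4⟩ := cell_gap h
  constructor
  · intro hθ
    exact (termEmbed_coord_lt_iff hk C _ _ _).1 (h.1.trans_lt hθ)
  · intro hp
    have := (h4 p).resolve_left (not_le.2 hp)
    refine h.2.trans_le ?_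
    rw [cellBase_add_cellWt h1 h2 h3 h4]
    exact embed_mono _ this

lemma cell_unique (hk : 0 < k) {i : Fin d} {a a' : Fin k} {θ : ℝ} (h : θ ∈ cellIco C (i, a))
    (h' : θ ∈ cellIco C (i, a')) : a = a' := by
  have key : ∀ a a', θ ∈ cellIco C (i, a) → θ ∈ cellIco C (i, a') → C a' i ≤ C a i := by
    intro a a' h h'
    by_contra hcon
    have := (lt_termEmbed_iff_of_mem hk h a').2 (not_le.1 hcon)
    exact absurd h'.1 (not_le.2 this)
  have he := le_antisymm (key a a' h h') (key a' a h' h)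
  rcases lt_trichotomy a a' with hlt | heq | hlt
  · exact absurd he.symm ((cell_gap h').1 a hlt)
  · exact heq
  · exact absurd he ((cell_gap h).1 a' hlt)

lemma exists_cell (hk : 0 < k) {i : Fin d} {p q : Fin k} {θ : ℝ}
    (hp : termEmbed C (C p) i ≤ θ) (hq : θ < termEmbed C (C q) i) : ∃ a, θ ∈ cellIco C (i, a) := by
  classical
  let F : Finset (Fin k) := Finset.univ.filter fun b => termEmbed C (C b) i ≤ θ
  obtain ⟨a₁, ha₁, hmax⟩ := F.exists_max_image (fun b => C b i) ⟨p, by simpa [F] using hp⟩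
  let F' : Finset (Fin k) := Finset.univ.filter fun b => C b i = C a₁ i
  obtain ⟨a, ha, hmin⟩ := F'.exists_min_image id ⟨a₁, by simp [F']⟩
  simp only [F, F', Finset.mem_filter, Finset.mem_univ, true_and, id] at ha₁ hmax ha hmin
  have hbase : cellBase C (i, a) = termEmbed C (C a₁) i := by
    simp only [cellBase, termEmbed, ha]
  have h1 : ∀ b < a, C b i ≠ C a i := fun b hb hbe => absurd (hmin b (hbe.trans ha)) (not_le.2 hb)
  have haq : C a i < C q i := by
    rw [ha]; exact (termEmbed_coord_lt_iff hk C _ _ _).1 (ha₁.trans_lt hq)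
  obtain ⟨b, h2, h3, h4⟩ := (nextVal_spec C i a).resolve_left fun h =>
    absurd (h.2 q) (not_le.2 haq)
  refine ⟨a, by rw [hbase]; exact ha₁, ?_⟩
  rw [cellBase_add_cellWt (c := (i, a)) h1 h2 h3 h4]
  by_contra hcon
  have := hmax b (not_lt.1 hcon)
  rw [← ha] at this
  exact absurd h3 (not_lt.2 this)

variable (C)

/-- The cuts of the cell `c` separate the centers `p` and `q`. -/
def CellSep (c : Fin d × Fin k) (p q : Fin k) : Prop := ¬ (C c.2 c.1 < C p c.1 ↔ C c.2 c.1 < C q c.1)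

variable {C}

lemma mem_sepCuts_iff_exists (hk : 0 < k) (i : Fin d) (θ : ℝ) (p q : Fin k) :
    (i, θ) ∈ sepCuts (termEmbed C (C p)) (termEmbed C (C q)) ↔
      ∃ a, θ ∈ cellIco C (i, a) ∧ CellSep C (i, a) p q := by
  constructor
  · intro h
    have hcell : ∃ a, θ ∈ cellIco C (i, a) := by
      change ¬ (θ < termEmbed C (C p) i ↔ θ < termEmbed C (C q) i) at h
      by_cases hp : θ < termEmbed C (C p) i
      · have hq : ¬ θ < termEmbed C (C q) i := fun hq => h ⟨fun _ => hq, fun _ => hp⟩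
        exact exists_cell hk (not_lt.1 hq) hp
      · have hq : θ < termEmbed C (C q) i := by
          by_contra hq; exact h ⟨fun h => absurd h hp, fun h => absurd h hq⟩
        exact exists_cell hk (not_lt.1 hp) hq
    obtain ⟨a, ha⟩ := hcell
    refine ⟨a, ha, ?_⟩
    unfold CellSep
    rw [← lt_termEmbed_iff_of_mem hk ha, ← lt_termEmbed_iff_of_mem hk ha]
    exact h
  · rintro ⟨a, ha, h⟩
    unfold CellSep at h
    rw [← lt_termEmbed_iff_of_mem hk ha, ← lt_termEmbed_iff_of_mem hk ha] at h
    exact h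

open Classical in
lemma mem_Ico_ite_iff (c : Fin d × Fin k) (Q : Prop) (θ : ℝ) :
    θ ∈ Set.Ico (cellBase C c) (cellBase C c + if Q then cellWt C c else 0) ↔
      θ ∈ cellIco C c ∧ Q := by
  by_cases hQ : Q
  · simp [hQ, cellIco]
  · simp [hQ]

open Classical in
/-- The distance of two embedded centers is the total length of the cells between them. -/
lemma l1Dist_eq_sum_cells (hk : 0 < k) (p q : Fin k) :
    l1Dist (termEmbed C (C p)) (termEmbed C (C q)) =
      ∑ c : Fin d × Fin k, if CellSep C c p q then cellWt C c else 0 := by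
  have hw : ∀ c : Fin d × Fin k, 0 ≤ (if CellSep C c p q then cellWt C c else 0) := fun c => by
    split_ifs
    · exact cellWt_nonneg C c
    · exact le_rfl
  have h := cutMeasure_cells (base := cellBase C)
    (w := fun c => if CellSep C c p q then cellWt C c else 0) hw
    (R := sepCuts (termEmbed C (C p)) (termEmbed C (C q)))
    (fun i θ => by
      simp only [mem_Ico_ite_iff]
      exact mem_sepCuts_iff_exists hk i θ p q)
    (fun i a a' θ h h' => by
      simp only [mem_Ico_ite_iff] at h h'
      exact cell_unique hk h.1 h'.1)
  rw [cutMeasure_sepCuts] at h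
  exact (ENNReal.ofReal_eq_ofReal_iff (l1Dist_nonneg _ _)
    (Finset.sum_nonneg fun c _ => hw c)).1 h

variable (C) (E : Fin k → Fin k → Prop)

/-- The largest distance between the images of two related centers. -/
def relDiam : ℝ :=
  ⨆ z : {z : Fin k × Fin k // E z.1 z.2}, l1Dist (termEmbed C (C z.1.1)) (termEmbed C (C z.1.2))

/-- The cuts of the cell `c` may be chosen. -/
def CellAvail (c : Fin d × Fin k) : Prop :=
  (∃ p q, E p q ∧ CellSep C c p q) ∧ ¬ ∃ p q, E p q ∧ CellSep C c p q ∧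
    l1Dist (termEmbed C (C p)) (termEmbed C (C q)) ≤ relDiam C E / (k : ℝ) ^ 3

open Classical in
/-- The lengths of the cells that may be chosen. -/
def roundWt (c : Fin d × Fin k) : ℝ := if CellAvail C E c then cellWt C c else 0

lemma roundWt_nonneg (c : Fin d × Fin k) : 0 ≤ roundWt C E c := by
  unfold roundWt; split_ifs
  · exact cellWt_nonneg C c
  · exact le_rfl

/-- The choice of a cut when the centers are clustered according to `E`. -/
def cellPick (w₀ : Cut d) : ℝ → Cut d := allocate (cellBase C) (roundWt C E) w₀

variable {C}

lemma relDiam_nonneg : 0 ≤ relDiam C E := Real.iSup_nonneg fun _ => l1Dist_nonneg _ _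

lemma mem_cutsR_iff_exists (hk : 0 < k) (T : ThresholdTree d) (i : Fin d) (θ : ℝ) :
    (i, θ) ∈ cutsR (fun j => termEmbed C (C j)) T ↔
      ∃ a, θ ∈ Set.Ico (cellBase C (i, a)) (cellBase C (i, a) +
        roundWt C (centerRel (fun j => termEmbed C (C j)) T) (i, a)) := by
  classical
  set E := centerRel (fun j => termEmbed C (C j)) T with hE
  simp only [roundWt, mem_Ico_ite_iff]
  have hA : (i, θ) ∈ cutsA (fun j => termEmbed C (C j)) T ↔
      ∃ a, θ ∈ cellIco C (i, a) ∧ ∃ p q, E p q ∧ CellSep C (i, a) p q := by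
    simp only [cutsA, Set.mem_iUnion, exists_prop, Prod.exists, mem_sepCuts_iff_exists hk]
    constructor
    · rintro ⟨p, q, hpq, a, ha, h⟩; exact ⟨a, ha, p, q, hpq, h⟩
    · rintro ⟨a, ha, p, q, hpq, h⟩; exact ⟨p, q, hpq, a, ha, h⟩
  have hD : 0 ≤ maxDist (fun j => termEmbed C (C j)) T / (k : ℝ) ^ 3 :=
    div_nonneg (Real.iSup_nonneg fun _ => l1Dist_nonneg _ _) (by positivity)
  have hB : (i, θ) ∈ cutsB (fun j => termEmbed C (C j)) T ↔
      ∃ a, θ ∈ cellIco C (i, a) ∧ ∃ p q, E p q ∧ CellSep C (i, a) p q ∧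
        l1Dist (termEmbed C (C p)) (termEmbed C (C q)) ≤ relDiam C E / (k : ℝ) ^ 3 := by
    simp only [cutsB, Set.mem_iUnion, exists_prop, Prod.exists, mem_sepCuts_iff_exists hk,
      Set.mem_ofPred_eq, cutMeasure_sepCuts, ENNReal.ofReal_le_ofReal_iff hD]
    constructor
    · rintro ⟨p, q, ⟨hpq, hd⟩, a, ha, h⟩; exact ⟨a, ha, p, q, hpq, h, hd⟩
    · rintro ⟨a, ha, p, q, hpq, h, hd⟩; exact ⟨p, q, ⟨hpq, hd⟩, a, ha, h⟩
  unfold cutsR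
  rw [Set.mem_sdiff, hA, hB]
  constructor
  · rintro ⟨⟨a, ha, h⟩, h'⟩
    exact ⟨a, ha, h, fun h'' => h' ⟨a, ha, h''⟩⟩
  · rintro ⟨a, ha, h, h'⟩
    refine ⟨⟨a, ha, h⟩, ?_⟩
    rintro ⟨a', ha', h''⟩
    rw [cell_unique hk ha' ha] at h''
    exact h' h''

lemma roundWt_cells_disjoint (hk : 0 < k) (i : Fin d) (a a' : Fin k) (θ : ℝ)
    (h : θ ∈ Set.Ico (cellBase C (i, a)) (cellBase C (i, a) + roundWt C E (i, a)))
    (h' : θ ∈ Set.Ico (cellBase C (i, a')) (cellBase C (i, a') + roundWt C E (i, a'))) :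
    a = a' := by
  simp only [roundWt, mem_Ico_ite_iff] at h h'
  exact cell_unique hk h.1 h'.1

/-- As long as two centers are in the same leaf, there are cuts that may be chosen. -/
lemma totalWeight_roundWt_pos (hk : 0 < k) (hC : Function.Injective C) {T : ThresholdTree d}
    (hT : ¬ AllSeparated (fun j => termEmbed C (C j)) T) :
    0 < totalWeight (roundWt C (centerRel (fun j => termEmbed C (C j)) T)) := by
  set E := centerRel (fun j => termEmbed C (C j)) T with hE
  have hinj : Function.Injective fun j => termEmbed C (C j) :=
    (termEmbed_injective hk C).comp hC
  have hcells := cutMeasure_cells (roundWt_nonneg C E) (mem_cutsR_iff_exists hk T)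
    (roundWt_cells_disjoint E hk)
  have h1 := cutMeasure_cutsR (fun j => termEmbed C (C j)) id T
  have h2 := CutSystem.mass_pos (M := cutSystem (fun j => termEmbed C (C j)) id)
    (r := treeRel (fun j => termEmbed C (C j)) T)
    (cutSystem_separated (fun j => termEmbed C (C j)) id hinj)
    ⟨⟨fun _ => rfl, fun h => h.symm, fun h h' => h.trans h'⟩, fun p => ⟨p, rfl⟩⟩
    fun h => hT ((allSeparated_iff (fun j => termEmbed C (C j)) id hinj T).2 h)
  rw [← h1] at h2
  simp only [id, Measure.real, hcells] at h2
  by_contra hcon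
  rw [ENNReal.ofReal_of_nonpos (not_lt.1 hcon)] at h2
  simp at h2

/-- The choice of a cell with probability proportional to its length and of a uniformly random cut
in it is a uniform choice from the set of the cuts that may be chosen. -/
lemma cellPick_isUniformChoice (hk : 0 < k) (hC : Function.Injective C) (w₀ : Cut d) :
    IsUniformChoice (fun j => termEmbed C (C j))
      (relPick (fun E => cellPick C E w₀) fun j => termEmbed C (C j)) := by
  intro T hT
  set E := centerRel (fun j => termEmbed C (C j)) T with hE
  have hW := totalWeight_roundWt_pos hk hC hT
  exact ⟨fun u hu => allocate_mem (roundWt_nonneg C E) (mem_cutsR_iff_exists hk T) w₀ hW hu,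
    map_allocate (roundWt_nonneg C E) (mem_cutsR_iff_exists hk T) (roundWt_cells_disjoint E hk)
      w₀ hW⟩

end Cells

/-! ### The expected cost -/

section ExpectedCost

variable {d k n : ℕ} (C : Fin k → Pt d) (w₀ : Cut d) (X : Fin n → Pt d)

/-- The tree of the random cut algorithm on the embedded centers, after `k` rounds. -/
def finalTree (u : ℕ → ℝ) : ThresholdTree d :=
  treeSeq (fun j => termEmbed C (C j)) (relPick (fun E => cellPick C E w₀) fun j => termEmbed C (C j))
    u k

/-- The images of the data points and of the centers. -/
def allPts : Fin n ⊕ Fin k → Pt d := Sum.elim (fun a => termEmbed C (X a)) fun j => termEmbed C (C j)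

variable {C}

lemma measurable_treeRel_finalTree (hk : 0 < k) (hC : Function.Injective C) :
    Measurable fun u => treeRel (allPts C X) (finalTree C w₀ u) :=
  measurable_treeRel_treeSeq (allPts C X) Sum.inr
    (fun E => measurable_allocate (roundWt_nonneg C E) w₀) ((termEmbed_injective hk C).comp hC) k

lemma treeCost_finalTree_eq (hk : 0 < k) : ∃ f : (Fin n ⊕ Fin k → Fin n ⊕ Fin k → Prop) → ℝ,
    ∀ u, treeCost X (pullTree C (finalTree C w₀ u)) =
      f (treeRel (allPts C X) (finalTree C w₀ u)) := by
  classical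
  refine ⟨fun r => ∑ a, sqDist (X a)
    (mean X (Finset.univ.filter fun b => r (Sum.inl b) (Sum.inl a))), fun u => ?_⟩
  unfold treeCost
  rw [costOn_eq]
  refine Finset.sum_congr rfl fun a _ => ?_
  congr 2
  refine Finset.filter_congr fun b _ => ?_
  rw [leafOf_pullTree hk, leafOf_pullTree hk]
  rfl

lemma integrable_treeRel (hk : 0 < k) (hC : Function.Injective C)
    (f : (Fin n ⊕ Fin k → Fin n ⊕ Fin k → Prop) → ℝ) :
    Integrable (fun u => f (treeRel (allPts C X) (finalTree C w₀ u))) seedMeasure := by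
  obtain ⟨B, hB⟩ := (Set.finite_range fun r => ‖f r‖).bddAbove
  exact Integrable.of_bound ((measurable_of_finite f).comp
    (measurable_treeRel_finalTree w₀ X hk hC)).aestronglyMeasurable B
    (Filter.Eventually.of_forall fun u => hB ⟨_, rfl⟩)

lemma integrable_treeCost_finalTree (hk : 0 < k) (hC : Function.Injective C) :
    Integrable (fun u => treeCost X (pullTree C (finalTree C w₀ u))) seedMeasure := by
  obtain ⟨f, hf⟩ := treeCost_finalTree_eq (C := C) w₀ X hk
  simp only [hf]
  exact integrable_treeRel w₀ X hk hC f

lemma ae_mem_seeds : ∀ᵐ u ∂seedMeasure, u ∈ Seeds := by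
  have h : ∀ j : ℕ, ∀ᵐ u ∂seedMeasure, u j ∈ Set.Ico (0 : ℝ) 1 := by
    intro j
    have hmap : Measure.map (fun u : ℕ → ℝ => u j) seedMeasure = uniform01 :=
      Measure.infinitePi_map_eval (μ := fun _ : ℕ => uniform01) j
    have h1 : ∀ᵐ v ∂uniform01, v ∈ Set.Ico (0 : ℝ) 1 := ae_restrict_mem measurableSet_Ico
    rw [← hmap] at h1
    exact ae_of_ae_map (measurable_pi_apply j).aemeasurable h1
  exact ae_all_iff.2 h

/-- As cuts are applied only to leaves with centers on both sides, every leaf keeps a center. -/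
lemma valid_treeRel (hk : 0 < k) (u : ℕ → ℝ) (t : ℕ) :
    (cutSystem (allPts C X) Sum.inr).Valid (treeRel (allPts C X)
      (treeSeq (fun j => termEmbed C (C j))
        (relPick (fun E => cellPick C E w₀) fun j => termEmbed C (C j)) u t)) := by
  induction t with
  | zero =>
    exact ⟨⟨fun _ => rfl, fun h => h.symm, fun h h' => h.trans h'⟩, fun p => ⟨⟨0, hk⟩, rfl⟩⟩
  | succ t ih =>
    unfold treeSeq
    split_ifs
    · exact ih
    · have h := treeRel_splitLeaves (allPts C X) Sum.inr
        (treeSeq (fun j => termEmbed C (C j))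
          (relPick (fun E => cellPick C E w₀) fun j => termEmbed C (C j)) u t)
      simp only [allPts, Sum.elim_inr] at h ⊢
      rw [h]
      exact ih.step _

/-- The cost of the final tree is bounded in terms of the distances, in the embedding, of the data
points to given centers `c a` and of these to the final centers. -/
lemma treeCost_finalTree_le (hk : 0 < k) (hC : Function.Injective C) (c : Fin n → Fin k)
    {u : ℕ → ℝ} (hu : u ∈ Seeds) :
    treeCost X (pullTree C (finalTree C w₀ u)) ≤
      ∑ a, 8 * (k : ℝ) * (l1Dist (termEmbed C (X a)) (termEmbed C (C (c a))) +
        (cutSystem (allPts C X) Sum.inr).finalDist (c a) (Sum.inl a)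
          (treeRel (allPts C X) (finalTree C w₀ u))) := by
  classical
  have hinj : Function.Injective fun j => allPts C X (Sum.inr j) := (termEmbed_injective hk C).comp hC
  have hv : (cutSystem (allPts C X) Sum.inr).Valid (treeRel (allPts C X) (finalTree C w₀ u)) :=
    valid_treeRel (C := C) w₀ X hk u k
  have hsep : AllSeparated (fun j => termEmbed C (C j)) (finalTree C w₀ u) :=
    treeSeq_allSeparated hk (cellPick_isUniformChoice hk hC w₀) hu
  have hd := (allSeparated_iff (allPts C X) Sum.inr hinj (finalTree C w₀ u)).1 hsep
  choose j hj using fun a : Fin n => hv.center (Sum.inl a)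
  have hj' : ∀ a, (pullTree C (finalTree C w₀ u)).leafOf (X a) =
      (finalTree C w₀ u).leafOf (termEmbed C (C (j a))) := fun a => by
    rw [leafOf_pullTree hk]; exact hj a
  have hex : ∀ p : List Bool, ∃ z : Pt d, ∀ i, (finalTree C w₀ u).leafOf (termEmbed C (C i)) = p →
      z = C i := by
    intro p
    by_cases h : ∃ i, (finalTree C w₀ u).leafOf (termEmbed C (C i)) = p
    · obtain ⟨i, hi⟩ := h
      exact ⟨C i, fun i' hi' => termEmbed_injective hk C (hsep (i, i') (hi.trans hi'.symm))⟩
    · exact ⟨0, fun i hi => absurd ⟨i, hi⟩ h⟩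
  choose g hg using hex
  refine (costOn_le X _ _ g).trans (Finset.sum_le_sum fun a _ => ?_)
  rw [hg _ (j a) (hj' a).symm]
  refine (sqDist_le_l1Dist_termEmbed hk C _ _).trans ?_
  refine mul_le_mul_of_nonneg_left ?_ (by positivity)
  rw [CutSystem.finalDist_eq hv hd (hj a)]
  change _ ≤ _ + (cutSystem (allPts C X) Sum.inr).dist (Sum.inr (c a)) (Sum.inr (j a))
  rw [cutSystem_dist_center]
  exact l1Dist_triangle _ _ _

lemma one_le_logFactor (k : ℕ) : 1 ≤ CutSystem.logFactor k :=
  one_le_mul_of_one_le_of_one_le (le_max_left _ _) (le_max_left _ _)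

lemma integral_finalDist_le (hk : 0 < k) (hC : Function.Injective C) (c : Fin k) (a : Fin n) :
    ∫ u, (cutSystem (allPts C X) Sum.inr).finalDist c (Sum.inl a)
      (treeRel (allPts C X) (finalTree C w₀ u)) ∂seedMeasure ≤
      8000 * CutSystem.logFactor k * l1Dist (termEmbed C (X a)) (termEmbed C (C c)) := by
  have hinj : Function.Injective fun j => allPts C X (Sum.inr j) := (termEmbed_injective hk C).comp hC
  have hM := cutSystem_separated (allPts C X) Sum.inr hinj
  have hv : (cutSystem (allPts C X) Sum.inr).Valid fun _ _ => True :=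
    ⟨⟨fun _ => trivial, fun _ => trivial, fun _ _ => trivial⟩, fun _ => ⟨⟨0, hk⟩, trivial⟩⟩
  have hpos : 0 ≤ 8000 * CutSystem.logFactor k * l1Dist (termEmbed C (X a)) (termEmbed C (C c)) := by
    have := one_le_logFactor k
    have := l1Dist_nonneg (termEmbed C (X a)) (termEmbed C (C c))
    positivity
  have h := integral_treeRel_treeSeq (allPts C X) Sum.inr (pk := fun E => cellPick C E w₀)
    (fun E => measurable_allocate (roundWt_nonneg C E) w₀) hinj
    (cellPick_isUniformChoice hk hC w₀)
    ((cutSystem (allPts C X) Sum.inr).finalDist c (Sum.inl a)) k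
  refine h.le.trans ?_
  rcases subsingleton_or_nontrivial (Fin k) with hs | hn
  · refine (CutSystem.iterate_avg_le hM (r₀ := fun _ _ => True) (B := 0) (fun r hr => ?_) k _
      (CutSystem.Refines.refl hv)).trans hpos
    refine CutSystem.finalDist_le hr.1 le_rfl fun j _ => ?_
    rw [Subsingleton.elim c j]
    exact (CutSystem.dist_self _).le
  · have h1 := CutSystem.iterate_finalDist_le_logFactor hM c (Sum.inl a) k hv trivial
    rw [Fintype.card_fin] at h1
    refine h1.trans (mul_le_mul_of_nonneg_left (cutSystem_dist_le (allPts C X) Sum.inr _ _) ?_)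
    have := one_le_logFactor k
    positivity

/-- The constant is `8 * (1 + 8000)`: the given center is the closest one, and the squared distance to
the final center is at most `8 k` times the distance of the images. -/
theorem integral_treeCost_finalTree_le (hk : 0 < k) (hC : Function.Injective C) :
    ∫ u, treeCost X (pullTree C (finalTree C w₀ u)) ∂seedMeasure ≤
      64008 * ((k : ℝ) * max 1 (Real.log k) * max 1 (Real.log (Real.log k))) * centersCost X C := by
  have : Nonempty (Fin k) := ⟨⟨0, hk⟩⟩
  choose c hc using fun a : Fin n => exists_eq_ciInf_of_finite (f := fun j => sqDist (X a) (C j))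
  set F : Fin n → ℝ := fun a => l1Dist (termEmbed C (X a)) (termEmbed C (C (c a))) with hF
  have hint : ∀ a, Integrable (fun u => (cutSystem (allPts C X) Sum.inr).finalDist (c a) (Sum.inl a)
      (treeRel (allPts C X) (finalTree C w₀ u))) seedMeasure := fun a =>
    integrable_treeRel w₀ X hk hC _
  have hint' : ∀ a, Integrable (fun u => 8 * (k : ℝ) * (F a +
      (cutSystem (allPts C X) Sum.inr).finalDist (c a) (Sum.inl a)
        (treeRel (allPts C X) (finalTree C w₀ u)))) seedMeasure := fun a =>
    ((integrable_const _).add (hint a)).const_mul _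
  have h1 : ∫ u, treeCost X (pullTree C (finalTree C w₀ u)) ∂seedMeasure ≤
      ∫ u, ∑ a, 8 * (k : ℝ) * (F a +
        (cutSystem (allPts C X) Sum.inr).finalDist (c a) (Sum.inl a)
          (treeRel (allPts C X) (finalTree C w₀ u))) ∂seedMeasure := by
    refine integral_mono_ae (integrable_treeCost_finalTree w₀ X hk hC)
      (integrable_finsetSum _ fun a _ => hint' a) ?_
    filter_upwards [ae_mem_seeds] with u hu
    exact treeCost_finalTree_le w₀ X hk hC c hu
  refine h1.trans ?_
  rw [integral_finsetSum _ fun a _ => hint' a]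
  unfold centersCost
  rw [Finset.mul_sum]
  refine Finset.sum_le_sum fun a _ => ?_
  rw [integral_const_mul, integral_add (integrable_const _) (hint a), integral_const]
  rw [probReal_univ, one_smul]
  have h2 := integral_finalDist_le w₀ X hk hC (c a) a
  have h3 : F a ≤ ⨅ j, sqDist (X a) (C j) := by
    rw [← hc a]; exact l1Dist_termEmbed_le C _ _
  have h4 := one_le_logFactor k
  have h5 : 0 ≤ F a := l1Dist_nonneg _ _
  have e : (k : ℝ) * max 1 (Real.log k) * max 1 (Real.log (Real.log k)) =
      k * CutSystem.logFactor k := by unfold CutSystem.logFactor; ring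
  rw [e]
  have hk' : (0 : ℝ) ≤ k := by positivity
  calc 8 * (k : ℝ) * (F a + _) ≤ 8 * k * (F a + 8000 * CutSystem.logFactor k * F a) := by
        gcongr
    _ ≤ 8 * k * (CutSystem.logFactor k * F a + 8000 * CutSystem.logFactor k * F a) := by
        gcongr
        nlinarith
    _ = 64008 * (k * CutSystem.logFactor k) * F a := by ring
    _ ≤ _ := by gcongr

end ExpectedCost

/-! ### Programs with bounded loops -/

/-- Write a natural number into memory. -/
def Mem.setNat (s : Mem) (a i j v : ℕ) : Mem := { s with nat := update s.nat a i j v }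

/-- Write a real number into memory. -/
def Mem.setReal (s : Mem) (a i j : ℕ) (v : ℝ) : Mem := { s with real := update s.real a i j v }

/-- Draw a random number into memory. -/
def Mem.draw (s : Mem) (u : ℕ → ℝ) (a i j : ℕ) : Mem :=
  { s with real := update s.real a i j (u s.drawn), drawn := s.drawn + 1 }

section MemLemmas

variable (s : Mem) (a i j : ℕ)

@[simp] lemma Mem.setNat_nat (v a' i' j' : ℕ) : (s.setNat a i j v).nat a' i' j' =
    if a' = a ∧ i' = i ∧ j' = j then v else s.nat a' i' j' := rfl
@[simp] lemma Mem.setNat_real (v : ℕ) : (s.setNat a i j v).real = s.real := rfl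
@[simp] lemma Mem.setReal_real (v : ℝ) (a' i' j' : ℕ) : (s.setReal a i j v).real a' i' j' =
    if a' = a ∧ i' = i ∧ j' = j then v else s.real a' i' j' := rfl
@[simp] lemma Mem.setReal_nat (v : ℝ) : (s.setReal a i j v).nat = s.nat := rfl
@[simp] lemma Mem.draw_real (u : ℕ → ℝ) (a' i' j' : ℕ) : (s.draw u a i j).real a' i' j' =
    if a' = a ∧ i' = i ∧ j' = j then u s.drawn else s.real a' i' j' := rfl
@[simp] lemma Mem.draw_nat (u : ℕ → ℝ) : (s.draw u a i j).nat = s.nat := rfl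

lemma Mem.setNat_nat_of_ne {v a' : ℕ} (h : a' ≠ a) : (s.setNat a i j v).nat a' = s.nat a' := by
  funext i' j'; simp [h]
lemma Mem.setReal_real_of_ne {v : ℝ} {a' : ℕ} (h : a' ≠ a) :
    (s.setReal a i j v).real a' = s.real a' := by
  funext i' j'; simp [h]
lemma Mem.draw_real_of_ne {u : ℕ → ℝ} {a' : ℕ} (h : a' ≠ a) :
    (s.draw u a i j).real a' = s.real a' := by
  funext i' j'; simp [h]

end MemLemmas

/-- Programs in which all loops are bounded. `loop c b p` runs `p` with the cell `(0, 0)` of the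
natural array `c` ranging over the numbers below the cell `(0, b)` of the natural array `0`; this
bound is the dimension for `b = 1` and the number of centers for `b = 2`. -/
inductive LoopProg : Type
  | skip : LoopProg
  | setNat (a : ℕ) (i j e : NExpr) : LoopProg
  | setReal (a : ℕ) (i j : NExpr) (e : RExpr) : LoopProg
  | sample (a : ℕ) (i j : NExpr) : LoopProg
  | seq (p q : LoopProg) : LoopProg
  | ite (b : Test) (p q : LoopProg) : LoopProg
  | loop (c b : ℕ) (p : LoopProg) : LoopProg

/-- The states at the beginning of the iterations of a loop with counter `c` and body `f`. -/
def loopState (f : Mem → Mem) (c : ℕ) (s : Mem) : ℕ → Mem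
  | 0 => s.setNat c 0 0 0
  | i + 1 => (f (loopState f c s i)).setNat c 0 0 ((f (loopState f c s i)).nat c 0 0 + 1)

namespace LoopProg

/-- The test of a loop: the counter is below the bound. -/
def loopTest (c b : ℕ) : Test :=
  .neg (.natLE (.get 0 (.lit 0) (.lit b)) (.get c (.lit 0) (.lit 0)))

/-- The statement that increments a loop counter. -/
def incr (c : ℕ) : Prog :=
  .setNat c (.lit 0) (.lit 0) (.add (.get c (.lit 0) (.lit 0)) (.lit 1))

/-- The translation into while-programs. -/
def compile : LoopProg → Prog
  | .skip => .skip
  | .setNat a i j e => .setNat a i j e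
  | .setReal a i j e => .setReal a i j e
  | .sample a i j => .sample a i j
  | .seq p q => .seq p.compile q.compile
  | .ite b p q => .ite b p.compile q.compile
  | .loop c b p => .seq (.setNat c (.lit 0) (.lit 0) (.lit 0))
      (.while (loopTest c b) (.seq p.compile (incr c)))

open Classical in
/-- The memory after the execution of the program. -/
def run (u : ℕ → ℝ) : LoopProg → Mem → Mem
  | .skip, s => s
  | .setNat a i j e, s => s.setNat a (i.eval s) (j.eval s) (e.eval s)
  | .setReal a i j e, s => s.setReal a (i.eval s) (j.eval s) (e.eval s)
  | .sample a i j, s => s.draw u a (i.eval s) (j.eval s)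
  | .seq p q, s => q.run u (p.run u s)
  | .ite b p q, s => if b.holds s then p.run u s else q.run u s
  | .loop c b p, s => loopState (p.run u) c s (s.nat 0 0 b)

/-- The natural arrays to which the program may write. -/
def natWrites : LoopProg → List ℕ
  | .setNat a _ _ _ => [a]
  | .seq p q => p.natWrites ++ q.natWrites
  | .ite _ p q => p.natWrites ++ q.natWrites
  | .loop c _ p => c :: p.natWrites
  | _ => []

/-- The real arrays to which the program may write. -/
def realWrites : LoopProg → List ℕ
  | .setReal a _ _ _ => [a]
  | .sample a _ _ => [a]
  | .seq p q => p.realWrites ++ q.realWrites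
  | .ite _ p q => p.realWrites ++ q.realWrites
  | .loop _ _ p => p.realWrites
  | _ => []

/-- The program draws no random numbers. -/
def noSample : LoopProg → Bool
  | .sample _ _ _ => false
  | .seq p q => p.noSample && q.noSample
  | .ite _ p q => p.noSample && q.noSample
  | .loop _ _ p => p.noSample
  | _ => true

/-- The program writes neither to the input array `0` nor, inside of a loop, to the counter. -/
def wf : LoopProg → Bool
  | .setNat a _ _ _ => a != 0
  | .seq p q => p.wf && q.wf
  | .ite _ p q => p.wf && q.wf
  | .loop c b p => p.wf && c != 0 && !p.natWrites.contains c && (b == 1 || b == 2)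
  | _ => true

/-- A bound, as a polynomial, on the running time in terms of the sum of the number of centers and the dimension. -/
def cost : LoopProg → Polynomial ℕ
  | .skip => 1
  | .setNat _ i j e => (1 + i.size + j.size + e.size : ℕ)
  | .setReal _ i j e => (1 + i.size + j.size + e.size : ℕ)
  | .sample _ i j => (1 + i.size + j.size : ℕ)
  | .seq p q => p.cost + q.cost
  | .ite b p q => (1 + b.size : ℕ) + (p.cost + q.cost)
  | .loop _ _ p => 13 + Polynomial.X * (20 + p.cost)

lemma run_nat_of_notMem (u : ℕ → ℝ) (p : LoopProg) {a : ℕ} (h : a ∉ p.natWrites) (s : Mem) :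
    (p.run u s).nat a = s.nat a := by
  induction p generalizing s with
  | skip => rfl
  | setNat a' i j e => exact Mem.setNat_nat_of_ne _ _ _ _ (by simpa [natWrites] using h)
  | setReal => rfl
  | sample => rfl
  | seq p q ihp ihq =>
    simp only [natWrites, List.mem_append, not_or] at h
    exact (ihq h.2 _).trans (ihp h.1 _)
  | ite b p q ihp ihq =>
    simp only [natWrites, List.mem_append, not_or] at h
    unfold run
    split_ifs
    · exact ihp h.1 _
    · exact ihq h.2 _
  | loop c b p ih =>
    simp only [natWrites, List.mem_cons, not_or] at h
    have key : ∀ n, (loopState (p.run u) c s n).nat a = s.nat a := by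
      intro n
      induction n with
      | zero => exact Mem.setNat_nat_of_ne _ _ _ _ h.1
      | succ n ihn =>
        exact (Mem.setNat_nat_of_ne _ _ _ _ h.1).trans ((ih h.2 _).trans ihn)
    exact key _

lemma run_real_of_notMem (u : ℕ → ℝ) (p : LoopProg) {a : ℕ} (h : a ∉ p.realWrites) (s : Mem) :
    (p.run u s).real a = s.real a := by
  induction p generalizing s with
  | skip => rfl
  | setNat => rfl
  | setReal a' i j e => exact Mem.setReal_real_of_ne _ _ _ _ (by simpa [realWrites] using h)
  | sample a' i j => exact Mem.draw_real_of_ne _ _ _ _ (by simpa [realWrites] using h)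
  | seq p q ihp ihq =>
    simp only [realWrites, List.mem_append, not_or] at h
    exact (ihq h.2 _).trans (ihp h.1 _)
  | ite b p q ihp ihq =>
    simp only [realWrites, List.mem_append, not_or] at h
    unfold run
    split_ifs
    · exact ihp h.1 _
    · exact ihq h.2 _
  | loop c b p ih =>
    have key : ∀ n, (loopState (p.run u) c s n).real a = s.real a := by
      intro n
      induction n with
      | zero => rfl
      | succ n ihn => exact (ih h _).trans ihn
    exact key _

lemma run_drawn (u : ℕ → ℝ) (p : LoopProg) (h : p.noSample = true) (s : Mem) :
    (p.run u s).drawn = s.drawn := by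
  induction p generalizing s with
  | skip => rfl
  | setNat => rfl
  | setReal => rfl
  | sample a' i j => simp [noSample] at h
  | seq p q ihp ihq =>
    simp only [noSample, Bool.and_eq_true] at h
    exact (ihq h.2 _).trans (ihp h.1 _)
  | ite b p q ihp ihq =>
    simp only [noSample, Bool.and_eq_true] at h
    unfold run
    split_ifs
    · exact ihp h.1 _
    · exact ihq h.2 _
  | loop c b p ih =>
    have key : ∀ n, (loopState (p.run u) c s n).drawn = s.drawn := by
      intro n
      induction n with
      | zero => rfl
      | succ n ihn => exact (ih h _).trans ihn
    exact key _

lemma zero_notMem_natWrites {p : LoopProg} (h : p.wf = true) : 0 ∉ p.natWrites := by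
  induction p with
  | setNat a i j e =>
    simp only [wf, bne_iff_ne] at h
    simpa [natWrites] using Ne.symm h
  | seq p q ihp ihq =>
    simp only [wf, Bool.and_eq_true] at h
    simp [natWrites, ihp h.1, ihq h.2]
  | ite b p q ihp ihq =>
    simp only [wf, Bool.and_eq_true] at h
    simp [natWrites, ihp h.1, ihq h.2]
  | loop c b p ih =>
    simp only [wf, Bool.and_eq_true, bne_iff_ne] at h
    simp [natWrites, ih h.1.1.1, Ne.symm h.1.1.2]
  | _ => simp [natWrites]

lemma loopState_counter (u : ℕ → ℝ) {p : LoopProg} {c : ℕ} (h : c ∉ p.natWrites) (s : Mem) (n : ℕ) :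
    (loopState (p.run u) c s n).nat c 0 0 = n := by
  induction n with
  | zero => simp [loopState]
  | succ n ih =>
    unfold loopState
    rw [Mem.setNat_nat, if_pos ⟨rfl, rfl, rfl⟩, run_nat_of_notMem u p h, ih]

/-- The compiled program halts within its cost, with the memory computed by `run`. -/
theorem exec_compile (u : ℕ → ℝ) (p : LoopProg) (h : p.wf = true) (N : ℕ) (s : Mem)
    (h1 : s.nat 0 0 1 ≤ N) (h2 : s.nat 0 0 2 ≤ N) :
    ∃ t ≤ p.cost.eval N, Exec u p.compile s t (p.run u s) := by
  induction p generalizing s with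
  | skip => exact ⟨1, by simp [cost], Exec.skip s⟩
  | setNat a i j e => exact ⟨_, by simp [cost], Exec.setNat a i j e s⟩
  | setReal a i j e => exact ⟨_, by simp [cost], Exec.setReal a i j e s⟩
  | sample a i j => exact ⟨_, by simp [cost], Exec.sample a i j s⟩
  | seq p q ihp ihq =>
    simp only [wf, Bool.and_eq_true] at h
    have h0 := run_nat_of_notMem u p (zero_notMem_natWrites h.1) s
    obtain ⟨t, ht, he⟩ := ihp h.1 s h1 h2
    obtain ⟨t', ht', he'⟩ := ihq h.2 (p.run u s) (by rw [h0]; exact h1) (by rw [h0]; exact h2)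
    exact ⟨t + t', by simpa [cost] using add_le_add ht ht', he.seq he'⟩
  | ite b p q ihp ihq =>
    simp only [wf, Bool.and_eq_true] at h
    obtain ⟨t, ht, he⟩ := ihp h.1 s h1 h2
    obtain ⟨t', ht', he'⟩ := ihq h.2 s h1 h2
    unfold run
    by_cases hb : b.holds s
    · rw [if_pos hb]
      exact ⟨_, by simp [cost]; omega, Exec.iteTrue hb he⟩
    · rw [if_neg hb]
      exact ⟨_, by simp [cost]; omega, Exec.iteFalse hb he'⟩
  | loop c b p ih =>
    simp only [wf, Bool.and_eq_true, bne_iff_ne, Bool.not_eq_true', List.contains_eq_mem,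
      decide_eq_false_iff_not, Bool.or_eq_true, beq_iff_eq] at h
    obtain ⟨⟨⟨hp, hc0⟩, hc⟩, hb⟩ := h
    have hbN : s.nat 0 0 b ≤ N := by rcases hb with rfl | rfl <;> assumption
    set n := s.nat 0 0 b with hn
    set L := loopState (p.run u) c s with hL
    have h0 : ∀ i, (L i).nat 0 = s.nat 0 := by
      intro i
      induction i with
      | zero => exact Mem.setNat_nat_of_ne _ _ _ _ hc0.symm
      | succ i ihi =>
        exact (Mem.setNat_nat_of_ne _ _ _ _ hc0.symm).trans
          ((run_nat_of_notMem u p (zero_notMem_natWrites hp) _).trans ihi)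
    have hcount := loopState_counter u hc s
    have htest : ∀ i, (loopTest c b).holds (L i) ↔ i < n := by
      intro i
      change ¬ (L i).nat 0 0 b ≤ (L i).nat c 0 0 ↔ i < n
      rw [h0, hcount, not_le]
    have key : ∀ m i, i + m = n → ∃ t ≤ 9 + m * (20 + p.cost.eval N),
        Exec u (.while (loopTest c b) (.seq p.compile (incr c))) (L i) t (L n) := by
      intro m
      induction m with
      | zero =>
        intro i hi
        have hi' : i = n := by omega
        subst hi'
        exact ⟨_, by simp [loopTest, Test.size, NExpr.size],
          Exec.whileFalse fun h => lt_irrefl _ ((htest _).1 h)⟩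
      | succ m ihm =>
        intro i hi
        obtain ⟨t, ht, he⟩ := ih hp (L i) (by rw [h0]; exact h1) (by rw [h0]; exact h2)
        obtain ⟨t', ht', he'⟩ := ihm (i + 1) (by omega)
        have hinc := Exec.setNat (u := u) c (.lit 0) (.lit 0)
          (.add (.get c (.lit 0) (.lit 0)) (.lit 1)) (p.run u (L i))
        have := Exec.whileTrue ((htest i).2 (by omega)) (he.seq hinc) he'
        refine ⟨_, ?_, this⟩
        simp only [loopTest, Test.size, NExpr.size, add_mul, one_mul]
        omega
    obtain ⟨t, ht, he⟩ := key n 0 (by omega)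
    have hfirst := Exec.setNat (u := u) c (.lit 0) (.lit 0) (.lit 0) s
    refine ⟨_, ?_, hfirst.seq he⟩
    have hmul := Nat.mul_le_mul_right (20 + p.cost.eval N) hbN
    simp [cost, NExpr.size]
    omega

/-- Induction over the iterations of a loop. The arrays to which the loop does not write are
unchanged in all its states. -/
theorem loop_induct (u : ℕ → ℝ) (c b : ℕ) (p : LoopProg) (s : Mem) (I : ℕ → Mem → Prop)
    (hc : c ∉ p.natWrites) (h0 : I 0 (s.setNat c 0 0 0))
    (hs : ∀ i < s.nat 0 0 b, ∀ s' : Mem,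
      (∀ a ∉ c :: p.natWrites, s'.nat a = s.nat a) → (∀ a ∉ p.realWrites, s'.real a = s.real a) →
      s'.nat c 0 0 = i → I i s' → I (i + 1) ((p.run u s').setNat c 0 0 (i + 1))) :
    I (s.nat 0 0 b) ((loop c b p).run u s) := by
  have key : ∀ n ≤ s.nat 0 0 b, I n (loopState (p.run u) c s n) ∧
      (∀ a ∉ c :: p.natWrites, (loopState (p.run u) c s n).nat a = s.nat a) ∧
      (∀ a ∉ p.realWrites, (loopState (p.run u) c s n).real a = s.real a) := by
    intro n
    induction n with
    | zero =>
      intro _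
      refine ⟨h0, fun a ha => ?_, fun a _ => rfl⟩
      exact Mem.setNat_nat_of_ne _ _ _ _ (by simp only [List.mem_cons, not_or] at ha; exact ha.1)
    | succ n ih =>
      intro hn
      obtain ⟨h1, h2, h3⟩ := ih (by omega)
      refine ⟨?_, fun a ha => ?_, fun a ha => ?_⟩
      · have := hs n (by omega) _ h2 h3 (loopState_counter u hc s n) h1
        unfold loopState
        rwa [run_nat_of_notMem u p hc, loopState_counter u hc s n]
      · have ha' := ha
        simp only [List.mem_cons, not_or] at ha'
        exact (Mem.setNat_nat_of_ne _ _ _ _ ha'.1).trans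
          ((run_nat_of_notMem u p ha'.2 _).trans (h2 a ha))
      · exact (run_real_of_notMem u p ha _).trans (h3 a ha)
  exact (key _ le_rfl).1

end LoopProg

namespace LoopProg

/-- `s'` agrees with `s` outside of the natural arrays in `N` and the real arrays in `R`. -/
structure Agree (N R : List ℕ) (s s' : Mem) : Prop where
  nat : ∀ a ∉ N, s'.nat a = s.nat a
  real : ∀ a ∉ R, s'.real a = s.real a

lemma run_seq (u : ℕ → ℝ) (p q : LoopProg) (s : Mem) :
    (seq p q).run u s = q.run u (p.run u s) := rfl

lemma agree_run (u : ℕ → ℝ) (p : LoopProg) (s : Mem) :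
    Agree p.natWrites p.realWrites s (p.run u s) :=
  ⟨fun _ h => run_nat_of_notMem u p h s, fun _ h => run_real_of_notMem u p h s⟩

/-- Induction over the iterations of two nested loops. -/
theorem loop_loop_induct (u : ℕ → ℝ) {c b c' b' : ℕ} {p : LoopProg} {s : Mem} {m n : ℕ}
    (I : ℕ → ℕ → Mem → Prop)
    (hwf : (loop c b (loop c' b' p)).wf = true)
    (hm : s.nat 0 0 b = m) (hn : s.nat 0 0 b' = n)
    (hI : ∀ i j s v, I i j s → I i j (s.setNat c 0 0 v) ∧ I i j (s.setNat c' 0 0 v))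
    (h0 : I 0 0 s)
    (hrow : ∀ i s, I i n s → I (i + 1) 0 s)
    (hs : ∀ (i : Fin m) (j : Fin n) (s' : Mem),
      Agree (c :: c' :: p.natWrites) p.realWrites s s' →
      s'.nat c 0 0 = i → s'.nat c' 0 0 = j → I i j s' → I i (j + 1) (p.run u s')) :
    I m 0 ((loop c b (loop c' b' p)).run u s) := by
  have hwf' := hwf
  simp only [wf, natWrites, Bool.and_eq_true, bne_iff_ne, Bool.not_eq_true', List.contains_eq_mem,
    decide_eq_false_iff_not, List.mem_cons, not_or] at hwf
  obtain ⟨⟨⟨⟨⟨⟨hp, hc0'⟩, hc'⟩, hb'⟩, hc0⟩, hcc', hc⟩, hb⟩ := hwf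
  have h00 := zero_notMem_natWrites hp
  rw [← hm]
  refine loop_induct u c b (loop c' b' p) s (fun i => I i 0) (by
    simp only [natWrites, List.mem_cons, not_or]; exact ⟨hcc', hc⟩) (hI _ _ _ _ h0).1 ?_
  intro i hi s₁ hN hR hci hIi
  refine (hI _ _ _ _ (hrow i _ ?_)).1
  have h1 : s₁.nat 0 = s.nat 0 := hN 0 (by
    simp only [natWrites, List.mem_cons, not_or]; exact ⟨hc0.symm, hc0'.symm, h00⟩)
  have hn' : s₁.nat 0 0 b' = n := by rw [h1, hn]
  rw [← hn']
  refine loop_induct u c' b' p s₁ (fun j => I i j) hc' (hI _ _ _ _ hIi).2 ?_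
  intro j hj s₂ hN' hR' hcj hIj
  refine (hI _ _ _ _ ?_).2
  refine hs ⟨i, hm ▸ hi⟩ ⟨j, hn' ▸ hj⟩ s₂ ⟨fun a ha => ?_, fun a ha => ?_⟩ ?_ hcj hIj
  · simp only [List.mem_cons, not_or] at ha
    rw [hN' a (by simp only [List.mem_cons, not_or]; exact ⟨ha.2.1, ha.2.2⟩),
      hN a (by simp only [natWrites, List.mem_cons, not_or]; exact ha)]
  · rw [hR' a ha, hR a (by simpa [realWrites] using ha)]
  · rw [hN' c (by simp only [List.mem_cons, not_or]; exact ⟨hcc', hc⟩)]; exact hci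

/-- Induction over the iterations of a loop, with the bound given by name. -/
theorem loop_fin_induct (u : ℕ → ℝ) {c b : ℕ} {p : LoopProg} {s : Mem} {n : ℕ} (I : ℕ → Mem → Prop)
    (hwf : (loop c b p).wf = true) (hn : s.nat 0 0 b = n)
    (hI : ∀ i s v, I i s → I i (s.setNat c 0 0 v))
    (h0 : I 0 s)
    (hs : ∀ (i : Fin n) (s' : Mem), Agree (c :: p.natWrites) p.realWrites s s' →
      s'.nat c 0 0 = i → I i s' → I (i + 1) (p.run u s')) :
    I n ((loop c b p).run u s) := by
  simp only [wf, Bool.and_eq_true, bne_iff_ne, Bool.not_eq_true', List.contains_eq_mem,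
    decide_eq_false_iff_not] at hwf
  rw [← hn]
  refine loop_induct u c b p s I hwf.1.2 (hI _ _ _ h0) ?_
  intro i hi s' hN hR hci hIi
  exact hI _ _ _ (hs ⟨i, hn ▸ hi⟩ s' ⟨hN, hR⟩ hci hIi)

end LoopProg

lemma forall_fin_lt_succ {n : ℕ} {b : Fin n} {P : Fin n → Prop} :
    (∀ j : Fin n, (j : ℕ) < b + 1 → P j) ↔ (∀ j : Fin n, (j : ℕ) < b → P j) ∧ P b := by
  constructor
  · intro h; exact ⟨fun j hj => h j (by omega), h b (by omega)⟩
  · rintro ⟨h1, h2⟩ j hj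
    rcases Nat.lt_succ_iff_lt_or_eq.1 hj with hj | hj
    · exact h1 j hj
    · rw [Fin.ext hj]; exact h2

/-- The pairs that two nested loops have processed before the iteration `(i, j)`. -/
def Before (i j : ℕ) {m n : ℕ} (c : Fin m × Fin n) : Prop :=
  (c.1 : ℕ) < i ∨ ((c.1 : ℕ) = i ∧ (c.2 : ℕ) < j)

lemma not_before_zero {m n : ℕ} (c : Fin m × Fin n) : ¬ Before 0 0 c := by
  unfold Before; omega

lemma before_all {m n : ℕ} (c : Fin m × Fin n) : Before m 0 c := Or.inl c.1.2

lemma before_row {m n : ℕ} (i : ℕ) (c : Fin m × Fin n) : Before i n c ↔ Before (i + 1) 0 c := by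
  have := c.2.2
  unfold Before; omega

lemma before_succ {m n : ℕ} {i : Fin m} {j : Fin n} {c : Fin m × Fin n} :
    Before i (j + 1) c ↔ Before i j c ∨ c = (i, j) := by
  obtain ⟨p, q⟩ := c
  simp only [Before, Prod.mk.injEq, Fin.ext_iff]
  omega

lemma forall_before_succ {m n : ℕ} {i : Fin m} {j : Fin n} {P : Fin m × Fin n → Prop} :
    (∀ c, Before i (j + 1) c → P c) ↔ (∀ c, Before i j c → P c) ∧ P (i, j) := by
  simp only [before_succ]
  constructor
  · intro h; exact ⟨fun c hc => h c (Or.inl hc), h _ (Or.inr rfl)⟩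
  · rintro ⟨h1, h2⟩ c (hc | rfl)
    · exact h1 c hc
    · exact h2

lemma exists_before_succ {m n : ℕ} {i : Fin m} {j : Fin n} {P : Fin m × Fin n → Prop} :
    (∃ c, Before i (j + 1) c ∧ P c) ↔ (∃ c, Before i j c ∧ P c) ∨ P (i, j) := by
  simp only [before_succ]
  constructor
  · rintro ⟨c, hc | rfl, h⟩
    · exact Or.inl ⟨c, hc, h⟩
    · exact Or.inr h
  · rintro (⟨c, hc, h⟩ | h)
    · exact ⟨c, Or.inl hc, h⟩
    · exact ⟨_, Or.inr rfl, h⟩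

/-! ### Computing the distances of the images of the centers

The program uses its arrays as follows. Variables are stored in the cell `(0, 0)` of an array.

* Natural arrays: `0` input, `1` nodes of the tree, `2`, `3` the coordinate and the center that
  determine a cell, `4`, `5` a pair of centers, `6`, `18` further centers, `7` the round, `9`
  addresses of the leaves of the centers, in column `0`, `10` the first unused address, `11`, `12`
  flags, `13`, `14` the chosen cell, `15` the address of the leaf to be split.
* Real arrays: `1` centers, `2` thresholds of the tree, `3` right ends and `4` weights of the cells,
  `5` distances of the images of the centers, `6` the largest distance of two centers in one leaf,
  `7` weights of the cells in the present round, `8` their partial sums, `9` their sum, `10` the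
  random number, `11` the position of the cut in the image of the chosen cell, `12` the threshold.
-/

/-- The cell `(0, 0)` of a natural array. -/
abbrev NExpr.var (a : ℕ) : NExpr := .get a (.lit 0) (.lit 0)

/-- The cell `(0, 0)` of a real array. -/
abbrev RExpr.var (a : ℕ) : RExpr := .get a (.lit 0) (.lit 0)

/-- The test `e < f` for real numbers. -/
abbrev Test.realLT (e f : RExpr) : Test := .neg (.realLE f e)

/-- The test `e = f` for natural numbers. -/
abbrev Test.natEq (e f : NExpr) : Test := .conj (.natLE e f) (.natLE f e)

/-- The coordinate `e` of the center `j`. -/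
abbrev centerCoord (j e : NExpr) : RExpr := .get 1 j e

namespace LoopProg

/-- Update the next larger coordinate (real array `3`) and the flag for an earlier center with the
same coordinate (natural array `11`) of the cell `(i, a)`, by comparison with the center `b`. Here
`i`, `a`, `b` are the counters in the natural arrays `2`, `3`, `6`. -/
def compareCenter : LoopProg :=
  .seq
    (.ite (.conj (.realLT (centerCoord (.var 3) (.var 2)) (centerCoord (.var 6) (.var 2)))
        (.neg (.conj (.realLT (centerCoord (.var 3) (.var 2)) (.get 3 (.var 2) (.var 3)))
          (.realLE (.get 3 (.var 2) (.var 3)) (centerCoord (.var 6) (.var 2))))))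
      (.setReal 3 (.var 2) (.var 3) (centerCoord (.var 6) (.var 2))) .skip)
    (.ite (.conj (.neg (.natLE (.var 3) (.var 6)))
        (.conj (.realLE (centerCoord (.var 6) (.var 2)) (centerCoord (.var 3) (.var 2)))
          (.realLE (centerCoord (.var 3) (.var 2)) (centerCoord (.var 6) (.var 2)))))
      (.setNat 11 (.lit 0) (.lit 0) (.lit 1)) .skip)

/-- Compute the weight of the cell `(i, a)` (real array `4`). -/
def computeCell : LoopProg :=
  .seq (.setReal 3 (.var 2) (.var 3) (centerCoord (.var 3) (.var 2)))
  (.seq (.setNat 11 (.lit 0) (.lit 0) (.lit 0))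
  (.seq (.loop 6 2 compareCenter)
    (.ite (.natLE (.var 11) (.lit 0))
      (.setReal 4 (.var 2) (.var 3)
        (.div (.mul (.sub (.get 3 (.var 2) (.var 3)) (centerCoord (.var 3) (.var 2)))
          (.sub (.get 3 (.var 2) (.var 3)) (centerCoord (.var 3) (.var 2)))) (.lit 2)))
      (.setReal 4 (.var 2) (.var 3) (.lit 0)))))

/-- Compute the weights of all cells. -/
def computeCells : LoopProg := .loop 2 1 (.loop 3 2 computeCell)

/-- The cell `(i, a)` separates the centers `p` and `q`, the counters in the natural arrays `4`
and `5`. -/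
def sepTest : Test :=
  .conj
    (.neg (.conj (.realLE (centerCoord (.var 4) (.var 2)) (centerCoord (.var 3) (.var 2)))
      (.realLE (centerCoord (.var 5) (.var 2)) (centerCoord (.var 3) (.var 2)))))
    (.neg (.conj (.neg (.realLE (centerCoord (.var 4) (.var 2)) (centerCoord (.var 3) (.var 2))))
      (.neg (.realLE (centerCoord (.var 5) (.var 2)) (centerCoord (.var 3) (.var 2))))))

/-- Add the weight of the cell `(i, a)` to the distance of `p` and `q` (real array `5`) if it
separates them. -/
def addCell : LoopProg :=
  .ite sepTest (.setReal 5 (.var 4) (.var 5)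
    (.add (.get 5 (.var 4) (.var 5)) (.get 4 (.var 2) (.var 3)))) .skip

/-- Compute the distance of the images of `p` and `q`. -/
def computeDist : LoopProg :=
  .seq (.setReal 5 (.var 4) (.var 5) (.lit 0)) (.loop 2 1 (.loop 3 2 addCell))

/-- Compute the distances of the images of all pairs of centers. -/
def computeDists : LoopProg := .loop 4 2 (.loop 5 2 computeDist)

end LoopProg

section Static

variable {d k : ℕ}

/-- The memory holds the dimension, the number of centers and the centers. -/
structure HoldsInput (C : Fin k → Pt d) (s : Mem) : Prop where
  dim : s.nat 0 0 1 = d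
  card : s.nat 0 0 2 = k
  centers : ∀ (j : Fin k) (i : Fin d), s.real 1 j i = C j i

lemma HoldsInput.of_agree {C : Fin k → Pt d} {N R : List ℕ} {s s' : Mem} (h : HoldsInput C s)
    (ha : LoopProg.Agree N R s s') (hN : 0 ∉ N) (hR : 1 ∉ R) : HoldsInput C s' :=
  ⟨by rw [ha.nat 0 hN, h.dim], by rw [ha.nat 0 hN, h.card], fun j i => by
    rw [ha.real 1 hR, h.centers]⟩

variable {C : Fin k → Pt d} (u : ℕ → ℝ)

open LoopProg

lemma compareCenter_spec {s : Mem} (h : HoldsInput C s) {i : Fin d} {a : Fin k}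
    (hi : s.nat 2 0 0 = i) (ha : s.nat 3 0 0 = a) (h3 : s.real 3 i a = C a i)
    (h11 : s.nat 11 0 0 = 0) :
    ((loop 6 2 compareCenter).run u s).real 3 i a = nextVal C i a ∧
    (((loop 6 2 compareCenter).run u s).nat 11 0 0 = 0 ↔ ¬ ∃ b < a, C b i = C a i) ∧
    ∀ i' a', (i', a') ≠ ((i : ℕ), (a : ℕ)) →
      ((loop 6 2 compareCenter).run u s).real 3 i' a' = s.real 3 i' a' := by
  have key := loop_fin_induct u (c := 6) (b := 2) (p := compareCenter) (s := s) (n := k)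
    (fun n s' =>
      ((s'.real 3 i a = C a i ∧ ∀ b : Fin k, (b : ℕ) < n → C b i ≤ C a i) ∨
        ∃ b : Fin k, s'.real 3 i a = C b i ∧ C a i < s'.real 3 i a ∧
          ∀ b' : Fin k, (b' : ℕ) < n → C b' i ≤ C a i ∨ s'.real 3 i a ≤ C b' i) ∧
      (s'.nat 11 0 0 = 0 ↔ ¬ ∃ b < a, (b : ℕ) < n ∧ C b i = C a i) ∧
      ∀ i' a', (i', a') ≠ ((i : ℕ), (a : ℕ)) → s'.real 3 i' a' = s.real 3 i' a')
    rfl h.card (fun n s' v hs => by simpa using hs)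
    ⟨Or.inl ⟨h3, by simp⟩, by simp [h11], fun _ _ _ => rfl⟩ ?_
  · obtain ⟨h1, h2, h3⟩ := key
    refine ⟨nextVal_eq_of_spec C ?_, by simpa using h2, h3⟩
    simpa using h1
  · intro b s' hag hb hs'
    have hin := h.of_agree hag (by decide) (by decide)
    have hi' : s'.nat 2 0 0 = i := by rw [hag.nat 2 (by decide), hi]
    have ha' : s'.nat 3 0 0 = a := by rw [hag.nat 3 (by decide), ha]
    obtain ⟨I1, I2, I3⟩ := hs'
    have hcb := hin.centers b i
    have hca := hin.centers a i
    have hreal : ∀ i' a', (compareCenter.run u s').real 3 i' a' =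
        if (i' = i ∧ a' = a) ∧ C a i < C b i ∧ ¬ (C a i < s'.real 3 i a ∧ s'.real 3 i a ≤ C b i) then
          C b i else s'.real 3 i' a' := by
      intro i' a'
      simp only [compareCenter, run, Test.holds, NExpr.eval, RExpr.eval, hi', ha', hb, hcb, hca,
        not_le]
      split_ifs <;> simp_all
    have hnat : (compareCenter.run u s').nat 11 0 0 =
        if b < a ∧ C b i = C a i then 1 else s'.nat 11 0 0 := by
      have e : C b i = C a i ↔ C b i ≤ C a i ∧ C a i ≤ C b i := le_antisymm_iff
      simp only [compareCenter, run, Test.holds, NExpr.eval, RExpr.eval, hi', ha', hb, hcb, hca,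
        not_le, e, Fin.lt_def]
      split_ifs <;> simp_all
    refine ⟨?_, ?_, fun i' a' hne => ?_⟩
    · have e : (compareCenter.run u s').real 3 i a =
          if C a i < C b i ∧ ¬ (C a i < s'.real 3 i a ∧ s'.real 3 i a ≤ C b i) then
            C b i else s'.real 3 i a := by rw [hreal]; simp
      simp only [e, forall_fin_lt_succ]
      generalize s'.real 3 i a = z at I1
      split_ifs with hc
      · refine Or.inr ⟨b, rfl, hc.1, fun b' hb' => ?_, Or.inr le_rfl⟩
        by_cases hca : C b' i ≤ C a i
        · exact Or.inl hca
        · right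
          rcases I1 with ⟨-, h2⟩ | ⟨b₁, -, h2, h3⟩
          · exact absurd (h2 b' hb') hca
          · have := (h3 b' hb').resolve_left hca
            have h4 : C b i < z := by
              by_contra h4; exact hc.2 ⟨h2, not_lt.1 h4⟩
            exact h4.le.trans this
      · rcases I1 with ⟨h1, h2⟩ | ⟨b₁, h1, h2, h3⟩
        · refine Or.inl ⟨h1, h2, ?_⟩
          by_contra h4
          exact hc ⟨not_le.1 h4, fun h5 => absurd h5.1 (by rw [h1]; exact lt_irrefl _)⟩
        · refine Or.inr ⟨b₁, h1, h2, h3, ?_⟩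
          by_contra h4
          simp only [not_or, not_le] at h4
          exact hc ⟨h4.1, fun h5 => absurd h5.2 (not_le.2 h4.2)⟩
    · rw [hnat]
      have e : (∃ b₁ < a, (b₁ : ℕ) < b + 1 ∧ C b₁ i = C a i) ↔
          (∃ b₁ < a, (b₁ : ℕ) < b ∧ C b₁ i = C a i) ∨ (b < a ∧ C b i = C a i) := by
        constructor
        · rintro ⟨b₁, h1, h2, h3⟩
          rcases Nat.lt_succ_iff_lt_or_eq.1 h2 with h2 | h2
          · exact Or.inl ⟨b₁, h1, h2, h3⟩
          · rw [Fin.ext h2] at h1 h3; exact Or.inr ⟨h1, h3⟩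
        · rintro (⟨b₁, h1, h2, h3⟩ | ⟨h1, h2⟩)
          · exact ⟨b₁, h1, by omega, h3⟩
          · exact ⟨b, h1, by omega, h2⟩
      rw [e, not_or, ← I2]
      split_ifs with hc
      · simp [hc]
      · simp [hc]
    · rw [hreal, if_neg fun h => hne (by rw [h.1.1, h.1.2]), I3 _ _ hne]

lemma computeCell_spec {s : Mem} (h : HoldsInput C s) {i : Fin d} {a : Fin k}
    (hi : s.nat 2 0 0 = i) (ha : s.nat 3 0 0 = a) :
    (∀ i' a', (computeCell.run u s).real 3 i' a' =
      if i' = i ∧ a' = a then nextVal C i a else s.real 3 i' a') ∧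
    ∀ i' a', (computeCell.run u s).real 4 i' a' =
      if i' = i ∧ a' = a then cellWt C (i, a) else s.real 4 i' a' := by
  set s₁ := (s.setReal 3 i a (C a i)).setNat 11 0 0 0 with hs₁
  have hin : HoldsInput C s₁ := ⟨by simp [hs₁, h.dim], by simp [hs₁, h.card],
    fun j i => by simp [hs₁, h.centers]⟩
  obtain ⟨h1, h2, h3⟩ := compareCenter_spec u (s := s₁) hin (i := i) (a := a) (by simp [hs₁, hi])
    (by simp [hs₁, ha]) (by simp [hs₁]) (by simp [hs₁])
  set s₂ := (loop 6 2 compareCenter).run u s₁ with hs₂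
  have hag : Agree _ _ s₁ s₂ := agree_run u (loop 6 2 compareCenter) s₁
  have hin₂ := hin.of_agree hag (by decide) (by decide)
  have hi₂ : s₂.nat 2 0 0 = i := by rw [hag.nat 2 (by decide)]; simp [hs₁, hi]
  have ha₂ : s₂.nat 3 0 0 = a := by rw [hag.nat 3 (by decide)]; simp [hs₁, ha]
  have h4 : ∀ i' a', s₂.real 4 i' a' = s.real 4 i' a' := fun i' a' => by
    rw [hag.real 4 (by decide)]; simp [hs₁]
  have hrun : computeCell.run u s = if s₂.nat 11 0 0 ≤ 0 then
      s₂.setReal 4 i a ((nextVal C i a - C a i) * (nextVal C i a - C a i) / 2)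
      else s₂.setReal 4 i a 0 := by
    have e1 : ((LoopProg.setNat 11 (.lit 0) (.lit 0) (.lit 0)).run u
        ((LoopProg.setReal 3 (.var 2) (.var 3) (centerCoord (.var 3) (.var 2))).run u s)) = s₁ := by
      simp only [run, NExpr.eval, RExpr.eval, hi, ha, h.centers, hs₁]
    unfold computeCell
    rw [run_seq, run_seq, run_seq, e1, ← hs₂]
    simp only [run, Test.holds, NExpr.eval, RExpr.eval, hi₂, ha₂, hin₂.centers, h1, Rat.cast_ofNat,
      Rat.cast_zero]
  have hz3 : (computeCell.run u s).real 3 = s₂.real 3 := by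
    rw [hrun]; split_ifs <;> exact Mem.setReal_real_of_ne _ _ _ _ (by decide)
  constructor
  · intro i' a'
    rw [hz3]
    split_ifs with hc
    · rw [hc.1, hc.2, h1]
    · rw [h3 _ _ (by simpa using hc)]
      simp only [hs₁, Mem.setNat_real, Mem.setReal_real]
      simp [hc]
  · intro i' a'
    rw [hrun]
    unfold cellWt
    simp only [Nat.le_zero, h2]
    by_cases hex : ∃ b < a, C b i = C a i
    · simp only [hex, not_true_eq_false, if_false, if_true, Mem.setReal_real, true_and, h4]
    · simp only [hex, not_false_eq_true, if_false, if_true, Mem.setReal_real, true_and, h4, sq]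

/-- The memory holds the weights and the right ends of the cells. -/
structure HoldsCells (C : Fin k → Pt d) (s : Mem) : Prop where
  input : HoldsInput C s
  next : ∀ (i : Fin d) (a : Fin k), s.real 3 i a = nextVal C i a
  weight : ∀ c : Fin d × Fin k, s.real 4 c.1 c.2 = cellWt C c

lemma HoldsCells.of_agree {N R : List ℕ} {s s' : Mem} (h : HoldsCells C s)
    (ha : LoopProg.Agree N R s s') (hN : 0 ∉ N) (hR : 1 ∉ R) (hR3 : 3 ∉ R) (hR4 : 4 ∉ R) :
    HoldsCells C s' :=
  ⟨h.input.of_agree ha hN hR, fun i a => by rw [ha.real 3 hR3, h.next], fun c => by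
    rw [ha.real 4 hR4, h.weight]⟩

lemma computeCells_spec {s : Mem} (h : HoldsInput C s) : HoldsCells C (computeCells.run u s) := by
  have key := loop_loop_induct u (c := 2) (b := 1) (c' := 3) (b' := 2) (p := computeCell) (s := s)
    (m := d) (n := k)
    (fun i j s' => ∀ c : Fin d × Fin k, Before i j c →
      s'.real 3 c.1 c.2 = nextVal C c.1 c.2 ∧ s'.real 4 c.1 c.2 = cellWt C c)
    rfl h.dim h.card (fun _ _ _ _ h => ⟨h, h⟩) (fun c hc => absurd hc (not_before_zero c))
    (fun i s' h c hc => h c ((before_row i c).2 hc)) ?_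
  · exact ⟨h.of_agree (agree_run u computeCells s) (by decide) (by decide),
      fun i a => (key (i, a) (before_all _)).1, fun c => (key c (before_all _)).2⟩
  · intro i a s' hag hi ha hI
    obtain ⟨h3, h4⟩ := computeCell_spec u (h.of_agree hag (by decide) (by decide)) hi ha
    rw [forall_before_succ]
    refine ⟨fun c hc => ?_, ?_⟩
    · have hne : ¬ ((c.1 : ℕ) = i ∧ (c.2 : ℕ) = a) := by unfold Before at hc; omega
      rw [h3, h4, if_neg hne, if_neg hne]
      exact hI c hc
    · rw [h3, h4, if_pos ⟨rfl, rfl⟩, if_pos ⟨rfl, rfl⟩]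
      exact ⟨rfl, rfl⟩

open Classical in
/-- The weights of the cells that separate `p` and `q`. -/
def sepWt (C : Fin k → Pt d) (p q : Fin k) (c : Fin d × Fin k) : ℝ :=
  if CellSep C c p q then cellWt C c else 0

lemma sepTest_holds {s : Mem} (h : HoldsInput C s) {i : Fin d} {a p q : Fin k}
    (hi : s.nat 2 0 0 = i) (ha : s.nat 3 0 0 = a) (hp : s.nat 4 0 0 = p) (hq : s.nat 5 0 0 = q) :
    sepTest.holds s ↔ CellSep C (i, a) p q := by
  simp only [sepTest, Test.holds, NExpr.eval, RExpr.eval, hi, ha, hp, hq, h.centers, CellSep,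
    ← not_le]
  tauto

lemma cumWeight_cell (w : Fin d × Fin k → ℝ) (i : Fin d) (a : Fin k) :
    cumWeight w (a + 1 + k * i) = cumWeight w (a + k * i) + w (i, a) := by
  have h1 : (a : ℕ) + 1 + k * i = cellNum (i, a) + 1 := by
    simp [cellNum, finProdFinEquiv]; ring
  have h2 : (a : ℕ) + k * i = cellNum (i, a) := by simp [cellNum, finProdFinEquiv]
  rw [h1, h2, cumWeight_succ, linWeight_cellNum]

/-- The sum over the cells is compared with the partial sums of `cumWeight`. -/
lemma computeDist_spec (hk : 0 < k) {s : Mem} (h : HoldsCells C s) {p q : Fin k}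
    (hp : s.nat 4 0 0 = p) (hq : s.nat 5 0 0 = q) :
    ∀ p' q', (computeDist.run u s).real 5 p' q' = if p' = p ∧ q' = q then
      l1Dist (termEmbed C (C p)) (termEmbed C (C q)) else s.real 5 p' q' := by
  set s₁ := s.setReal 5 p q 0 with hs₁
  have hin : HoldsCells C s₁ := ⟨⟨h.input.dim, h.input.card, fun j i => by
    simp [hs₁, h.input.centers]⟩, fun i a => by simp [hs₁, h.next], fun c => by
    simp [hs₁, h.weight]⟩
  have key := loop_loop_induct u (c := 2) (b := 1) (c' := 3) (b' := 2) (p := addCell) (s := s₁)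
    (m := d) (n := k)
    (fun i j s' => ∀ p' q', s'.real 5 p' q' = if p' = p ∧ q' = q then
      cumWeight (sepWt C p q) (j + k * i) else s.real 5 p' q')
    rfl h.input.dim h.input.card (fun _ _ _ _ h => ⟨h, h⟩)
    (fun p' q' => by simp [hs₁, cumWeight])
    (fun i s' h p' q' => by rw [h, mul_add, mul_one, zero_add, add_comm]) ?_
  · have hrun : computeDist.run u s = (loop 2 1 (loop 3 2 addCell)).run u s₁ := by
      unfold computeDist
      rw [run]
      congr 1
      simp only [run, NExpr.eval, RExpr.eval, hp, hq, Rat.cast_zero, hs₁]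
    intro p' q'
    rw [hrun, key p' q', zero_add, mul_comm, cumWeight_total, l1Dist_eq_sum_cells hk]
    rfl
  · intro i a s' hag hi ha hI p' q'
    have hin' := hin.of_agree hag (by decide) (by decide) (by decide) (by decide)
    have hp' : s'.nat 4 0 0 = p := by rw [hag.nat 4 (by decide)]; exact hp
    have hq' : s'.nat 5 0 0 = q := by rw [hag.nat 5 (by decide)]; exact hq
    have hw := hin'.weight (i, a)
    have hpq := hI p q
    rw [if_pos ⟨rfl, rfl⟩] at hpq
    classical
    have ht := sepTest_holds hin'.input hi ha hp' hq'
    have hadd : ∀ p' q', (addCell.run u s').real 5 p' q' =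
        if (p' = p ∧ q' = q) ∧ CellSep C (i, a) p q then s'.real 5 p q + cellWt C (i, a)
        else s'.real 5 p' q' := by
      intro p' q'
      unfold addCell
      by_cases hc : sepTest.holds s'
      · rw [run, if_pos hc]
        simp only [run, NExpr.eval, RExpr.eval, Mem.setReal_real, hi, ha, hp', hq', hw, ht.1 hc,
          true_and, and_true]
      · rw [run, if_neg hc, run, if_neg fun h => hc (ht.2 h.2)]
    rw [hadd, hpq, hI, cumWeight_cell]
    unfold sepWt
    by_cases h1 : p' = p ∧ q' = q <;> by_cases h2 : CellSep C (i, a) p q <;> simp [h1, h2]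

/-- The memory holds the cells, and the distances of the images of the centers. -/
structure HoldsDists (C : Fin k → Pt d) (s : Mem) : Prop where
  cells : HoldsCells C s
  dist : ∀ p q : Fin k, s.real 5 p q = l1Dist (termEmbed C (C p)) (termEmbed C (C q))

lemma HoldsDists.of_agree {N R : List ℕ} {s s' : Mem} (h : HoldsDists C s)
    (ha : LoopProg.Agree N R s s') (hN : 0 ∉ N) (hR : 1 ∉ R) (hR3 : 3 ∉ R) (hR4 : 4 ∉ R)
    (hR5 : 5 ∉ R) : HoldsDists C s' :=
  ⟨h.cells.of_agree ha hN hR hR3 hR4, fun p q => by rw [ha.real 5 hR5, h.dist]⟩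

lemma computeDists_spec (hk : 0 < k) {s : Mem} (h : HoldsCells C s) :
    HoldsDists C (computeDists.run u s) := by
  have key := loop_loop_induct u (c := 4) (b := 2) (c' := 5) (b' := 2) (p := computeDist) (s := s)
    (m := k) (n := k)
    (fun i j s' => ∀ c : Fin k × Fin k, Before i j c →
      s'.real 5 c.1 c.2 = l1Dist (termEmbed C (C c.1)) (termEmbed C (C c.2)))
    rfl h.input.card h.input.card (fun _ _ _ _ h => ⟨h, h⟩)
    (fun c hc => absurd hc (not_before_zero c))
    (fun i s' h c hc => h c ((before_row i c).2 hc)) ?_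
  · exact ⟨h.of_agree (agree_run u computeDists s) (by decide) (by decide) (by decide) (by decide),
      fun p q => key (p, q) (before_all _)⟩
  · intro p q s' hag hp hq hI
    have h5 := computeDist_spec u hk
      (h.of_agree hag (by decide) (by decide) (by decide) (by decide)) hp hq
    rw [forall_before_succ]
    refine ⟨fun c hc => ?_, ?_⟩
    · have hne : ¬ ((c.1 : ℕ) = p ∧ (c.2 : ℕ) = q) := by unfold Before at hc; omega
      rw [h5, if_neg hne]
      exact hI c hc
    · rw [h5, if_pos ⟨rfl, rfl⟩]

end Static

/-! ### Choosing a cut -/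

namespace LoopProg

/-- The address of the leaf that contains the center with index in the natural array `c`. -/
abbrev leafAddr (c : ℕ) : NExpr := .get 9 (.var c) (.lit 0)

/-- The centers `p` and `q` are in the same leaf. -/
abbrev sameLeaf : Test := Test.natEq (leafAddr 4) (leafAddr 5)

/-- Replace the number in the real array `6` by the distance of `p` and `q` if this is larger and
they are in the same leaf. -/
def updateDiam : LoopProg :=
  .ite (.conj sameLeaf (.realLT (.var 6) (.get 5 (.var 4) (.var 5))))
    (.setReal 6 (.lit 0) (.lit 0) (.get 5 (.var 4) (.var 5))) .skip

/-- Compute the largest distance of two centers in the same leaf. -/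
def computeDiam : LoopProg :=
  .seq (.setReal 6 (.lit 0) (.lit 0) (.lit 0)) (.loop 4 2 (.loop 5 2 updateDiam))

/-- The number of centers. -/
abbrev numCenters : RExpr := .ofNat (.get 0 (.lit 0) (.lit 2))

/-- Set the flag `11` if the cell `(i, a)` separates `p` and `q` and these are in the same leaf, and
then also the flag `12` if their distance is at most the bound for short distances. -/
def markCell : LoopProg :=
  .ite (.conj sameLeaf sepTest)
    (.seq (.setNat 11 (.lit 0) (.lit 0) (.lit 1))
      (.ite (.realLE (.get 5 (.var 4) (.var 5))
          (.div (.var 6) (.mul numCenters (.mul numCenters numCenters))))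
        (.setNat 12 (.lit 0) (.lit 0) (.lit 1)) .skip))
    .skip

/-- Compute the weight of the cell `(i, a)` in this round (real array `7`) and the sum of the weights
of the cells before it (real array `8`), and update the sum of all weights (real array `9`). -/
def weighCell : LoopProg :=
  .seq (.setNat 11 (.lit 0) (.lit 0) (.lit 0))
  (.seq (.setNat 12 (.lit 0) (.lit 0) (.lit 0))
  (.seq (.loop 4 2 (.loop 5 2 markCell))
  (.seq (.setReal 8 (.var 2) (.var 3) (.var 9))
  (.seq (.ite (.conj (.natLE (.lit 1) (.var 11)) (.natLE (.var 12) (.lit 0)))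
      (.setReal 7 (.var 2) (.var 3) (.get 4 (.var 2) (.var 3)))
      (.setReal 7 (.var 2) (.var 3) (.lit 0)))
    (.setReal 9 (.lit 0) (.lit 0) (.add (.var 9) (.get 7 (.var 2) (.var 3))))))))

/-- Compute the weights of all cells in this round. -/
def weighCells : LoopProg :=
  .seq (.setReal 9 (.lit 0) (.lit 0) (.lit 0)) (.loop 2 1 (.loop 3 2 weighCell))

/-- Choose the cell `(i, a)` if the random number is in its range. The chosen cell is stored in the
natural arrays `13`, `14`, the position in its range in the real array `11`. -/
def tryCell : LoopProg :=
  .ite (.conj (.realLE (.get 8 (.var 2) (.var 3)) (.var 10))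
      (.realLT (.var 10) (.add (.get 8 (.var 2) (.var 3)) (.get 7 (.var 2) (.var 3)))))
    (.seq (.setNat 13 (.lit 0) (.lit 0) (.var 2))
    (.seq (.setNat 14 (.lit 0) (.lit 0) (.var 3))
      (.setReal 11 (.lit 0) (.lit 0) (.sub (.var 10) (.get 8 (.var 2) (.var 3))))))
    .skip

/-- Choose a cell with probability proportional to its weight. -/
def chooseCell : LoopProg :=
  .seq (.sample 10 (.lit 0) (.lit 0))
  (.seq (.setReal 10 (.lit 0) (.lit 0) (.mul (.var 10) (.var 9))) (.loop 2 1 (.loop 3 2 tryCell)))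

/-- The left end of the chosen cell. -/
abbrev cellLeft : RExpr := centerCoord (.var 14) (.var 13)

/-- The right end of the chosen cell. -/
abbrev cellRight : RExpr := .get 3 (.var 13) (.var 14)

/-- The square of the length of the chosen cell. -/
abbrev cellSq : RExpr := .mul (.sub cellRight cellLeft) (.sub cellRight cellLeft)

/-- Compute the threshold of the preimage of the chosen cut (real array `12`). -/
def computeThreshold : LoopProg :=
  .ite (.realLE (.var 11) (.div cellSq (.lit 4)))
    (.setReal 12 (.lit 0) (.lit 0) (.add cellLeft (.sqrt (.var 11))))
    (.setReal 12 (.lit 0) (.lit 0) (.sub cellRight (.sqrt (.sub (.div cellSq (.lit 2)) (.var 11)))))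

end LoopProg

section Choice

open LoopProg

variable {d k : ℕ} {C : Fin k → Pt d} (u : ℕ → ℝ)

/-- The centers `p` and `q` are in the same leaf of the stored tree. -/
def SameAddr (s : Mem) (p q : Fin k) : Prop := s.nat 9 p 0 = s.nat 9 q 0

lemma SameAddr.of_agree {N R : List ℕ} {s s' : Mem} (ha : Agree N R s s') (hN : 9 ∉ N) :
    (SameAddr s' : Fin k → Fin k → Prop) = SameAddr s := by
  funext p q; simp only [SameAddr, ha.nat 9 hN]

lemma eq_relDiam {E : Fin k → Fin k → Prop} {z : ℝ} (h0 : 0 ≤ z)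
    (h1 : ∀ p q, E p q → l1Dist (termEmbed C (C p)) (termEmbed C (C q)) ≤ z)
    (h2 : z = 0 ∨ ∃ p q, E p q ∧ z = l1Dist (termEmbed C (C p)) (termEmbed C (C q))) :
    z = relDiam C E := by
  refine le_antisymm ?_ (Real.iSup_le (fun z => h1 _ _ z.2) h0)
  rcases h2 with h2 | ⟨p, q, hE, h2⟩
  · rw [h2]; exact relDiam_nonneg E
  · rw [h2]
    exact le_ciSup (f := fun z : {z : Fin k × Fin k // E z.1 z.2} =>
      l1Dist (termEmbed C (C z.1.1)) (termEmbed C (C z.1.2))) (Set.finite_range _).bddAbove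
      ⟨(p, q), hE⟩

lemma computeDiam_spec {s : Mem} (h : HoldsDists C s) :
    (computeDiam.run u s).real 6 0 0 = relDiam C (SameAddr s) := by
  set s₁ := s.setReal 6 0 0 0 with hs₁
  have hag₁ : Agree [] [6] s s₁ :=
    ⟨fun _ _ => rfl, fun a ha => Mem.setReal_real_of_ne _ _ _ _ (by simpa using ha)⟩
  have h₁ := h.of_agree hag₁ (by decide) (by decide) (by decide) (by decide) (by decide)
  have key := loop_loop_induct u (c := 4) (b := 2) (c' := 5) (b' := 2) (p := updateDiam) (s := s₁)
    (m := k) (n := k)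
    (fun i j s' => 0 ≤ s'.real 6 0 0 ∧
      (∀ c : Fin k × Fin k, Before i j c → SameAddr s c.1 c.2 →
        l1Dist (termEmbed C (C c.1)) (termEmbed C (C c.2)) ≤ s'.real 6 0 0) ∧
      (s'.real 6 0 0 = 0 ∨ ∃ p q, SameAddr s p q ∧
        s'.real 6 0 0 = l1Dist (termEmbed C (C p)) (termEmbed C (C q))))
    rfl h₁.cells.input.card h₁.cells.input.card (fun _ _ _ _ h => ⟨h, h⟩)
    ⟨by simp [hs₁], fun c hc => absurd hc (not_before_zero c), by simp [hs₁]⟩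
    (fun i s' h => ⟨h.1, fun c hc => h.2.1 c ((before_row i c).2 hc), h.2.2⟩) ?_
  · have hrun : computeDiam.run u s = (loop 4 2 (loop 5 2 updateDiam)).run u s₁ := by
      unfold computeDiam
      rw [run_seq]
      simp only [run, NExpr.eval, RExpr.eval, Rat.cast_zero, hs₁]
    rw [hrun]
    exact eq_relDiam key.1 (fun p q hE => key.2.1 (p, q) (before_all _) hE) key.2.2
  · rintro p q s' hag hp hq ⟨I1, I2, I3⟩
    have hd := (h₁.of_agree hag (by decide) (by decide) (by decide) (by decide) (by decide)).dist p q
    have h9 : s'.nat 9 = s.nat 9 := by rw [hag.nat 9 (by decide)]; rfl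
    have ht : (Test.conj sameLeaf (.realLT (.var 6) (.get 5 (.var 4) (.var 5)))).holds s' ↔
        SameAddr s p q ∧ s'.real 6 0 0 < l1Dist (termEmbed C (C p)) (termEmbed C (C q)) := by
      simp only [Test.holds, NExpr.eval, RExpr.eval, hp, hq, hd, h9, SameAddr, not_le,
        ← le_antisymm_iff]
    rw [forall_before_succ]
    unfold updateDiam
    rw [run]
    split_ifs with hc
    · rw [ht] at hc
      have e : ((LoopProg.setReal 6 (.lit 0) (.lit 0) (.get 5 (.var 4) (.var 5))).run u s').real 6 0 0 =
          l1Dist (termEmbed C (C p)) (termEmbed C (C q)) := by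
        simp [run, NExpr.eval, RExpr.eval, hp, hq, hd]
      rw [e]
      exact ⟨l1Dist_nonneg _ _, ⟨fun c hc' hE => (I2 c hc' hE).trans hc.2.le, fun _ => le_rfl⟩,
        Or.inr ⟨p, q, hc.1, rfl⟩⟩
    · rw [ht] at hc
      exact ⟨I1, ⟨I2, fun hE => not_lt.1 fun hlt => hc ⟨hE, hlt⟩⟩, I3⟩

lemma marks_spec {s : Mem} (h : HoldsDists C s) {i : Fin d} {a : Fin k}
    (hi : s.nat 2 0 0 = i) (ha : s.nat 3 0 0 = a) (h11 : s.nat 11 0 0 = 0) (h12 : s.nat 12 0 0 = 0) :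
    (((loop 4 2 (loop 5 2 markCell)).run u s).nat 11 0 0 = 0 ↔
      ¬ ∃ p q, SameAddr s p q ∧ CellSep C (i, a) p q) ∧
    (((loop 4 2 (loop 5 2 markCell)).run u s).nat 12 0 0 = 0 ↔
      ¬ ∃ p q, SameAddr s p q ∧ CellSep C (i, a) p q ∧
        l1Dist (termEmbed C (C p)) (termEmbed C (C q)) ≤ s.real 6 0 0 / (k : ℝ) ^ 3) := by
  have key := loop_loop_induct u (c := 4) (b := 2) (c' := 5) (b' := 2) (p := markCell) (s := s)
    (m := k) (n := k)
    (fun i' j' s' =>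
      (s'.nat 11 0 0 = 0 ↔ ¬ ∃ c : Fin k × Fin k, Before i' j' c ∧
        SameAddr s c.1 c.2 ∧ CellSep C (i, a) c.1 c.2) ∧
      (s'.nat 12 0 0 = 0 ↔ ¬ ∃ c : Fin k × Fin k, Before i' j' c ∧
        SameAddr s c.1 c.2 ∧ CellSep C (i, a) c.1 c.2 ∧
        l1Dist (termEmbed C (C c.1)) (termEmbed C (C c.2)) ≤ s.real 6 0 0 / (k : ℝ) ^ 3))
    rfl h.cells.input.card h.cells.input.card (fun _ _ _ _ h => by simpa using h)
    (by simp [h11, h12, not_before_zero]) (fun i s' h => by simpa only [before_row] using h) ?_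
  · obtain ⟨h1, h2⟩ := key
    simp only [before_all, true_and, Prod.exists] at h1 h2
    exact ⟨h1, h2⟩
  · rintro p q s' hag hp hq ⟨I1, I2⟩
    have hh := h.of_agree hag (by decide) (by decide) (by decide) (by decide) (by decide)
    have hd := hh.dist p q
    have h9 : s'.nat 9 = s.nat 9 := hag.nat 9 (by decide)
    have h6 : s'.real 6 = s.real 6 := hag.real 6 (by decide)
    have hi' : s'.nat 2 0 0 = i := by rw [hag.nat 2 (by decide), hi]
    have ha' : s'.nat 3 0 0 = a := by rw [hag.nat 3 (by decide), ha]
    have ht : (Test.conj sameLeaf sepTest).holds s' ↔ SameAddr s p q ∧ CellSep C (i, a) p q := by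
      rw [Test.holds, sepTest_holds hh.cells.input hi' ha' hp hq]
      simp only [Test.holds, NExpr.eval, hp, hq, h9, SameAddr, ← le_antisymm_iff]
    have ht' : ∀ v, (Test.realLE (.get 5 (.var 4) (.var 5))
          (.div (.var 6) (.mul numCenters (.mul numCenters numCenters)))).holds
          (s'.setNat 11 0 0 v) ↔
        l1Dist (termEmbed C (C p)) (termEmbed C (C q)) ≤ s.real 6 0 0 / (k : ℝ) ^ 3 := by
      intro v
      have e : (k : ℝ) ^ 3 = k * (k * k) := by ring
      simp [Test.holds, NExpr.eval, RExpr.eval, hp, hq, hd, h6, hh.cells.input.card, e]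
    simp only [exists_before_succ]
    rw [not_or, not_or, ← I1, ← I2]
    unfold markCell
    rw [run]
    split_ifs with hc
    · rw [run_seq]
      have e : (LoopProg.setNat 11 (.lit 0) (.lit 0) (.lit 1)).run u s' = s'.setNat 11 0 0 1 := rfl
      rw [e, run, ht'] 
      rw [ht] at hc
      split_ifs with hc'
      · simp [hc, hc', run, NExpr.eval]
      · simp [hc, hc', run]
    · rw [ht] at hc
      rw [run]
      constructor
      · tauto
      · tauto

lemma weighCell_spec {s : Mem} (h : HoldsDists C s) (h6 : s.real 6 0 0 = relDiam C (SameAddr s))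
    {i : Fin d} {a : Fin k} (hi : s.nat 2 0 0 = i) (ha : s.nat 3 0 0 = a) :
    (∀ i' a', (weighCell.run u s).real 7 i' a' =
      if i' = i ∧ a' = a then roundWt C (SameAddr s) (i, a) else s.real 7 i' a') ∧
    (∀ i' a', (weighCell.run u s).real 8 i' a' =
      if i' = i ∧ a' = a then s.real 9 0 0 else s.real 8 i' a') ∧
    (weighCell.run u s).real 9 0 0 = s.real 9 0 0 + roundWt C (SameAddr s) (i, a) := by
  set s₁ := (s.setNat 11 0 0 0).setNat 12 0 0 0 with hs₁
  have hag₁ : Agree [11, 12] [] s s₁ :=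
    agree_run u (.seq (.setNat 11 (.lit 0) (.lit 0) (.lit 0))
      (.setNat 12 (.lit 0) (.lit 0) (.lit 0))) s
  have h₁ := h.of_agree hag₁ (by decide) (by decide) (by decide) (by decide) (by decide)
  obtain ⟨m1, m2⟩ := marks_spec u (s := s₁) h₁ (i := i) (a := a) (by simp [hs₁, hi])
    (by simp [hs₁, ha]) (by simp [hs₁]) (by simp [hs₁])
  rw [SameAddr.of_agree hag₁ (by decide)] at m1 m2
  have e6 : s₁.real 6 0 0 = relDiam C (SameAddr s) := h6
  rw [e6] at m2
  set s₂ := (loop 4 2 (loop 5 2 markCell)).run u s₁ with hs₂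
  have hag₂ : Agree _ _ s₁ s₂ := agree_run u (loop 4 2 (loop 5 2 markCell)) s₁
  have h₂ := h₁.of_agree hag₂ (by decide) (by decide) (by decide) (by decide) (by decide)
  have hi₂ : s₂.nat 2 0 0 = i := by rw [hag₂.nat 2 (by decide)]; simp [hs₁, hi]
  have ha₂ : s₂.nat 3 0 0 = a := by rw [hag₂.nat 3 (by decide)]; simp [hs₁, ha]
  have e7 : s₂.real 7 = s.real 7 := by rw [hag₂.real 7 (by decide)]; rfl
  have e8 : s₂.real 8 = s.real 8 := by rw [hag₂.real 8 (by decide)]; rfl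
  have e9 : s₂.real 9 = s.real 9 := by rw [hag₂.real 9 (by decide)]; rfl
  have hw := h₂.cells.weight (i, a)
  simp only at hw
  have hcond : (1 ≤ s₂.nat 11 0 0 ∧ s₂.nat 12 0 0 ≤ 0) ↔ CellAvail C (SameAddr s) (i, a) := by
    rw [Nat.le_zero, m2, Nat.one_le_iff_ne_zero, Ne, m1, not_not]; rfl
  have hrun : weighCell.run u s = ((s₂.setReal 8 i a (s.real 9 0 0)).setReal 7 i a
      (roundWt C (SameAddr s) (i, a))).setReal 9 0 0
        (s.real 9 0 0 + roundWt C (SameAddr s) (i, a)) := by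
    unfold weighCell
    rw [run_seq, run_seq, run_seq, run_seq, run_seq]
    change LoopProg.run u _ (LoopProg.run u _ (LoopProg.run u _ s₂)) = _
    set s₃ := s₂.setReal 8 i a (s.real 9 0 0) with hs₃
    have e₃ : (LoopProg.setReal 8 (.var 2) (.var 3) (.var 9)).run u s₂ = s₃ := by
      simp only [run, NExpr.eval, RExpr.eval, hi₂, ha₂, e9, hs₃]
    rw [e₃]
    have e₄ : (LoopProg.ite (.conj (.natLE (.lit 1) (.var 11)) (.natLE (.var 12) (.lit 0)))
        (.setReal 7 (.var 2) (.var 3) (.get 4 (.var 2) (.var 3)))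
        (.setReal 7 (.var 2) (.var 3) (.lit 0))).run u s₃ =
        s₃.setReal 7 i a (roundWt C (SameAddr s) (i, a)) := by
      have ht : (Test.conj (.natLE (.lit 1) (.var 11)) (.natLE (.var 12) (.lit 0))).holds s₃ ↔
          CellAvail C (SameAddr s) (i, a) := hcond
      unfold roundWt
      by_cases hav : CellAvail C (SameAddr s) (i, a)
      · rw [run, if_pos (ht.2 hav), if_pos hav]
        simp [run, NExpr.eval, RExpr.eval, hs₃, hi₂, ha₂, hw]
      · rw [run, if_neg fun h => hav (ht.1 h), if_neg hav]
        simp [run, NExpr.eval, RExpr.eval, hs₃, hi₂, ha₂]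
    rw [e₄]
    simp [run, NExpr.eval, RExpr.eval, hs₃, hi₂, ha₂, e9]
  rw [hrun]
  refine ⟨fun i' a' => ?_, fun i' a' => ?_, ?_⟩
  · simp [e7]
  · simp [e8]
  · simp

/-- The memory holds the weights of the cells for the present round. -/
structure HoldsWeights (C : Fin k → Pt d) (s : Mem) : Prop where
  dists : HoldsDists C s
  wt : ∀ c : Fin d × Fin k, s.real 7 c.1 c.2 = roundWt C (SameAddr s) c
  cum : ∀ c : Fin d × Fin k, s.real 8 c.1 c.2 = cumWeight (roundWt C (SameAddr s)) (cellNum c)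
  total : s.real 9 0 0 = totalWeight (roundWt C (SameAddr s))

lemma cellNum_eq (c : Fin d × Fin k) : cellNum c = c.2 + k * c.1 := by
  simp [cellNum, finProdFinEquiv]

lemma weighCells_spec {s : Mem} (h : HoldsDists C s) (h6 : s.real 6 0 0 = relDiam C (SameAddr s)) :
    HoldsWeights C (weighCells.run u s) := by
  set w := roundWt C (SameAddr s) with hw
  set s₁ := s.setReal 9 0 0 0 with hs₁
  have hrun : weighCells.run u s = (loop 2 1 (loop 3 2 weighCell)).run u s₁ := by
    unfold weighCells
    rw [run_seq]
    simp only [run, NExpr.eval, RExpr.eval, Rat.cast_zero, hs₁]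
  have hagf := agree_run u weighCells s
  have hag₁ : Agree [] [9] s s₁ :=
    ⟨fun _ _ => rfl, fun a ha => Mem.setReal_real_of_ne _ _ _ _ (by simpa using ha)⟩
  have h₁ := h.of_agree hag₁ (by decide) (by decide) (by decide) (by decide) (by decide)
  have key := loop_loop_induct u (c := 2) (b := 1) (c' := 3) (b' := 2) (p := weighCell) (s := s₁)
    (m := d) (n := k)
    (fun i j s' => (∀ c : Fin d × Fin k, Before i j c →
      s'.real 7 c.1 c.2 = w c ∧ s'.real 8 c.1 c.2 = cumWeight w (cellNum c)) ∧
      s'.real 9 0 0 = cumWeight w (j + k * i))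
    rfl h₁.cells.input.dim h₁.cells.input.card (fun _ _ _ _ h => ⟨h, h⟩)
    ⟨fun c hc => absurd hc (not_before_zero c), by simp [hs₁, cumWeight]⟩
    (fun i s' h => ⟨fun c hc => h.1 c ((before_row i c).2 hc), by
      rw [h.2, mul_add, mul_one, zero_add, add_comm]⟩) ?_
  · rw [← hrun] at key
    have hE := SameAddr.of_agree (k := k) hagf (by decide)
    refine ⟨h.of_agree hagf (by decide) (by decide) (by decide) (by decide) (by decide), ?_, ?_, ?_⟩
    · rw [hE]; exact fun c => (key.1 c (before_all c)).1
    · rw [hE]; exact fun c => (key.1 c (before_all c)).2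
    · rw [hE, key.2, zero_add, mul_comm, cumWeight_total]
  · rintro i a s' hag hi ha ⟨I1, I2⟩
    have hE : (SameAddr s' : Fin k → Fin k → Prop) = SameAddr s :=
      (SameAddr.of_agree hag (by decide)).trans (SameAddr.of_agree hag₁ (by decide))
    obtain ⟨k1, k2, k3⟩ := weighCell_spec u
      (h₁.of_agree hag (by decide) (by decide) (by decide) (by decide) (by decide))
      (by rw [hE, hag.real 6 (by decide), hag₁.real 6 (by decide), h6]) hi ha
    rw [hE] at k1 k3
    rw [forall_before_succ]
    refine ⟨⟨fun c hc => ?_, ?_⟩, ?_⟩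
    · have hne : ¬ ((c.1 : ℕ) = i ∧ (c.2 : ℕ) = a) := by unfold Before at hc; omega
      rw [k1, k2, if_neg hne, if_neg hne]
      exact I1 c hc
    · rw [k1, k2, if_pos ⟨rfl, rfl⟩, if_pos ⟨rfl, rfl⟩, I2, cellNum_eq]
      exact ⟨rfl, rfl⟩
    · rw [k3, I2, cumWeight_cell]

lemma chooseCell_spec {s : Mem} (h : HoldsWeights C s) {c : Fin d × Fin k}
    (hc : u s.drawn * totalWeight (roundWt C (SameAddr s)) ∈ cellRange (roundWt C (SameAddr s)) c) :
    (chooseCell.run u s).nat 13 0 0 = c.1 ∧ (chooseCell.run u s).nat 14 0 0 = c.2 ∧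
    (chooseCell.run u s).real 11 0 0 = u s.drawn * totalWeight (roundWt C (SameAddr s)) -
      cumWeight (roundWt C (SameAddr s)) (cellNum c) := by
  set w := roundWt C (SameAddr s) with hw
  set r := u s.drawn * totalWeight w with hr
  set s₁ := (s.draw u 10 0 0).setReal 10 0 0 r with hs₁
  have hrun : chooseCell.run u s = (loop 2 1 (loop 3 2 tryCell)).run u s₁ := by
    unfold chooseCell
    rw [run_seq, run_seq]
    congr 1
    simp [run, NExpr.eval, RExpr.eval, hs₁, hr, h.total, hw]
  have key := loop_loop_induct u (c := 2) (b := 1) (c' := 3) (b' := 2) (p := tryCell) (s := s₁)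
    (m := d) (n := k)
    (fun i j s' => Before i j c → s'.nat 13 0 0 = c.1 ∧ s'.nat 14 0 0 = c.2 ∧
      s'.real 11 0 0 = r - cumWeight w (cellNum c))
    rfl h.dists.cells.input.dim h.dists.cells.input.card
    (fun _ _ _ _ h => by simpa using h)
    (fun hc => absurd hc (not_before_zero c)) (fun i s' h hc => h ((before_row i c).2 hc)) ?_
  · rw [hrun]; exact key (before_all c)
  · intro i a s' hag hi ha hI
    have e7 : s'.real 7 i a = w (i, a) := by
      rw [hag.real 7 (by decide)]
      exact (by simp [hs₁] : s₁.real 7 i a = s.real 7 i a).trans (h.wt (i, a))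
    have e8 : s'.real 8 i a = cumWeight w (cellNum (i, a)) := by
      rw [hag.real 8 (by decide)]
      exact (by simp [hs₁] : s₁.real 8 i a = s.real 8 i a).trans (h.cum (i, a))
    have e10 : s'.real 10 0 0 = r := by
      rw [hag.real 10 (by decide)]; simp [hs₁]
    unfold tryCell
    rw [run]
    have ht : (Test.conj (.realLE (.get 8 (.var 2) (.var 3)) (.var 10))
      (.realLT (.var 10) (.add (.get 8 (.var 2) (.var 3)) (.get 7 (.var 2) (.var 3))))).holds s' ↔
        r ∈ cellRange w (i, a) := by
      simp only [Test.holds, NExpr.eval, RExpr.eval, hi, ha, e7, e8, e10, not_le]; rfl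
    intro hb
    split_ifs with hc'
    · rw [ht] at hc'
      have := cellRange_disjoint (roundWt_nonneg C _) hc hc'
      subst this
      simp [run, NExpr.eval, RExpr.eval, hi, ha, e8, e10]
    · rw [ht] at hc'
      rcases before_succ.1 hb with hb | rfl
      · exact hI hb
      · exact absurd hc hc'

lemma computeThreshold_spec (hk : 0 < k) {s : Mem} (h : HoldsCells C s) {c : Fin d × Fin k}
    (h13 : s.nat 13 0 0 = c.1) (h14 : s.nat 14 0 0 = c.2)
    (hθ : cellBase C c + s.real 11 0 0 ∈ cellIco C c) :
    (computeThreshold.run u s).real 12 0 0 =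
      embedInv (coords C c.1) (cellBase C c + s.real 11 0 0) := by
  set y := C c.2 c.1 with hy
  set z := nextVal C c.1 c.2 with hz
  have hrun : (computeThreshold.run u s).real 12 0 0 = gapPoint y z (s.real 11 0 0) := by
    have e4 : (z - y) ^ 2 / 4 = (z - y) * (z - y) / 4 := by ring
    have e2 : (z - y) ^ 2 / 2 = (z - y) * (z - y) / 2 := by ring
    unfold computeThreshold gapPoint
    simp only [run, Test.holds, NExpr.eval, RExpr.eval, h13, h14, h.input.centers, h.next, e4, e2,
      Rat.cast_ofNat]
    split_ifs <;> simp [hy, hz]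
  obtain ⟨-, h2, b, h3, h4, h5⟩ := cell_gap hθ
  have h6 := hθ.1
  have h7 := hθ.2
  rw [hrun]
  refine (embedInv_eq (coords_finite C c.1) (coords_nonempty hk C c.1) ?_).symm
  refine embed_gapPoint (Set.mem_range_self c.2) ⟨b, h3.symm⟩ ?_ ?_ (by linarith) ?_
  · rw [hz, h3]; exact h4.le
  · rintro _ ⟨b', rfl⟩
    rw [hz, h3]; exact h5 b'
  · rw [← h2]; linarith

end Choice

/-! ### Applying a cut to the stored tree -/

namespace LoopProg

/-- The center with index in the natural array `c` is on the left side of the chosen cut. -/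
abbrev leftSide (c : ℕ) : Test := .realLE (centerCoord (.var c) (.var 13)) cellLeft

/-- Move the center `j`, the counter in the natural array `18`, to one of the two new leaves if it is
in the leaf which is split, whose address is in the natural array `15`. -/
def moveCenter : LoopProg :=
  .ite (Test.natEq (leafAddr 18) (.var 15))
    (.ite (leftSide 18) (.setNat 9 (.var 18) (.lit 0) (.var 10))
      (.setNat 9 (.var 18) (.lit 0) (.add (.var 10) (.lit 1))))
    .skip

/-- Replace the leaf with the address in the natural array `15` by a node with two leaves. -/
def splitLeaf : LoopProg :=
  .seq (.setNat 15 (.lit 0) (.lit 0) (leafAddr 4))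
  (.seq (.setNat 1 (.var 15) (.lit 0) (.lit 1))
  (.seq (.setNat 1 (.var 15) (.lit 1) (.var 13))
  (.seq (.setNat 1 (.var 15) (.lit 2) (.var 10))
  (.seq (.setNat 1 (.var 15) (.lit 3) (.add (.var 10) (.lit 1)))
  (.seq (.setReal 2 (.var 15) (.lit 0) (.var 12))
  (.seq (.loop 18 2 moveCenter)
    (.setNat 10 (.lit 0) (.lit 0) (.add (.var 10) (.lit 2)))))))))

/-- Split the leaf of `p` and `q` if they are in the same leaf, but on different sides of the cut. -/
def trySplit : LoopProg :=
  .ite (.conj sameLeaf (.conj (leftSide 4) (.neg (leftSide 5)))) splitLeaf .skip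

/-- Apply the chosen cut to all leaves that contain centers on both of its sides. -/
def splitAll : LoopProg := .loop 4 2 (.loop 5 2 trySplit)

end LoopProg

section Split

open LoopProg

variable {d k : ℕ} {C : Fin k → Pt d} (u : ℕ → ℝ)

/-- The addresses below the natural number in the array `10` are in use, and the addresses of the
centers are leaves. -/
structure LeafInv (k : ℕ) (s : Mem) : Prop where
  lt : ∀ j : Fin k, s.nat 9 j 0 < s.nat 10 0 0
  free : ∀ v, s.nat 10 0 0 ≤ v → s.nat 1 v 0 = 0
  leaf : ∀ j : Fin k, s.nat 1 (s.nat 9 j 0) 0 = 0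

/-- The effect of splitting the leaf `v` with the cut with left side `side`, stored in `s`. -/
structure SplitLeaf (side : Fin k → Prop) (v : ℕ) (s s' : Mem) : Prop where
  kind : s'.nat 1 v 0 = 1
  coord : s'.nat 1 v 1 = s.nat 13 0 0
  left : s'.nat 1 v 2 = s.nat 10 0 0
  right : s'.nat 1 v 3 = s.nat 10 0 0 + 1
  threshold : s'.real 2 v 0 = s.real 12 0 0
  row : ∀ v' ≠ v, ∀ i, s'.nat 1 v' i = s.nat 1 v' i
  row_threshold : ∀ v' ≠ v, s'.real 2 v' 0 = s.real 2 v' 0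
  count : s'.nat 10 0 0 = s.nat 10 0 0 + 2
  move_left : ∀ j : Fin k, s.nat 9 j 0 = v → side j → s'.nat 9 j 0 = s.nat 10 0 0
  move_right : ∀ j : Fin k, s.nat 9 j 0 = v → ¬ side j → s'.nat 9 j 0 = s.nat 10 0 0 + 1
  stay : ∀ j : Fin k, s.nat 9 j 0 ≠ v → s'.nat 9 j 0 = s.nat 9 j 0

lemma leftSide_holds {s : Mem} (h : HoldsInput C s) {i : Fin d} {a j : Fin k} {c : ℕ}
    (h13 : s.nat 13 0 0 = i) (h14 : s.nat 14 0 0 = a) (hj : s.nat c 0 0 = j) :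
    (leftSide c).holds s ↔ C j i ≤ C a i := by
  simp only [Test.holds, NExpr.eval, RExpr.eval, h13, h14, hj, h.centers]

lemma moveCenters_spec {s : Mem} (h : HoldsInput C s) {i : Fin d} {a : Fin k}
    (h13 : s.nat 13 0 0 = i) (h14 : s.nat 14 0 0 = a) (j : Fin k) :
    (s.nat 9 j 0 = s.nat 15 0 0 → C j i ≤ C a i →
      ((loop 18 2 moveCenter).run u s).nat 9 j 0 = s.nat 10 0 0) ∧
    (s.nat 9 j 0 = s.nat 15 0 0 → ¬ C j i ≤ C a i →
      ((loop 18 2 moveCenter).run u s).nat 9 j 0 = s.nat 10 0 0 + 1) ∧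
    (s.nat 9 j 0 ≠ s.nat 15 0 0 →
      ((loop 18 2 moveCenter).run u s).nat 9 j 0 = s.nat 9 j 0) := by
  classical
  have key := loop_fin_induct u (c := 18) (b := 2) (p := moveCenter) (s := s) (n := k)
    (fun n s' => ∀ j : Fin k, s'.nat 9 j 0 =
      if (j : ℕ) < n ∧ s.nat 9 j 0 = s.nat 15 0 0 then
        (if C j i ≤ C a i then s.nat 10 0 0 else s.nat 10 0 0 + 1) else s.nat 9 j 0)
    rfl h.card (fun n s' v hs => by simpa using hs) (by simp) ?_
  · have := key j
    exact ⟨fun h1 h2 => by simp [this, h1, h2], fun h1 h2 => by simp [this, h1, h2],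
      fun h1 => by simp [this, h1]⟩
  · intro b s' hag hb hI j
    have hin := h.of_agree hag (by decide) (by decide)
    have h13' : s'.nat 13 0 0 = i := by rw [hag.nat 13 (by decide), h13]
    have h14' : s'.nat 14 0 0 = a := by rw [hag.nat 14 (by decide), h14]
    have h15 : s'.nat 15 = s.nat 15 := hag.nat 15 (by decide)
    have h10 : s'.nat 10 = s.nat 10 := hag.nat 10 (by decide)
    have hs := leftSide_holds hin h13' h14' hb
    have hbb : s'.nat 9 b 0 = s.nat 9 b 0 := by rw [hI b]; simp
    have ht : (Test.natEq (leafAddr 18) (.var 15)).holds s' ↔ s.nat 9 b 0 = s.nat 15 0 0 := by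
      simp only [Test.holds, NExpr.eval, hb, h15, hbb, ← le_antisymm_iff]
    have hmove : (moveCenter.run u s').nat 9 j 0 =
        if j = b ∧ s.nat 9 b 0 = s.nat 15 0 0 then
          (if C b i ≤ C a i then s.nat 10 0 0 else s.nat 10 0 0 + 1) else s'.nat 9 j 0 := by
      unfold moveCenter
      rw [run, run]
      simp only [ht, hs, run, NExpr.eval, hb, h10]
      split_ifs <;> simp_all [Fin.ext_iff]
    rw [hmove, hI]
    by_cases hjb : j = b
    · subst hjb; simp
    · have e : (j : ℕ) < b + 1 ↔ (j : ℕ) < b := by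
        have : (j : ℕ) ≠ b := fun h => hjb (Fin.ext h)
        omega
      simp [hjb, e]

lemma splitLeaf_spec {s : Mem} (h : HoldsInput C s) {i : Fin d} {a p : Fin k}
    (h13 : s.nat 13 0 0 = i) (h14 : s.nat 14 0 0 = a) (hp : s.nat 4 0 0 = p) :
    SplitLeaf (fun j : Fin k => C j i ≤ C a i) (s.nat 9 p 0) s (splitLeaf.run u s) := by
  set v := s.nat 9 p 0 with hv
  set s₁ := (((((s.setNat 15 0 0 v).setNat 1 v 0 1).setNat 1 v 1 (s.nat 13 0 0)).setNat 1 v 2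
    (s.nat 10 0 0)).setNat 1 v 3 (s.nat 10 0 0 + 1)).setReal 2 v 0 (s.real 12 0 0) with hs₁
  set s₂ := (loop 18 2 moveCenter).run u s₁ with hs₂
  have hrun : splitLeaf.run u s = s₂.setNat 10 0 0 (s₂.nat 10 0 0 + 2) := by
    have e : ∀ p, (LoopProg.seq (.setNat 15 (.lit 0) (.lit 0) (leafAddr 4))
        (.seq (.setNat 1 (.var 15) (.lit 0) (.lit 1))
        (.seq (.setNat 1 (.var 15) (.lit 1) (.var 13))
        (.seq (.setNat 1 (.var 15) (.lit 2) (.var 10))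
        (.seq (.setNat 1 (.var 15) (.lit 3) (.add (.var 10) (.lit 1)))
        (.seq (.setReal 2 (.var 15) (.lit 0) (.var 12)) p)))))).run u s = p.run u s₁ := by
      intro p
      simp [run, NExpr.eval, RExpr.eval, hs₁, hv, hp]
    unfold splitLeaf
    rw [e, run_seq, ← hs₂]
    rfl
  have hag : Agree _ _ s₁ s₂ := agree_run u (loop 18 2 moveCenter) s₁
  have h₁ : HoldsInput C s₁ := ⟨by simp [hs₁, h.dim], by simp [hs₁, h.card], fun j i => by
    simp [hs₁, h.centers]⟩
  have hmove := moveCenters_spec u (s := s₁) h₁ (i := i) (a := a) (by simp [hs₁, h13])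
    (by simp [hs₁, h14])
  have e9 : ∀ j, s₁.nat 9 j 0 = s.nat 9 j 0 := fun j => by simp [hs₁]
  have e10 : s₁.nat 10 0 0 = s.nat 10 0 0 := by simp [hs₁]
  have e15 : s₁.nat 15 0 0 = v := by simp [hs₁]
  simp only [e9, e10, e15, ← hs₂] at hmove
  have f1 : ∀ v' i', (splitLeaf.run u s).nat 1 v' i' = s₁.nat 1 v' i' := fun v' i' => by
    rw [hrun, Mem.setNat_nat, if_neg (by omega), hag.nat 1 (by decide)]
  have f2 : (splitLeaf.run u s).real 2 = s₁.real 2 := by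
    rw [hrun, Mem.setNat_real, hag.real 2 (by decide)]
  have f9 : ∀ j, (splitLeaf.run u s).nat 9 j 0 = s₂.nat 9 j 0 := fun j => by
    rw [hrun, Mem.setNat_nat, if_neg (by omega)]
  constructor
  · rw [f1]; simp [hs₁]
  · rw [f1]; simp [hs₁]
  · rw [f1]; simp [hs₁]
  · rw [f1]; simp [hs₁]
  · rw [f2]; simp [hs₁]
  · intro v' hv' i'; rw [f1]; simp [hs₁, hv']
  · intro v' hv'; rw [f2]; simp [hs₁, hv']
  · rw [hrun, Mem.setNat_nat, if_pos ⟨rfl, rfl, rfl⟩, hag.nat 10 (by decide), e10]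
  · intro j h1 h2; rw [f9, (hmove j).1 h1 h2]
  · intro j h1 h2; rw [f9, (hmove j).2.1 h1 h2]
  · intro j h1; rw [f9, (hmove j).2.2 h1]

/-- Both sides of the cut contain a center at the address `v`. -/
def Both (side : Fin k → Prop) (s : Mem) (v : ℕ) : Prop :=
  (∃ j : Fin k, s.nat 9 j 0 = v ∧ side j) ∧ ∃ j : Fin k, s.nat 9 j 0 = v ∧ ¬ side j

/-- The leaf `v` of `s` is a leaf with the same centers in `s'`. -/
def Unsplit (k : ℕ) (s s' : Mem) (v : ℕ) : Prop :=
  s'.nat 1 v 0 = 0 ∧ ∀ j : Fin k, s'.nat 9 j 0 = v ↔ s.nat 9 j 0 = v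

/-- The leaf `v` of `s` has been split by the cut stored in `s`. -/
structure IsSplit (side : Fin k → Prop) (s s' : Mem) (v : ℕ) : Prop where
  both : Both side s v
  kind : s'.nat 1 v 0 = 1
  coord : s'.nat 1 v 1 = s.nat 13 0 0
  threshold : s'.real 2 v 0 = s.real 12 0 0
  left_kind : s'.nat 1 (s'.nat 1 v 2) 0 = 0
  right_kind : s'.nat 1 (s'.nat 1 v 3) 0 = 0
  left : ∀ j : Fin k, s'.nat 9 j 0 = s'.nat 1 v 2 ↔ s.nat 9 j 0 = v ∧ side j
  right : ∀ j : Fin k, s'.nat 9 j 0 = s'.nat 1 v 3 ↔ s.nat 9 j 0 = v ∧ ¬ side j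

/-- Some of the leaves of `s` have been split, and the other nodes have not been changed. -/
structure PartSplit (side : Fin k → Prop) (s s' : Mem) : Prop where
  inv : LeafInv k s'
  node : ∀ v, s.nat 1 v 0 ≠ 0 → (∀ i, s'.nat 1 v i = s.nat 1 v i) ∧ s'.real 2 v 0 = s.real 2 v 0
  leaf : ∀ j : Fin k, Unsplit k s s' (s.nat 9 j 0) ∨ IsSplit side s s' (s.nat 9 j 0)

/-- Two centers that are still at the same address, but on different sides of the cut, are in a leaf
that has not been split yet. -/
lemma PartSplit.step {side : Fin k → Prop} {s s' s'' : Mem} (h : PartSplit side s s') {p q : Fin k}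
    (hpq : s'.nat 9 p 0 = s'.nat 9 q 0) (hp : side p) (hq : ¬ side q)
    (h13 : s'.nat 13 0 0 = s.nat 13 0 0) (h12 : s'.real 12 0 0 = s.real 12 0 0)
    (hs : SplitLeaf side (s'.nat 9 p 0) s' s'') :
    s.nat 9 p 0 = s.nat 9 q 0 ∧ s'.nat 9 p 0 = s.nat 9 p 0 ∧ PartSplit side s s'' := by
  -- the leaf of `p` and `q` has not been split before
  have hun : Unsplit k s s' (s.nat 9 p 0) := by
    refine (h.leaf p).resolve_right fun hsp => ?_
    have h1 := (hsp.left p).2 ⟨rfl, hp⟩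
    exact hq ((hsp.left q).1 (hpq ▸ h1)).2
  have hv := (hun.2 p).2 rfl
  have hqv : s.nat 9 q 0 = s.nat 9 p 0 := (hun.2 q).1 (by rw [← hpq, hv])
  refine ⟨hqv.symm, hv, ?_⟩
  rw [hv] at hs
  set v := s.nat 9 p 0 with hvdef
  set N := s'.nat 10 0 0 with hN
  have hvN : v < N := by rw [← hv]; exact h.inv.lt p
  have hkN : s''.nat 1 N 0 = 0 := by rw [hs.row N (by omega), h.inv.free N le_rfl]
  have hkN1 : s''.nat 1 (N + 1) 0 = 0 := by
    rw [hs.row (N + 1) (by omega), h.inv.free (N + 1) (by omega)]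
  have hloc : ∀ j : Fin k, ∀ w, w ≠ v → w < N → (s''.nat 9 j 0 = w ↔ s'.nat 9 j 0 = w) := by
    intro j w hw hwN
    by_cases hj : s'.nat 9 j 0 = v
    · rw [hj]
      by_cases hsj : side j
      · rw [hs.move_left j hj hsj]; omega
      · rw [hs.move_right j hj hsj]; omega
    · rw [hs.stay j hj]
  refine ⟨⟨fun j => ?_, fun w hw => ?_, fun j => ?_⟩, fun w hw => ?_, fun j => ?_⟩
  · rw [hs.count]
    by_cases hj : s'.nat 9 j 0 = v
    · by_cases hsj : side j
      · rw [hs.move_left j hj hsj]; omega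
      · rw [hs.move_right j hj hsj]; omega
    · rw [hs.stay j hj]; have := h.inv.lt j; omega
  · rw [hs.count] at hw
    rw [hs.row w (by omega), h.inv.free w (by omega)]
  · by_cases hj : s'.nat 9 j 0 = v
    · by_cases hsj : side j
      · rw [hs.move_left j hj hsj]; exact hkN
      · rw [hs.move_right j hj hsj]; exact hkN1
    · rw [hs.stay j hj, hs.row _ hj]; exact h.inv.leaf j
  · obtain ⟨h1, h2⟩ := h.node w hw
    have hne : w ≠ v := by
      rintro rfl
      exact hw (by rw [← h1 0]; exact hun.1)
    exact ⟨fun i => by rw [hs.row w hne, h1], by rw [hs.row_threshold w hne, h2]⟩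
  · by_cases hjv : s.nat 9 j 0 = v
    · right
      rw [hjv]
      refine ⟨⟨⟨p, rfl, hp⟩, q, hqv, hq⟩, hs.kind, by rw [hs.coord, h13], by rw [hs.threshold, h12],
        by rw [hs.left]; exact hkN, by rw [hs.right]; exact hkN1, fun j' => ?_, fun j' => ?_⟩
      · rw [hs.left, ← hun.2 j']
        by_cases hj : s'.nat 9 j' 0 = v
        · by_cases hsj : side j'
          · simp [hs.move_left j' hj hsj, hj, hsj]
          · simp [hs.move_right j' hj hsj, hsj]
        · rw [hs.stay j' hj]
          have := h.inv.lt j'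
          simp [hj]
          omega
      · rw [hs.right, ← hun.2 j']
        by_cases hj : s'.nat 9 j' 0 = v
        · by_cases hsj : side j'
          · simp [hs.move_left j' hj hsj, hsj]
          · simp [hs.move_right j' hj hsj, hj, hsj]
        · rw [hs.stay j' hj]
          have := h.inv.lt j'
          simp [hj]
          omega
    · rcases h.leaf j with hu | hsp
      · left
        have hlt : s.nat 9 j 0 < N := by
          have h1 := (hu.2 j).2 rfl
          rw [← h1]; exact h.inv.lt j
        exact ⟨by rw [hs.row _ hjv, hu.1], fun j' => by rw [hloc j' _ hjv hlt, hu.2]⟩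
      · right
        obtain ⟨⟨j₁, hj₁, hs₁⟩, j₂, hj₂, hs₂⟩ := hsp.both
        have e₁ := (hsp.left j₁).2 ⟨hj₁, hs₁⟩
        have e₂ := (hsp.right j₂).2 ⟨hj₂, hs₂⟩
        have hlne : s'.nat 1 (s.nat 9 j 0) 2 ≠ v := fun he =>
          hjv ((hsp.left p).1 (by rw [hv, he])).1.symm
        have hrne : s'.nat 1 (s.nat 9 j 0) 3 ≠ v := fun he =>
          hjv ((hsp.right p).1 (by rw [hv, he])).1.symm
        have hlN : s'.nat 1 (s.nat 9 j 0) 2 < N := by rw [← e₁]; exact h.inv.lt j₁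
        have hrN : s'.nat 1 (s.nat 9 j 0) 3 < N := by rw [← e₂]; exact h.inv.lt j₂
        have hrow := hs.row _ hjv
        refine ⟨hsp.both, by rw [hrow, hsp.kind], by rw [hrow, hsp.coord],
          by rw [hs.row_threshold _ hjv, hsp.threshold], ?_, ?_, fun j' => ?_, fun j' => ?_⟩
        · rw [hrow, hs.row _ hlne]; exact hsp.left_kind
        · rw [hrow, hs.row _ hrne]; exact hsp.right_kind
        · rw [hrow, hloc j' _ hlne hlN]; exact hsp.left j'
        · rw [hrow, hloc j' _ hrne hrN]; exact hsp.right j'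

/-- All leaves with centers on both sides of the cut have been split. -/
structure FullSplit (side : Fin k → Prop) (s s' : Mem) : Prop where
  part : PartSplit side s s'
  full : ∀ j : Fin k, Both side s (s.nat 9 j 0) → IsSplit side s s' (s.nat 9 j 0)

/-- As soon as a pair has been processed, its centers are at different addresses if the cut separates
them; so a leaf that has not been split does not contain centers on both sides. -/
lemma splitAll_spec {s : Mem} (h : HoldsInput C s) {i : Fin d} {a : Fin k}
    (h13 : s.nat 13 0 0 = i) (h14 : s.nat 14 0 0 = a) (hinv : LeafInv k s) :
    FullSplit (fun j : Fin k => C j i ≤ C a i) s (splitAll.run u s) := by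
  set side : Fin k → Prop := fun j => C j i ≤ C a i with hside
  have key := loop_loop_induct u (c := 4) (b := 2) (c' := 5) (b' := 2) (p := trySplit) (s := s)
    (m := k) (n := k)
    (fun i' j' s' => PartSplit side s s' ∧
      ∀ c : Fin k × Fin k, Before i' j' c → s.nat 9 c.1 0 = s.nat 9 c.2 0 → side c.1 → ¬ side c.2 →
        s'.nat 9 c.1 0 ≠ s'.nat 9 c.2 0)
    rfl h.card h.card (fun i' j' s' v hs => ?_)
    ⟨⟨hinv, fun _ _ => ⟨fun _ => rfl, rfl⟩, fun j => Or.inl ⟨hinv.leaf j, fun _ => Iff.rfl⟩⟩,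
      fun c hc => absurd hc (not_before_zero c)⟩
    (fun i s' h => ⟨h.1, fun c hc => h.2 c ((before_row i c).2 hc)⟩) ?_
  · refine ⟨key.1, fun j ⟨⟨p, hp, hp'⟩, q, hq, hq'⟩ => (key.1.leaf j).resolve_left fun hu => ?_⟩
    exact key.2 (p, q) (before_all _) (hp.trans hq.symm) hp' hq'
      (((hu.2 p).2 hp).trans ((hu.2 q).2 hq).symm)
  · have e : ∀ c, c ≠ 1 → c ≠ 9 → c ≠ 10 → (PartSplit side s (s'.setNat c 0 0 v) ∧
      ∀ c' : Fin k × Fin k, Before i' j' c' → s.nat 9 c'.1 0 = s.nat 9 c'.2 0 → side c'.1 →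
        ¬ side c'.2 → (s'.setNat c 0 0 v).nat 9 c'.1 0 ≠ (s'.setNat c 0 0 v).nat 9 c'.2 0) := by
      intro c h1 h9 h10
      have g1 := Mem.setNat_nat_of_ne s' c 0 0 (v := v) h1.symm
      have g9 := Mem.setNat_nat_of_ne s' c 0 0 (v := v) h9.symm
      have g10 := Mem.setNat_nat_of_ne s' c 0 0 (v := v) h10.symm
      obtain ⟨⟨⟨a1, a2, a3⟩, a4, a5⟩, a6⟩ := hs
      refine ⟨⟨⟨?_, ?_, ?_⟩, ?_, fun j => ?_⟩, ?_⟩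
      · rw [g9, g10]; exact a1
      · rw [g1, g10]; exact a2
      · rw [g1, g9]; exact a3
      · rw [g1]; exact a4
      · rcases a5 j with ⟨b1, b2⟩ | ⟨b1, b2, b3, b4, b5, b6, b7, b8⟩
        · exact Or.inl ⟨by rw [g1]; exact b1, by rw [g9]; exact b2⟩
        · exact Or.inr ⟨b1, by rw [g1]; exact b2, by rw [g1]; exact b3, b4, by rw [g1]; exact b5,
            by rw [g1]; exact b6, by rw [g1, g9]; exact b7, by rw [g1, g9]; exact b8⟩
      · rw [g9]; exact a6
    exact ⟨e 4 (by decide) (by decide) (by decide), e 5 (by decide) (by decide) (by decide)⟩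
  · rintro p q s' hag hp hq ⟨I1, I2⟩
    have hin := h.of_agree hag (by decide) (by decide)
    have e13 := hag.nat 13 (by decide)
    have e14 := hag.nat 14 (by decide)
    have e12 := hag.real 12 (by decide)
    have h13' : s'.nat 13 0 0 = i := by rw [e13, h13]
    have h14' : s'.nat 14 0 0 = a := by rw [e14, h14]
    have ht : (Test.conj sameLeaf (.conj (leftSide 4) (.neg (leftSide 5)))).holds s' ↔
        s'.nat 9 p 0 = s'.nat 9 q 0 ∧ side p ∧ ¬ side q := by
      change (s'.nat 9 (s'.nat 4 0 0) 0 ≤ s'.nat 9 (s'.nat 5 0 0) 0 ∧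
        s'.nat 9 (s'.nat 5 0 0) 0 ≤ s'.nat 9 (s'.nat 4 0 0) 0) ∧
        (leftSide 4).holds s' ∧ ¬ (leftSide 5).holds s' ↔ _
      rw [leftSide_holds hin h13' h14' hp, leftSide_holds hin h13' h14' hq, hp, hq,
        ← le_antisymm_iff]
    rw [forall_before_succ]
    unfold trySplit
    rw [run]
    split_ifs with hc
    · obtain ⟨h1, h2, h3⟩ := ht.1 hc
      have hsp := splitLeaf_spec u hin h13' h14' hp
      obtain ⟨g1, g2, g3⟩ := I1.step h1 h2 h3 (by rw [e13]) (by rw [e12]) hsp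
      refine ⟨g3, fun c hcb hl hs1 hs2 => ?_, fun _ _ _ => ?_⟩
      · have hne := I2 c hcb hl hs1 hs2
        have hl1 := I1.inv.lt c.1
        have hl2 := I1.inv.lt c.2
        by_cases k1 : s'.nat 9 c.1 0 = s'.nat 9 p 0
        · rw [hsp.move_left _ k1 hs1, hsp.stay c.2 (fun k2 => hne (k1.trans k2.symm))]
          omega
        · rw [hsp.stay _ k1]
          by_cases k2 : s'.nat 9 c.2 0 = s'.nat 9 p 0
          · rw [hsp.move_right _ k2 hs2]; omega
          · rw [hsp.stay _ k2]; exact hne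
      · rw [hsp.move_left p rfl h2, hsp.move_right q h1.symm h3]
        omega
    · exact ⟨I1, I2, fun _ h2 h3 h1 => hc (ht.2 ⟨h1, h2, h3⟩)⟩

end Split

/-! ### The stored tree -/

section StoredTree

variable {d k : ℕ} {C : Fin k → Pt d}

/-- The memory holds, at the address `v`, the preimage of the tree `T`, and the centers with index
in `S` are at the addresses of their leaves, which contain no other centers. -/
def Rep (C : Fin k → Pt d) (s : Mem) : ThresholdTree d → ℕ → Set (Fin k) → Prop
  | .leaf, v, S => s.nat 1 v 0 = 0 ∧ S.Nonempty ∧ ∀ j : Fin k, s.nat 9 j 0 = v ↔ j ∈ S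
  | .node i θ l r, v, S => s.nat 1 v 0 = 1 ∧ s.nat 1 v 1 = i ∧
      s.real 2 v 0 = embedInv (coords C i) θ ∧
      Rep C s l (s.nat 1 v 2) {j ∈ S | termEmbed C (C j) i ≤ θ} ∧
      Rep C s r (s.nat 1 v 3) {j ∈ S | θ < termEmbed C (C j) i}

lemma Rep.congr {s s' : Mem} (h1 : s'.nat 1 = s.nat 1) (h9 : s'.nat 9 = s.nat 9)
    (h2 : s'.real 2 = s.real 2) {T : ThresholdTree d} {v : ℕ} {S : Set (Fin k)}
    (h : Rep C s T v S) : Rep C s' T v S := by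
  induction T generalizing v S with
  | leaf => unfold Rep at h ⊢; rw [h1, h9]; exact h
  | node i θ l r ihl ihr =>
    obtain ⟨a1, a2, a3, a4, a5⟩ := h
    unfold Rep
    rw [h1, h2]
    exact ⟨a1, a2, a3, ihl a4, ihr a5⟩

lemma Rep.stores {s : Mem} {T : ThresholdTree d} {v : ℕ} {S : Set (Fin k)}
    (h : Rep C s T v S) : Stores s v (pullTree C T) := by
  induction T generalizing v S with
  | leaf => exact Stores.leaf h.1
  | node i θ l r ihl ihr =>
    obtain ⟨a1, a2, a3, a4, a5⟩ := h
    unfold pullTree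
    rw [← a3]
    exact Stores.node a1 a2 (ihl a4) (ihr a5)

lemma Rep.leafOf_eq {s : Mem} {T : ThresholdTree d} {v : ℕ} {S : Set (Fin k)} (h : Rep C s T v S)
    {p q : Fin k} (hp : p ∈ S) (hpq : s.nat 9 q 0 = s.nat 9 p 0) :
    q ∈ S ∧ T.leafOf (termEmbed C (C q)) = T.leafOf (termEmbed C (C p)) := by
  induction T generalizing v S with
  | leaf =>
    unfold Rep at h
    obtain ⟨-, -, h3⟩ := h
    refine ⟨(h3 q).1 ?_, by simp only [ThresholdTree.leafOf]⟩
    rw [hpq]; exact (h3 p).2 hp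
  | node i θ l r ihl ihr =>
    unfold Rep at h
    obtain ⟨-, -, -, a4, a5⟩ := h
    by_cases hc : termEmbed C (C p) i ≤ θ
    · obtain ⟨⟨h1, h2⟩, h3⟩ := ihl a4 ⟨hp, hc⟩
      exact ⟨h1, by simp only [ThresholdTree.leafOf, if_pos hc, if_pos h2, h3]⟩
    · obtain ⟨⟨h1, h2⟩, h3⟩ := ihr a5 ⟨hp, not_le.1 hc⟩
      exact ⟨h1, by simp only [ThresholdTree.leafOf, if_neg hc, if_neg (not_le.2 h2), h3]⟩

lemma Rep.addr_eq {s : Mem} {T : ThresholdTree d} {v : ℕ} {S : Set (Fin k)} (h : Rep C s T v S)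
    {p q : Fin k} (hp : p ∈ S) (hq : q ∈ S)
    (hpq : T.leafOf (termEmbed C (C p)) = T.leafOf (termEmbed C (C q))) :
    s.nat 9 p 0 = s.nat 9 q 0 := by
  induction T generalizing v S with
  | leaf => rw [(h.2.2 p).2 hp, (h.2.2 q).2 hq]
  | node i θ l r ihl ihr =>
    obtain ⟨-, -, -, a4, a5⟩ := h
    simp only [ThresholdTree.leafOf] at hpq
    by_cases h1 : termEmbed C (C p) i ≤ θ <;> by_cases h2 : termEmbed C (C q) i ≤ θ <;>
      simp [h1, h2] at hpq
    · exact ihl a4 ⟨hp, h1⟩ ⟨hq, h2⟩ hpq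
    · exact ihr a5 ⟨hp, not_le.1 h1⟩ ⟨hq, not_le.1 h2⟩ hpq

lemma Rep.sameAddr_eq {s : Mem} {T : ThresholdTree d} {v : ℕ} (h : Rep C s T v Set.univ) :
    SameAddr s = centerRel (fun j => termEmbed C (C j)) T := by
  funext p q
  refine propext ⟨fun hpq => ((h.leafOf_eq trivial hpq.symm).2).symm, fun hpq => ?_⟩
  exact h.addr_eq trivial trivial hpq

lemma Rep.split {s s' : Mem} {w : Cut d} {side : Fin k → Prop}
    (hside : ∀ j, side j ↔ termEmbed C (C j) w.1 ≤ w.2) (h13 : s.nat 13 0 0 = w.1)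
    (h12 : s.real 12 0 0 = embedInv (coords C w.1) w.2) (hs : FullSplit side s s')
    {T : ThresholdTree d} {v : ℕ} {S : Set (Fin k)} (h : Rep C s T v S) :
    Rep C s' (splitLeaves (fun j => termEmbed C (C j)) w T S) v S := by
  induction T generalizing v S with
  | leaf =>
    obtain ⟨-, ⟨j, hj⟩, a3⟩ := h
    have hv := (a3 j).2 hj
    unfold splitLeaves
    split_ifs with hc
    · obtain ⟨⟨p, hp, hp'⟩, q, hq, hq'⟩ := hc
      have hsp := hs.full j ⟨⟨p, by rw [hv, a3]; exact hp, (hside p).2 hp'⟩,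
        q, by rw [hv, a3]; exact hq, fun hcon => absurd ((hside q).1 hcon) (not_le.2 hq')⟩
      rw [hv] at hsp
      refine ⟨hsp.kind, by rw [hsp.coord, h13], by rw [hsp.threshold, h12],
        ⟨hsp.left_kind, ⟨p, hp, hp'⟩, fun j => ?_⟩, ⟨hsp.right_kind, ⟨q, hq, hq'⟩, fun j => ?_⟩⟩
      · rw [hsp.left, a3, hside]; rfl
      · rw [hsp.right, a3, hside, not_le]; rfl
    · rcases hs.part.leaf j with hu | hsp
      · rw [hv] at hu
        exact ⟨hu.1, ⟨j, hj⟩, fun j' => by rw [hu.2, a3]⟩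
      · obtain ⟨⟨p, hp, hp'⟩, q, hq, hq'⟩ := hsp.both
        rw [hv, a3] at hp hq
        exact absurd ⟨⟨p, hp, (hside p).1 hp'⟩, q, hq, not_le.1 fun h' => hq' ((hside q).2 h')⟩ hc
  | node i θ l r ihl ihr =>
    obtain ⟨a1, a2, a3, a4, a5⟩ := h
    obtain ⟨b1, b2⟩ := hs.part.node v (by omega)
    unfold splitLeaves Rep
    rw [b1, b1, b1, b1, b2]
    exact ⟨a1, a2, a3, ihl a4, ihr a5⟩

/-- Nothing is split after all centers have been separated. -/
lemma Rep.unchanged {s s' : Mem} {side : Fin k → Prop} (hs : FullSplit side s s')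
    (hsep : ∀ p q : Fin k, s.nat 9 p 0 = s.nat 9 q 0 → p = q)
    {T : ThresholdTree d} {v : ℕ} {S : Set (Fin k)} (h : Rep C s T v S) : Rep C s' T v S := by
  induction T generalizing v S with
  | leaf =>
    obtain ⟨-, ⟨j, hj⟩, a3⟩ := h
    have hv := (a3 j).2 hj
    rcases hs.part.leaf j with hu | hsp
    · rw [hv] at hu
      exact ⟨hu.1, ⟨j, hj⟩, fun j' => by rw [hu.2, a3]⟩
    · obtain ⟨⟨p, hp, hp'⟩, q, hq, hq'⟩ := hsp.both
      rw [hsep p q (hp.trans hq.symm)] at hp'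
      exact absurd hp' hq'
  | node i θ l r ihl ihr =>
    obtain ⟨a1, a2, a3, a4, a5⟩ := h
    obtain ⟨b1, b2⟩ := hs.part.node v (by omega)
    unfold Rep
    rw [b1, b1, b1, b1, b2]
    exact ⟨a1, a2, a3, ihl a4, ihr a5⟩

end StoredTree

/-! ### The program for the random cut algorithm -/

namespace LoopProg

/-- Choose a random cut. -/
def chooseCut : LoopProg :=
  .seq computeDiam (.seq weighCells (.seq chooseCell computeThreshold))

/-- One round of the random cut algorithm. After all centers have been separated, all weights are `0`
and a cell chosen before is used again, but then no leaf is split. -/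
def round : LoopProg := .seq chooseCut splitAll

/-- The random cut algorithm on the images of the centers, where the stored tree consists of the
preimages of the chosen cuts. It does not read the data points. -/
def randomCut : LoopProg :=
  .seq (.setNat 10 (.lit 0) (.lit 0) (.lit 1))
    (.seq computeCells (.seq computeDists (.loop 7 2 round)))

end LoopProg

section RandomCut

open LoopProg

variable {d k : ℕ} {C : Fin k → Pt d} (u : ℕ → ℝ)

/-- The chosen cell in the memory is given by a coordinate and a center. This also holds in the
rounds in which no cell has positive weight. -/
def CellValid (d k : ℕ) (s : Mem) : Prop :=
  (∃ i : Fin d, s.nat 13 0 0 = i) ∧ ∃ a : Fin k, s.nat 14 0 0 = a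

lemma CellValid.of_agree {N R : List ℕ} {s s' : Mem} (h : CellValid d k s) (ha : Agree N R s s')
    (h13 : 13 ∉ N) (h14 : 14 ∉ N) : CellValid d k s' := by
  unfold CellValid
  rw [ha.nat 13 h13, ha.nat 14 h14]
  exact h

lemma chooseCell_valid {s : Mem} (hin : HoldsInput C s) (h : CellValid d k s) :
    CellValid d k (chooseCell.run u s) := by
  have hag := agree_run u (.seq (.sample 10 (.lit 0) (.lit 0))
    (.setReal 10 (.lit 0) (.lit 0) (.mul (.var 10) (.var 9)))) s
  have hin' := hin.of_agree hag (by decide) (by decide)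
  refine loop_loop_induct u (c := 2) (b := 1) (c' := 3) (b' := 2) (p := tryCell) (m := d) (n := k)
    (fun _ _ s' => CellValid d k s') rfl hin'.dim hin'.card
    (fun _ _ _ _ h => by simpa [CellValid] using h) (h.of_agree hag (by decide) (by decide))
    (fun _ _ h => h) ?_
  intro i a s' _ hi ha hv
  unfold tryCell
  rw [run]
  split_ifs
  · exact ⟨⟨i, by simp [run, NExpr.eval, hi]⟩, ⟨a, by simp [run, NExpr.eval, ha]⟩⟩
  · exact hv

lemma chooseCell_drawn (s : Mem) : (chooseCell.run u s).drawn = s.drawn + 1 :=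
  run_drawn u (.seq (.setReal 10 (.lit 0) (.lit 0) (.mul (.var 10) (.var 9)))
    (.loop 2 1 (.loop 3 2 tryCell))) rfl _

lemma chooseCut_drawn (s : Mem) : (chooseCut.run u s).drawn = s.drawn + 1 := by
  unfold chooseCut
  rw [run_seq, run_seq, run_seq, run_drawn u computeThreshold rfl, chooseCell_drawn,
    run_drawn u weighCells rfl, run_drawn u computeDiam rfl]

lemma chooseCut_valid {s : Mem} (hin : HoldsInput C s) (h : CellValid d k s) :
    CellValid d k (chooseCut.run u s) := by
  have hag := agree_run u (.seq computeDiam weighCells) s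
  have hv := chooseCell_valid u (hin.of_agree hag (by decide) (by decide))
    (h.of_agree hag (by decide) (by decide))
  exact hv.of_agree (agree_run u computeThreshold _) (by decide) (by decide)

/-- The program chooses a cell that contains the cut chosen by `cellPick`. -/
lemma chooseCut_spec (hk : 0 < k) {s : Mem} (h : HoldsDists C s) (w₀ : Cut d)
    (hW : 0 < totalWeight (roundWt C (SameAddr s))) (hu : u s.drawn ∈ Set.Ico (0 : ℝ) 1) :
    ∃ a : Fin k, (chooseCut.run u s).nat 13 0 0 = (cellPick C (SameAddr s) w₀ (u s.drawn)).1 ∧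
      (chooseCut.run u s).nat 14 0 0 = a ∧
      (chooseCut.run u s).real 12 0 0 =
        embedInv (coords C (cellPick C (SameAddr s) w₀ (u s.drawn)).1)
          (cellPick C (SameAddr s) w₀ (u s.drawn)).2 ∧
      ∀ j, C j (cellPick C (SameAddr s) w₀ (u s.drawn)).1 ≤
          C a (cellPick C (SameAddr s) w₀ (u s.drawn)).1 ↔
        termEmbed C (C j) (cellPick C (SameAddr s) w₀ (u s.drawn)).1 ≤
          (cellPick C (SameAddr s) w₀ (u s.drawn)).2 := by
  set E : Fin k → Fin k → Prop := SameAddr s with hE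
  set s₁ := computeDiam.run u s with hs₁
  have ag₁ : Agree _ _ s s₁ := agree_run u computeDiam s
  have h₁ := h.of_agree ag₁ (by decide) (by decide) (by decide) (by decide) (by decide)
  have hE₁ : SameAddr s₁ = E := SameAddr.of_agree ag₁ (by decide)
  have hd₁ : s₁.drawn = s.drawn := run_drawn u computeDiam rfl s
  set s₂ := weighCells.run u s₁ with hs₂
  have ag₂ : Agree _ _ s₁ s₂ := agree_run u weighCells s₁
  have hE₂ : SameAddr s₂ = E := (SameAddr.of_agree ag₂ (by decide)).trans hE₁
  have hd₂ : s₂.drawn = s.drawn := (run_drawn u weighCells rfl s₁).trans hd₁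
  have h₂ : HoldsWeights C s₂ := weighCells_spec u h₁ (by rw [hE₁]; exact computeDiam_spec u h)
  obtain ⟨c, hc⟩ := exists_mem_cellRange (roundWt_nonneg C E)
    (r := u s.drawn * totalWeight (roundWt C E)) (mul_nonneg hu.1 hW.le)
    (mul_lt_of_lt_one_left hW hu.2)
  have hspec := chooseCell_spec u h₂ (c := c) (by rw [hE₂, hd₂]; exact hc)
  rw [hE₂, hd₂] at hspec
  set s₃ := chooseCell.run u s₂ with hs₃
  have ag₃ : Agree _ _ s₂ s₃ := agree_run u chooseCell s₂
  have h₃ := h₂.dists.of_agree ag₃ (by decide) (by decide) (by decide) (by decide) (by decide)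
  obtain ⟨k13, k14, k11⟩ := hspec
  have hpick : cellPick C E w₀ (u s.drawn) = (c.1, cellBase C c + s₃.real 11 0 0) := by
    unfold cellPick
    rw [allocate_of_mem (roundWt_nonneg C E) hc, k11]
  have hle : roundWt C E c ≤ cellWt C c := by
    unfold roundWt; split_ifs
    · exact le_rfl
    · exact cellWt_nonneg C c
  have hθ : cellBase C c + s₃.real 11 0 0 ∈ cellIco C c := by
    have h1 := hc.1
    have h2 := hc.2
    exact ⟨by rw [k11]; linarith, by rw [k11]; linarith⟩
  have hthr := computeThreshold_spec u hk h₃.cells k13 k14 hθ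
  have hrun : chooseCut.run u s = computeThreshold.run u s₃ := rfl
  have ag₄ := agree_run u computeThreshold s₃
  rw [hpick, hrun, hthr, ag₄.nat 13 (by decide), ag₄.nat 14 (by decide)]
  refine ⟨c.2, k13, k14, rfl, fun j => ?_⟩
  rw [← not_lt, ← not_lt, lt_termEmbed_iff_of_mem hk hθ]

/-- The memory after `t` rounds, with the tree `T`. -/
structure RoundInv (C : Fin k → Pt d) (T : ThresholdTree d) (t : ℕ) (s : Mem) : Prop where
  dists : HoldsDists C s
  leaves : LeafInv k s
  rep : Rep C s T 0 Set.univ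
  valid : CellValid d k s
  drawn : s.drawn = t

lemma round_spec (hk : 0 < k) (hC : Function.Injective C) (w₀ : Cut d) (hu : u ∈ Seeds) {t : ℕ}
    {s : Mem} (h : RoundInv C (treeSeq (fun j => termEmbed C (C j))
      (relPick (fun E => cellPick C E w₀) fun j => termEmbed C (C j)) u t) t s) :
    RoundInv C (treeSeq (fun j => termEmbed C (C j))
      (relPick (fun E => cellPick C E w₀) fun j => termEmbed C (C j)) u (t + 1)) (t + 1)
      (round.run u s) := by
  set T := treeSeq (fun j => termEmbed C (C j))
      (relPick (fun E => cellPick C E w₀) fun j => termEmbed C (C j)) u t with hT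
  have hE := h.rep.sameAddr_eq
  set s₁ := chooseCut.run u s with hs₁
  have hrun : round.run u s = splitAll.run u s₁ := rfl
  have ag₁ : Agree _ _ s s₁ := agree_run u chooseCut s
  have h1 := ag₁.nat 1 (by decide)
  have h9 := ag₁.nat 9 (by decide)
  have h10 := ag₁.nat 10 (by decide)
  have h2 := ag₁.real 2 (by decide)
  have hd₁ := h.dists.of_agree ag₁ (by decide) (by decide) (by decide) (by decide) (by decide)
  have hrep₁ : Rep C s₁ T 0 Set.univ := h.rep.congr h1 h9 h2
  have hinv₁ : LeafInv k s₁ := by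
    obtain ⟨a1, a2, a3⟩ := h.leaves
    exact ⟨by rw [h9, h10]; exact a1, by rw [h1, h10]; exact a2, by rw [h1, h9]; exact a3⟩
  have hval := chooseCut_valid u h.dists.cells.input h.valid
  have ag₂ := agree_run u splitAll s₁
  have hdrawn : (splitAll.run u s₁).drawn = t + 1 := by
    rw [run_drawn u splitAll rfl, chooseCut_drawn, h.drawn]
  rw [hrun]
  suffices hmain : LeafInv k (splitAll.run u s₁) ∧ Rep C (splitAll.run u s₁)
      (treeSeq (fun j => termEmbed C (C j))
        (relPick (fun E => cellPick C E w₀) fun j => termEmbed C (C j)) u (t + 1)) 0 Set.univ from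
    ⟨hd₁.of_agree ag₂ (by decide) (by decide) (by decide) (by decide) (by decide), hmain.1, hmain.2,
      hval.of_agree ag₂ (by decide) (by decide), hdrawn⟩
  unfold treeSeq
  rw [← hT]
  by_cases hsep : AllSeparated (fun j => termEmbed C (C j)) T
  · rw [if_pos hsep]
    obtain ⟨⟨i, hi⟩, a, ha⟩ := hval
    have hfull := splitAll_spec u hd₁.cells.input hi ha hinv₁
    refine ⟨hfull.part.inv, hrep₁.unchanged hfull fun p q hpq => ?_⟩
    have hpq' : centerRel (fun j => termEmbed C (C j)) T p q := by
      rw [← hrep₁.sameAddr_eq]; exact hpq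
    exact hC (termEmbed_injective hk C (hsep (p, q) hpq'))
  · rw [if_neg hsep]
    have hW := totalWeight_roundWt_pos hk hC hsep
    rw [← hE] at hW
    obtain ⟨a, k13, k14, k12, hside⟩ := chooseCut_spec u hk h.dists w₀ hW (hu _)
    have hfull := splitAll_spec u hd₁.cells.input k13 k14 hinv₁
    rw [h.drawn] at k13 k12 hside hfull
    have := hrep₁.split hside k13 k12 hfull
    rw [hE] at this hfull
    exact ⟨hfull.part.inv, this⟩

lemma randomCut_stores (hd : 0 < d) (hk : 0 < k) (hC : Function.Injective C) (w₀ : Cut d)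
    (hu : u ∈ Seeds) {n : ℕ} (X : Fin n → Pt d) :
    Stores (randomCut.run u (inputMem X C)) 0 (pullTree C (finalTree C w₀ u)) := by
  set s₁ := (inputMem X C).setNat 10 0 0 1 with hs₁
  have hin : HoldsInput C s₁ := ⟨by simp [hs₁, inputMem], by simp [hs₁, inputMem], fun j i => by
    simp [hs₁, inputMem]⟩
  set s₂ := computeDists.run u (computeCells.run u s₁) with hs₂
  have hd₂ : HoldsDists C s₂ := computeDists_spec u hk (computeCells_spec u hin)
  have ag : Agree _ _ s₁ s₂ := agree_run u (.seq computeCells computeDists) s₁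
  have hrun : randomCut.run u (inputMem X C) = (loop 7 2 round).run u s₂ := rfl
  have h1 : ∀ v i, s₂.nat 1 v i = 0 := fun v i => by
    rw [ag.nat 1 (by decide)]; simp [hs₁, inputMem]
  have h9 : ∀ v i, s₂.nat 9 v i = 0 := fun v i => by
    rw [ag.nat 9 (by decide)]; simp [hs₁, inputMem]
  have h10 : s₂.nat 10 0 0 = 1 := by rw [ag.nat 10 (by decide)]; simp [hs₁]
  have h13 : s₂.nat 13 0 0 = 0 := by rw [ag.nat 13 (by decide)]; simp [hs₁, inputMem]
  have h14 : s₂.nat 14 0 0 = 0 := by rw [ag.nat 14 (by decide)]; simp [hs₁, inputMem]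
  have key := loop_fin_induct u (c := 7) (b := 2) (p := round) (s := s₂) (n := k)
    (fun t s => RoundInv C (treeSeq (fun j => termEmbed C (C j))
      (relPick (fun E => cellPick C E w₀) fun j => termEmbed C (C j)) u t) t s)
    rfl hd₂.cells.input.card (fun t s v h => ?_) ?_ ?_
  · rw [hrun]; exact key.rep.stores
  · have ag' : Agree [7] [] s (s.setNat 7 0 0 v) :=
      ⟨fun a ha => Mem.setNat_nat_of_ne _ _ _ _ (by simpa using ha), fun _ _ => rfl⟩
    have g1 := ag'.nat 1 (by decide)
    have g9 := ag'.nat 9 (by decide)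
    have g10 := ag'.nat 10 (by decide)
    obtain ⟨a1, a2, a3⟩ := h.leaves
    exact ⟨h.dists.of_agree ag' (by decide) (by decide) (by decide) (by decide) (by decide),
      ⟨by rw [g9, g10]; exact a1, by rw [g1, g10]; exact a2, by rw [g1, g9]; exact a3⟩,
      h.rep.congr g1 g9 rfl, h.valid.of_agree ag' (by decide) (by decide), h.drawn⟩
  · refine ⟨hd₂, ⟨fun j => ?_, fun v _ => h1 v 0, fun j => h1 _ _⟩,
      ⟨h1 _ _, ⟨⟨0, hk⟩, trivial⟩, fun j => ⟨fun _ => trivial, fun _ => h9 _ _⟩⟩,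
      ⟨⟨⟨0, hd⟩, h13⟩, ⟨0, hk⟩, h14⟩, ?_⟩
    · rw [h9, h10]; exact one_pos
    · exact run_drawn u (.seq computeCells computeDists) rfl s₁
  · intro t s' _ _ h
    exact round_spec u hk hC w₀ hu h

end RandomCut

end

end ExplainableKMeans

open MeasureTheory ExplainableKMeans

theorem theorem2 :
    ∃ (P : Prog) (q : Polynomial ℕ) (A : ℝ),
      ∀ (d k : ℕ) (C : Fin k → Pt d), 1 ≤ d → 1 ≤ k → Function.Injective C →
        ∃ (φ : Pt d → Pt d) (pick : ThresholdTree d → ℝ → Cut d),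
          CutPreserving φ ∧
          IsTerminalEmbedding φ (Set.range C) (8 * (k : ℝ)) ∧
          IsUniformChoice (fun j => φ (C j)) pick ∧
          ∀ (n : ℕ) (X : Fin n → Pt d),
            ∃ T : (ℕ → ℝ) → ThresholdTree d,
              (∀ u ∈ Seeds,
                Outputs P X C u (q.eval (k + d)) (T u) ∧
                (∃ T' : ThresholdTree d, Returns (fun j => φ (C j)) pick u T' ∧ IsPullback φ T' (T u)) ∧
                (T u).numLeaves = k ∧
                Function.Injective (fun j => (T u).leafOf (C j))) ∧
              Integrable (fun u => treeCost X (T u)) seedMeasure ∧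
              ∫ u, treeCost X (T u) ∂seedMeasure ≤
                A * ((k : ℝ) * max 1 (Real.log k) * max 1 (Real.log (Real.log k))) *
                  centersCost X C := by
  refine ⟨LoopProg.randomCut.compile, LoopProg.randomCut.cost, 64008, fun d k C hd hk hC => ?_⟩
  let w₀ : Cut d := (⟨0, hd⟩, 0)
  have hinj : Function.Injective fun j => termEmbed C (C j) := (termEmbed_injective hk C).comp hC
  have hpick := cellPick_isUniformChoice hk hC w₀
  refine ⟨termEmbed C, relPick (fun E => cellPick C E w₀) fun j => termEmbed C (C j),
    termEmbed_cutPreserving hk C, termEmbed_isTerminalEmbedding hk C, hpick, fun n X => ?_⟩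
  refine ⟨fun u => pullTree C (finalTree C w₀ u), fun u hu => ⟨?_, ?_, ?_, ?_⟩,
    integrable_treeCost_finalTree w₀ X hk hC, ?_⟩
  · obtain ⟨t, ht, he⟩ := LoopProg.exec_compile u LoopProg.randomCut rfl (k + d) (inputMem X C)
      (by simp [inputMem]) (by simp [inputMem])
    exact ⟨t, _, ht, he, randomCut_stores u hd hk hC w₀ hu X⟩
  · exact ⟨finalTree C w₀ u, ⟨k, treeSeq_allSeparated hk hpick hu, rfl⟩,
      isPullback_pullTree hk C _⟩
  · rw [numLeaves_pullTree]
    exact treeSeq_numLeaves_eq hinj hk hpick hu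
  · intro p q hpq
    simp only [leafOf_pullTree hk] at hpq
    exact hinj (treeSeq_allSeparated hk hpick hu (p, q) hpq)
  · exact integral_treeCost_finalTree_le w₀ X hk hC
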